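/- **Setting.** Let $X$ be a complete, connected, oriented $C^\infty$ Riemannian manifold of dimension $d$ with volume measure $m$, $m(X)=\infty$. Let $\Gamma_X$ be the space of locally finite subsets (configurations) $\gamma\subset X$, with the vague topology and its Borel $\sigma$-algebra; $\langle f,\gamma\rangle=\sum_{x\in\gamma}f(x)$, and $\gamma\pm\varepsilon_x$ is $\gamma$ with the point $x$ added/removed. Put $T_\gamma\Gamma_X=\bigoplus_{x\in\gamma}T_xX$; a form of order $n$ is a map $W$ with $W(\gamma)\in\wedge^n(T_\gamma\Gamma_X)$ ($n$-th antisymmetric tensor power of the Hilbert space $T_\gamma\Gamma_X$). Let $\nabla^\Gamma W(\gamma)=(\nabla^X_xW(\gamma))_{x\in\gamma}\in T_\gamma\Gamma_X\otimes\wedge^n(T_\gamma\Gamma_X)$, where $\nabla^X_xW(\gamma)$ is the covariant derivative at $y=x$ of $y\mapsto W(\gamma-\varepsilon_x+\varepsilon_y)$ for the connection induced by the Levi-Civita connection of $X$. Let $\mu$ be a probability measure on $\Gamma_X$ with $\int\langle\varphi,\gamma\rangle^k\,\mu(d\gamma)<\infty$ for all $k\in\mathbb N$ and all continuous compactly supported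 $\varphi\ge0$, and let $\sigma(\gamma,dx)$ be an ($s$-finite) kernel from $\Gamma_X$ to $X$ such that $$\int\mu(d\gamma)\sum_{x\in\gamma}F(\gamma,x)=\int\mu(d\gamma)\int\sigma(\gamma,dx)\,F(\gamma+\varepsilon_x,x)$$ for all measurable $F\ge0$, $\sigma(\gamma,\cdot)\ll m$ for $\mu$-a.e. $\gamma$, and $\rho(\gamma,x)=\frac{d\sigma(\gamma,\cdot)}{dm}(x)>0$ for $\mu\otimes m$-a.e. $(\gamma,x)$. Put $$\mu^{(k)}(d\gamma,dx_1,\dots,dx_k)=\mu(d\gamma)\,\sigma(\gamma,dx_1)\,\sigma(\gamma+\varepsilon_{x_1},dx_2)\cdots\sigma(\gamma+\varepsilon_{x_1}+\dots+\varepsilon_{x_{k-1}},dx_k).$$ For distinct $x_1,\dots,x_k\in X$ let $\mathbb T^{(n)}_{\{x_1,\dots,x_k\}}X^k=\bigoplus_{l_1,\dots,l_k\ge1,\ l_1+\dots+l_k=n}(T_{x_1}X)^{\wedge l_1}\wedge\dots\wedge(T_{x_k}X)^{\wedge l_k}\subset\wedge^n(T_{(x_1,\dots,x_k)}X^k)$,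 and for $\{x_1,\dots,x_k\}\subset\gamma$ let $W_k(\gamma,x_1,\dots,x_k)$ be the projection of $W(\gamma)$ onto this space. Let $\mathcal D\Omega^n$ be the linear span of the forms $W$ for which there are $1\le k\le n$, $F$ and $\omega$ with $$W_k(\gamma,x_1,\dots,x_k)=(k!)^{1/2}F(\gamma-\varepsilon_{x_1}-\dots-\varepsilon_{x_k})\,\omega(x_1,\dots,x_k),\qquad W_l=0\ (l\neq k),$$ where $F(\gamma)=g(\langle\varphi_1,\gamma\rangle,\dots,\langle\varphi_N,\gamma\rangle)$ with $g\in C^\infty_{\mathrm b}(\mathbb R^N)$, $\varphi_i\in C_0^\infty(X)$, and $\omega$ is a smooth compactly supported $n$-form on $X^k$ which at all tuples of distinct points takes values in $\mathbb T^{(n)}_{\{x_1,\dots,x_k\}}X^k$ and is invariant under permutations of $x_1,\dots,x_k$. For $W^{(1)},W^{(2)}\in\mathcal D\Omega^n$ put $$\mathcal E^{\mathrm B}_{\mu,n}(W^{(1)},W^{(2)})=\int_{\Gamma_X}\langle\nabla^\Gamma W^{(1)}(\gamma),\nabla^\Gamma W^{(2)}(\gamma)\rangle_{T_\gamma\Gamma_X\otimes\wedge^n(T_\gamma\Gamma_X)}\,\mu(d\gamma),$$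 and $I^nW=(I^n_kW)_{k=1}^n$, $I^n_kW(\gamma,x_1,\dots,x_k)=(k!)^{-1/2}\,W_k(\gamma+\varepsilon_{x_1}+\dots+\varepsilon_{x_k},x_1,\dots,x_k)$, regarded up to equality $\mu^{(k)}$-a.e. for each $k$. Let $\widetilde{\mathcal E}^{\mathrm B}_{\mu,n}$ be the image of $\mathcal E^{\mathrm B}_{\mu,n}$ under $I^n$, i.e. $\widetilde{\mathcal E}^{\mathrm B}_{\mu,n}(I^nW^{(1)},I^nW^{(2)})=\mathcal E^{\mathrm B}_{\mu,n}(W^{(1)},W^{(2)})$. **Proposition 3.8.** Let $\mathcal W^{(1)},\mathcal W^{(2)}\in I^n(\mathcal D\Omega^n)$. Then $\widetilde{\mathcal E}^{\mathrm B}_{\mu,n}(\mathcal W^{(1)},\mathcal W^{(2)})$ is well defined, all integrals involved are absolutely convergent, and $$\begin{aligned}\widetilde{\mathcal E}^{\mathrm B}_{\mu,n}(\mathcal W^{(1)},\mathcal W^{(2)})=\sum_{k=1}^n\int_{\Gamma_X\times X^k}\mu^{(k)}(d\gamma,dx_1,\dots,dx_k)\Big[&\big\langle\nabla^\Gamma_\gamma\mathcal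 W^{(1)}(\gamma,x_1,\dots,x_k),\nabla^\Gamma_\gamma\mathcal W^{(2)}(\gamma,x_1,\dots,x_k)\big\rangle_{T_\gamma\Gamma_X\otimes\mathbb T^{(n)}_{\{x_1,\dots,x_k\}}X^k}\\&+\big\langle\nabla^{X^k}_{(x_1,\dots,x_k)}\mathcal W^{(1)}(\gamma,x_1,\dots,x_k),\nabla^{X^k}_{(x_1,\dots,x_k)}\mathcal W^{(2)}(\gamma,x_1,\dots,x_k)\big\rangle_{T_{(x_1,\dots,x_k)}X^k\otimes\mathbb T^{(n)}_{\{x_1,\dots,x_k\}}X^k}\Big].\end{aligned}$$ Here, for fixed distinct $x_1,\dots,x_k$, $\nabla^\Gamma_\gamma$ is the gradient in $\gamma$ of the map $\gamma\mapsto\mathcal W(\gamma,x_1,\dots,x_k)$ with values in the fixed space $\mathbb T^{(n)}_{\{x_1,\dots,x_k\}}X^k$ (the family, over $z\in\gamma$, of the gradients at $y=z$ of $y\mapsto\mathcal W(\gamma-\varepsilon_z+\varepsilon_y,x_1,\dots,x_k)$), and $\nabla^{X^k}_{(x_1,\dots,x_k)}$ is the covariant gradient of forms on the Riemannian product $X^k$;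 both gradients are those of the pointwise defined representatives in $I^n(\mathcal D\Omega^n)$. -/

import Mathlib

open Set MeasureTheory ProbabilityTheory Manifold Bundle Topology
open scoped ContDiff CompactlySupported

noncomputable section

/-! ### The Riemannian manifold `X`: charts, volume measure, Levi-Civita connection -/

/-- The Christoffel operator at `p` of a (variable) metric `G` on a normed space `F`
(`G q u v` is the inner product of `u, v` at the point `q`): `christoffel G p u v` is the vector
`Γ_p(u, v)` determined by
`2 G_p(Γ_p(u, v), z) = ∂_u G(v, z) + ∂_v G(u, z) - ∂_z G(u, v)` for all `z`. -/
def christoffel {F : Type*} [NormedAddCommGroup F] [NormedSpace ℝ F]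
    (G : F → F → F → ℝ) (p u v : F) : F :=
  Classical.epsilon fun w => ∀ z : F,
    2 * G p w z =
      fderiv ℝ (fun q => G q v z) p u + fderiv ℝ (fun q => G q u z) p v
        - fderiv ℝ (fun q => G q u v) p z

/-- The vector field `q ↦ v - Γ_p(q - p, v)`. It takes the value `v` at `p`, and its covariant
derivative (for the Levi-Civita connection of `G`) vanishes at `p`. Hence the covariant derivative
at `p` of any tensor field `s` is `(∇_u s)(v₁, …, vₙ) = ∂_u (s (V₁, …, Vₙ))`, where `Vₘ` is
the field of this kind with value `vₘ` at `p`. -/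
def parallelExt {F : Type*} [NormedAddCommGroup F] [NormedSpace ℝ F]
    (G : F → F → F → ℝ) (p v q : F) : F :=
  v - christoffel G p (q - p) v

section Manifold

variable {d : ℕ} {X : Type*} [MetricSpace X] [ChartedSpace (EuclideanSpace ℝ (Fin d)) X]

/-- The coordinates of the point `x` in the preferred chart around `x`. -/
def coordAt (d : ℕ) {X : Type*} [MetricSpace X] [ChartedSpace (EuclideanSpace ℝ (Fin d)) X]
    (x : X) : EuclideanSpace ℝ (Fin d) :=
  chartAt (EuclideanSpace ℝ (Fin d)) x x

/-- The point with coordinates `q` in the preferred chart around `x`. -/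
def pointAt (x : X) (q : EuclideanSpace ℝ (Fin d)) : X :=
  (chartAt (EuclideanSpace ℝ (Fin d)) x).symm q

/-- The tangent vector, at the point with coordinates `q` in the preferred chart around `x`, which
has coordinates `v` in this chart. -/
def vecAt (x : X) (q v : EuclideanSpace ℝ (Fin d)) : TangentSpace (𝓡 d) (pointAt x q) :=
  mfderiv (𝓡 d) (𝓡 d) (chartAt (EuclideanSpace ℝ (Fin d)) x).symm q v

/-- The coordinates of a tangent vector at `x` in the preferred chart around `x`. -/
def vecCoord (x : X) (v : TangentSpace (𝓡 d) x) : EuclideanSpace ℝ (Fin d) :=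
  mfderiv (𝓡 d) (𝓡 d) (chartAt (EuclideanSpace ℝ (Fin d)) x) x v

variable [RiemannianBundle (fun x : X => TangentSpace (𝓡 d) x)]

/-- The Riemannian metric of `X` in the preferred chart around `x`. -/
def chartMetric (x : X) (q u v : EuclideanSpace ℝ (Fin d)) : ℝ :=
  inner ℝ (vecAt x q u) (vecAt x q v)

/-- The product Riemannian metric of `X ^ k`, in the product of the preferred charts around
`x₁, …, x_k`. -/
def prodMetric {k : ℕ} (x : Fin k → X) (q u v : Fin k → EuclideanSpace ℝ (Fin d)) : ℝ :=
  ∑ i, chartMetric (x i) (q i) (u i) (v i)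

/-- The Riemannian volume measure: the smallest measure on `X` that dominates, for every `x`, the
measure `√(det (g_ij)) dq₁ ⋯ dq_d` on the domain of the preferred chart around `x` (these measures
agree where two chart domains overlap). -/
def riemannianVolume (d : ℕ) (X : Type*) [MetricSpace X]
    [ChartedSpace (EuclideanSpace ℝ (Fin d)) X]
    [RiemannianBundle (fun x : X => TangentSpace (𝓡 d) x)] [MeasurableSpace X] : Measure X :=
  ⨆ x : X,
    (((volume : Measure (EuclideanSpace ℝ (Fin d))).withDensity fun q =>
        ENNReal.ofReal (Real.sqrt (Matrix.det (Matrix.of fun i j : Fin d =>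
          chartMetric x q (EuclideanSpace.single i 1) (EuclideanSpace.single j 1))))).restrict
      (chartAt (EuclideanSpace ℝ (Fin d)) x).target).map (pointAt x)

/-- An orthonormal basis of the tangent space `T_x X`. -/
def frame (x : X) : OrthonormalBasis (Fin d) ℝ (TangentSpace (𝓡 d) x) :=
  haveI : FiniteDimensional ℝ (TangentSpace (𝓡 d) x) :=
    inferInstanceAs (FiniteDimensional ℝ (EuclideanSpace ℝ (Fin d)))
  (stdOrthonormalBasis ℝ (TangentSpace (𝓡 d) x)).reindex
    (finCongr (finrank_euclideanSpace_fin (𝕜 := ℝ) (n := d)))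

end Manifold

/-! ### The configuration space -/

/-- The configuration space `Γ_X`: all locally finite subsets of `X`. -/
def Configuration (X : Type*) [TopologicalSpace X] : Type _ :=
  {γ : Set X // ∀ K : Set X, IsCompact K → (γ ∩ K).Finite}

namespace Configuration

variable {X : Type*} [TopologicalSpace X]

/-- `γ` with the points of `s` removed. -/
def remove (γ : Configuration X) (s : Set X) : Configuration X :=
  ⟨γ.1 \ s, fun K hK => (γ.2 K hK).subset (inter_subset_inter_left K sdiff_subset)⟩

/-- `γ` with the points of the finite set `s` added. -/
def add (γ : Configuration X) (s : Set X) (hs : s.Finite) : Configuration X :=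
  ⟨γ.1 ∪ s, fun K hK => ((γ.2 K hK).union hs).subset (by
    rintro y ⟨hy | hy, hyK⟩
    · exact Or.inl ⟨hy, hyK⟩
    · exact Or.inr hy)⟩

/-- `γ + ε_y`. -/
def addPoint (γ : Configuration X) (y : X) : Configuration X :=
  γ.add {y} (finite_singleton y)

/-- `γ - ε_x + ε_y`. -/
def move (γ : Configuration X) (x y : X) : Configuration X :=
  (γ.remove {x}).addPoint y

/-- `⟨f, γ⟩ = ∑_{x ∈ γ} f x` (a finite sum if `f` has compact support). -/
def pairing (f : X → ℝ) (γ : Configuration X) : ℝ :=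
  ∑ᶠ x ∈ γ.1, f x

/-- The vague topology. -/
instance : TopologicalSpace (Configuration X) :=
  ⨅ f : C_c(X, ℝ), TopologicalSpace.induced (pairing f) inferInstance

instance : MeasurableSpace (Configuration X) := borel _

instance : BorelSpace (Configuration X) := ⟨rfl⟩

end Configuration

/-- The functions `γ ↦ g (⟨φ₁, γ⟩, …, ⟨φ_N, γ⟩)`, where `φ₁, …, φ_N` are smooth with compact
support and `g` is smooth, bounded, with bounded derivatives of all orders. -/
def IsCylinder (d : ℕ) {X : Type*} [MetricSpace X] [ChartedSpace (EuclideanSpace ℝ (Fin d)) X]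
    (F : Configuration X → ℝ) : Prop :=
  ∃ (N : ℕ) (g : (Fin N → ℝ) → ℝ) (φ : Fin N → X → ℝ),
    ContDiff ℝ ∞ g ∧ (∀ j : ℕ, ∃ C : ℝ, ∀ t, ‖iteratedFDeriv ℝ j g t‖ ≤ C) ∧
    (∀ a, ContMDiff (𝓡 d) 𝓘(ℝ, ℝ) ∞ (φ a) ∧ HasCompactSupport (φ a)) ∧
    ∀ γ, F γ = g fun a => Configuration.pairing (φ a) γ

/-! ### Forms

An element of the antisymmetric tensor power `∧ⁿ(H)` of a Hilbert space `H` is represented by the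
alternating form `(v₁, …, vₙ) ↦ ⟨t, v₁ ⊗ ⋯ ⊗ vₙ⟩`; the inner product is that of `H ^ ⊗n`, that is,
the Hilbert-Schmidt inner product of the alternating forms.
-/

section Forms

variable {d : ℕ} {X : Type*} [MetricSpace X] [ChartedSpace (EuclideanSpace ℝ (Fin d)) X]

/-- Finitely supported families of tangent vectors. -/
abbrev TangentFam (d : ℕ) (X : Type*) [MetricSpace X]
    [ChartedSpace (EuclideanSpace ℝ (Fin d)) X] : Type _ :=
  Π₀ x : X, TangentSpace (𝓡 d) x

/-- A differential form of order `n` over `Γ_X`: `W γ` is an alternating form on the families of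
tangent vectors; that it is an element of `∧ⁿ(⨁_{x ∈ γ} T_x X)` means moreover that `W γ` is
carried by `γ`, see `IsCarried`. -/
abbrev ConfForm (d : ℕ) (X : Type*) [MetricSpace X]
    [ChartedSpace (EuclideanSpace ℝ (Fin d)) X] (n : ℕ) : Type _ :=
  Configuration X → TangentFam d X [⋀^Fin n]→ₗ[ℝ] ℝ

/-- The alternating form `α` depends on the components at the points of `γ` only. -/
def IsCarried {n : ℕ} (γ : Configuration X) (α : TangentFam d X [⋀^Fin n]→ₗ[ℝ] ℝ) : Prop :=
  ∀ v w : Fin n → TangentFam d X, (∀ m, ∀ x ∈ γ.1, v m x = w m x) → α v = α w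

/-- `∧ⁿ(T_{(x₁, …, x_k)} X ^ k)`, with `T_{(x₁, …, x_k)} X ^ k = ⨁ T_{x_i} X`. -/
abbrev PowFormAt (d : ℕ) {X : Type*} [MetricSpace X]
    [ChartedSpace (EuclideanSpace ℝ (Fin d)) X] (n : ℕ) {k : ℕ} (x : Fin k → X) : Type _ :=
  (∀ i, TangentSpace (𝓡 d) (x i)) [⋀^Fin n]→ₗ[ℝ] ℝ

open Classical in
/-- The projection of an element of `∧ⁿ(T_γ Γ_X)` onto `𝕋^{(n)}_{\{x₁, …, x_k\}} X ^ k` (for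
distinct points `x₁, …, x_k` of `γ`): of all the components indexed by `(z₁, …, zₙ) ∈ γ ^ n`, one
keeps those with `{z₁, …, zₙ} = {x₁, …, x_k}`. -/
def component {n k : ℕ} (α : TangentFam d X [⋀^Fin n]→ₗ[ℝ] ℝ) (x : Fin k → X) :
    PowFormAt d n x :=
  { ∑ j : Fin n → Fin k with Function.Surjective j,
      α.toMultilinearMap.compLinearMap fun m =>
        (DFinsupp.lsingle (x (j m)) : TangentSpace (𝓡 d) (x (j m)) →ₗ[ℝ] TangentFam d X).comp
          (LinearMap.proj (j m)) with
    map_eq_zero_of_eq' := by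
      intro v a b hab hne
      simp only [MultilinearMap.toFun_eq_coe, _root_.sum_apply,
        MultilinearMap.compLinearMap_apply]
      refine Finset.sum_involution (fun j _ => j ∘ Equiv.swap a b) ?_ ?_ ?_ ?_
      · intro j _
        have key : (fun m => (DFinsupp.lsingle (x ((j ∘ Equiv.swap a b) m)) :
              TangentSpace (𝓡 d) (x ((j ∘ Equiv.swap a b) m)) →ₗ[ℝ] TangentFam d X)
                (v m ((j ∘ Equiv.swap a b) m)))
            = (fun m => (DFinsupp.lsingle (x (j m)) :
              TangentSpace (𝓡 d) (x (j m)) →ₗ[ℝ] TangentFam d X) (v m (j m)))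
                ∘ Equiv.swap a b := by
          funext m
          have hv : v m = v (Equiv.swap a b m) := by
            by_cases h1 : m = a
            · subst h1; rw [Equiv.swap_apply_left]; exact hab
            · by_cases h2 : m = b
              · subst h2; rw [Equiv.swap_apply_right]; exact hab.symm
              · rw [Equiv.swap_apply_of_ne_of_ne h1 h2]
          simp only [Function.comp_apply]
          rw [hv]
        have := α.map_swap (fun m => (DFinsupp.lsingle (x (j m)) :
              TangentSpace (𝓡 d) (x (j m)) →ₗ[ℝ] TangentFam d X) (v m (j m))) hne
        rw [← key] at this
        simp only [AlternatingMap.coe_multilinearMap, LinearMap.comp_apply, LinearMap.proj_apply]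
        rw [this]
        exact add_neg_cancel _
      · intro j _ hj hfix
        apply hj
        have hjab : j a = j b := by
          have := congrFun hfix b
          simpa using this
        simp only [AlternatingMap.coe_multilinearMap, LinearMap.comp_apply, LinearMap.proj_apply]
        refine α.map_eq_zero_of_eq _ ?_ hne
        rw [hjab, hab]
      · intro j hj
        simp only [Finset.mem_filter, Finset.mem_univ, true_and] at hj ⊢
        exact hj.comp (Equiv.swap a b).surjective
      · intro j _
        funext m
        simp }

/-- The space `Ψ^n_sym(X ^ k)` of smooth, compactly supported `n`-forms `η` on `X ^ k` such that,
at all tuples of distinct points,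
(i) the components `η_{l₁, …, l_k}` with some `l_i = 0` vanish, i.e. `η` vanishes on all vectors
without component in `T_{x_i} X`, for each `i`;
(ii) `η` is invariant under permutations of the points. -/
structure IsPsiSym {n k : ℕ} (η : ∀ x : Fin k → X, PowFormAt d n x) : Prop where
  smooth : ∀ (x : Fin k → X) (v : Fin n → Fin k → EuclideanSpace ℝ (Fin d)),
    ContDiffOn ℝ ∞
      (fun q : Fin k → EuclideanSpace ℝ (Fin d) =>
        η (fun i => pointAt (x i) (q i)) fun m i => vecAt (x i) (q i) (v m i))
      (Set.univ.pi fun i => (chartAt (EuclideanSpace ℝ (Fin d)) (x i)).target)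
  compact_support : ∃ K : Set (Fin k → X), IsCompact K ∧ ∀ x, x ∉ K → η x = 0
  component_zero : ∀ x : Fin k → X, Function.Injective x → ∀ (i : Fin k)
    (v : Fin n → ∀ i, TangentSpace (𝓡 d) (x i)), (∀ m, v m i = 0) → η x v = 0
  symm : ∀ x : Fin k → X, Function.Injective x → ∀ (τ : Equiv.Perm (Fin k))
    (v : Fin n → ∀ i, TangentSpace (𝓡 d) (x i)),
    η (fun i => x (τ i)) (fun m i => v m (τ i)) = η x v

/-- `W` is the form over `Γ_X` whose components, for distinct points `x₁, …, x_l` of `γ`, are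
`W_k(γ, x₁, …, x_k) = √(k!) F(γ - ε_{x₁} - ⋯ - ε_{x_k}) η(x₁, …, x_k)` and `W_l = 0` for
`l ≠ k`. -/
structure IsElementaryForm {n : ℕ} (k : ℕ) (F : Configuration X → ℝ)
    (η : ∀ x : Fin k → X, PowFormAt d n x) (W : ConfForm d X n) : Prop where
  carried : ∀ γ, IsCarried γ (W γ)
  component_eq : ∀ (γ : Configuration X) (x : Fin k → X), Function.Injective x →
    (∀ i, x i ∈ γ.1) →
      component (W γ) x = (Real.sqrt (k.factorial : ℝ) * F (γ.remove (range x))) • η x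
  component_ne : ∀ (γ : Configuration X) (l : ℕ), l ≠ k → ∀ x : Fin l → X,
    Function.Injective x → (∀ i, x i ∈ γ.1) → component (W γ) x = 0

/-- The space `𝒟Ωⁿ` of forms over `Γ_X`: the linear span of the elementary forms. -/
def DOmega (d : ℕ) (X : Type*) [MetricSpace X] [ChartedSpace (EuclideanSpace ℝ (Fin d)) X]
    (n : ℕ) : Submodule ℝ (ConfForm d X n) :=
  Submodule.span ℝ {W | ∃ (k : ℕ) (F : Configuration X → ℝ)
    (η : ∀ x : Fin k → X, PowFormAt d n x),
    1 ≤ k ∧ k ≤ n ∧ IsCylinder d F ∧ IsPsiSym η ∧ IsElementaryForm k F η W}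

/-- Families `(𝒲_k)` of maps `(γ, x₁, …, x_k) ↦ 𝒲_k(γ, x₁, …, x_k) ∈ ∧ⁿ(T_{(x₁, …, x_k)} X ^ k)`. -/
abbrev FockForm (d : ℕ) (X : Type*) [MetricSpace X]
    [ChartedSpace (EuclideanSpace ℝ (Fin d)) X] (n : ℕ) : Type _ :=
  ∀ (k : ℕ) (_ : Configuration X) (x : Fin k → X), PowFormAt d n x

/-- The map `Iⁿ`: `(Iⁿ W)_k(γ, x₁, …, x_k) = (k!)^{-1/2} W_k(γ + ε_{x₁} + ⋯ + ε_{x_k}, x₁, …, x_k)`. -/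
def isoI {n : ℕ} (W : ConfForm d X n) : FockForm d X n := fun k γ x =>
  (Real.sqrt (k.factorial : ℝ))⁻¹ • component (W (γ.add (range x) (finite_range x))) x

/-! ### Covariant gradients and inner products -/

variable [RiemannianBundle (fun x : X => TangentSpace (𝓡 d) x)]

open Classical in
/-- `∇^Γ W(γ) = (∇^X_x W(γ))_{x ∈ γ}`: the covariant derivative at `y = x`, in direction
`u ∈ T_x X`, of the section `y ↦ W(γ - ε_x + ε_y)` of the bundle with fibres
`∧ⁿ(⨁_{z ∈ γ \ {x}} T_z X ⊕ T_y X)`, for the connection induced by the Levi-Civita connection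
of `X` (and by the trivial one on the fixed summands `T_z X`). -/
def gradConfForm {n : ℕ} (W : ConfForm d X n) (γ : Configuration X) (x : X)
    (u : TangentSpace (𝓡 d) x) (v : Fin n → TangentFam d X) : ℝ :=
  fderiv ℝ
    (fun q : EuclideanSpace ℝ (Fin d) =>
      W (γ.move x (pointAt x q)) fun m =>
        (v m).erase x + DFinsupp.single (pointAt x q)
          (vecAt x q (parallelExt (chartMetric x) (coordAt d x) (vecCoord x (v m x)) q)))
    (coordAt d x) (vecCoord x u)

/-- `∇^Γ_γ 𝒲(γ, x₁, …, x_k)`: the gradient, for fixed `x₁, …, x_k`, of `γ ↦ 𝒲(γ, x₁, …, x_k)`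
with values in a fixed space; its component at `z ∈ γ`, in direction `u ∈ T_z X`. -/
def gradGamma {n : ℕ} (𝒲 : FockForm d X n) {k : ℕ} (γ : Configuration X) (x : Fin k → X) (z : X)
    (u : TangentSpace (𝓡 d) z) (v : Fin n → ∀ i, TangentSpace (𝓡 d) (x i)) : ℝ :=
  fderiv ℝ (fun q : EuclideanSpace ℝ (Fin d) => 𝒲 k (γ.move z (pointAt z q)) x v)
    (coordAt d z) (vecCoord z u)

/-- `∇^{X ^ k} η(x₁, …, x_k)`: the covariant derivative, in direction
`u ∈ T_{(x₁, …, x_k)} X ^ k`, of the form `η` on the Riemannian product `X ^ k`, for the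
Levi-Civita connection. -/
def gradPow {n k : ℕ} (η : ∀ x : Fin k → X, PowFormAt d n x) (x : Fin k → X)
    (u : ∀ i, TangentSpace (𝓡 d) (x i)) (v : Fin n → ∀ i, TangentSpace (𝓡 d) (x i)) : ℝ :=
  fderiv ℝ
    (fun q : Fin k → EuclideanSpace ℝ (Fin d) =>
      η (fun i => pointAt (x i) (q i)) fun m i =>
        vecAt (x i) (q i) (parallelExt (prodMetric x) (fun i => coordAt d (x i))
          (fun i => vecCoord (x i) (v m i)) q i))
    (fun i => coordAt d (x i)) (fun i => vecCoord (x i) (u i))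

open Classical in
/-- The inner product of `∧ⁿ(T_γ Γ_X)`. -/
def innerConf {n : ℕ} (γ : Configuration X) (α β : (Fin n → TangentFam d X) → ℝ) : ℝ :=
  ∑' y : Fin n → γ.1, ∑ b : Fin n → Fin d,
    α (fun m => DFinsupp.single (y m : X) (frame (y m : X) (b m))) *
    β (fun m => DFinsupp.single (y m : X) (frame (y m : X) (b m)))

/-- The inner product of `T_γ Γ_X ⊗ ∧ⁿ(T_γ Γ_X)`. -/
def innerGradConf {n : ℕ} (γ : Configuration X)
    (A B : ∀ x : X, TangentSpace (𝓡 d) x → (Fin n → TangentFam d X) → ℝ) : ℝ :=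
  ∑' x : γ.1, ∑ a : Fin d, innerConf γ (A x (frame (x : X) a)) (B x (frame (x : X) a))

/-- The inner product of `∧ⁿ(T_{(x₁, …, x_k)} X ^ k)`, and of its subspace
`𝕋^{(n)}_{\{x₁, …, x_k\}} X ^ k`. -/
def innerPow {n k : ℕ} (x : Fin k → X)
    (α β : (Fin n → ∀ i, TangentSpace (𝓡 d) (x i)) → ℝ) : ℝ :=
  ∑ j : Fin n → Fin k, ∑ b : Fin n → Fin d,
    α (fun m => Pi.single (j m) (frame (x (j m)) (b m))) *
    β (fun m => Pi.single (j m) (frame (x (j m)) (b m)))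

/-- The inner product of `T_γ Γ_X ⊗ 𝕋^{(n)}_{\{x₁, …, x_k\}} X ^ k`. -/
def innerGradGamma {n k : ℕ} (γ : Configuration X) (x : Fin k → X)
    (A B : ∀ z : X, TangentSpace (𝓡 d) z → (Fin n → ∀ i, TangentSpace (𝓡 d) (x i)) → ℝ) : ℝ :=
  ∑' z : γ.1, ∑ a : Fin d, innerPow x (A z (frame (z : X) a)) (B z (frame (z : X) a))

/-- The inner product of `T_{(x₁, …, x_k)} X ^ k ⊗ 𝕋^{(n)}_{\{x₁, …, x_k\}} X ^ k`. -/
def innerGradPow {n k : ℕ} (x : Fin k → X)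
    (A B : (∀ i, TangentSpace (𝓡 d) (x i)) →
      (Fin n → ∀ i, TangentSpace (𝓡 d) (x i)) → ℝ) : ℝ :=
  ∑ i : Fin k, ∑ a : Fin d,
    innerPow x (A (Pi.single i (frame (x i) a))) (B (Pi.single i (frame (x i) a)))

end Forms

/-! ### The measures `σ^{(k)}(γ)` and `μ^{(k)}`, and the Bochner forms -/

section Measures

variable {X : Type*} [MetricSpace X] [MeasurableSpace X]

/-- `σ^{(k)}(γ, dx₁ ⋯ dx_k) = σ(γ, dx₁) σ(γ + ε_{x₁}, dx₂) ⋯ σ(γ + ε_{x₁} + ⋯ + ε_{x_{k-1}}, dx_k)`. -/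
def sigmaPow (σ : Kernel (Configuration X) X) :
    ∀ k : ℕ, Configuration X → Measure (Fin k → X)
  | 0, _ => Measure.dirac Fin.elim0
  | k + 1, γ => (σ γ).bind fun y =>
      (sigmaPow σ k (γ.addPoint y)).map fun x => (Fin.cons y x : Fin (k + 1) → X)

/-- `μ^{(k)}(dγ, dx₁ ⋯ dx_k) = μ(dγ) σ^{(k)}(γ, dx₁ ⋯ dx_k)`. -/
def muPow (μ : Measure (Configuration X)) (σ : Kernel (Configuration X) X) (k : ℕ) :
    Measure (Configuration X × (Fin k → X)) :=
  μ.bind fun γ => (sigmaPow σ k γ).map (Prod.mk γ)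

/-- The identity `∫ μ(dγ) ∑_{x ∈ γ} F(γ, x) = ∫ μ(dγ) ∫ σ(γ, dx) F(γ + ε_x, x)` for all measurable
`F ≥ 0`. -/
def MeckeIdentity (μ : Measure (Configuration X)) (σ : Kernel (Configuration X) X) : Prop :=
  ∀ F : Configuration X × X → ENNReal, Measurable F →
    ∫⁻ γ, ∑' x : γ.1, F (γ, x) ∂μ = ∫⁻ γ, ∫⁻ x, F (γ.addPoint x, x) ∂(σ γ) ∂μ

variable {d : ℕ} [ChartedSpace (EuclideanSpace ℝ (Fin d)) X]

/-- `𝒲` and `𝒱` define the same element of `⨁_{k=1}^n L²_Ψ(Γ_X × X ^ k → ∧ⁿ(T X ^ k); μ^{(k)})`. -/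
def SameClass {n : ℕ} (μ : Measure (Configuration X)) (σ : Kernel (Configuration X) X)
    (𝒲 𝒱 : FockForm d X n) : Prop :=
  ∀ k ∈ Finset.Icc 1 n, ∀ᵐ p ∂(muPow μ σ k), 𝒲 k p.1 p.2 = 𝒱 k p.1 p.2

variable [RiemannianBundle (fun x : X => TangentSpace (𝓡 d) x)]

/-- The function under the integral in `bochnerForm`. -/
def bochnerIntegrand {n : ℕ} (W₁ W₂ : ConfForm d X n) (γ : Configuration X) : ℝ :=
  innerGradConf γ (gradConfForm W₁ γ) (gradConfForm W₂ γ)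

/-- The Bochner bilinear form
`ℰ^B_{μ,n}(W₁, W₂) = ∫ ⟨∇^Γ W₁(γ), ∇^Γ W₂(γ)⟩ μ(dγ)` for `W₁, W₂ ∈ 𝒟Ωⁿ`. -/
def bochnerForm {n : ℕ} (μ : Measure (Configuration X)) (W₁ W₂ : ConfForm d X n) : ℝ :=
  ∫ γ, bochnerIntegrand W₁ W₂ γ ∂μ

open Classical in
/-- The image of the Bochner form under `Iⁿ`: its value at the classes of `𝒲₁` and `𝒲₂` is
`ℰ^B_{μ,n}(W₁, W₂)` if these are the classes of `Iⁿ W₁` and `Iⁿ W₂`, with `W₁, W₂ ∈ 𝒟Ωⁿ`. -/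
def bochnerFormImage {n : ℕ} (μ : Measure (Configuration X)) (σ : Kernel (Configuration X) X)
    (𝒲₁ 𝒲₂ : FockForm d X n) : ℝ :=
  if h : (∃ W ∈ DOmega d X n, SameClass μ σ (isoI W) 𝒲₁) ∧
      (∃ W ∈ DOmega d X n, SameClass μ σ (isoI W) 𝒲₂)
  then bochnerForm μ h.1.choose h.2.choose else 0

end Measures

end

/-! The gradient ∇^Γ W(γ) of a form has one scalar entry for each moved point x ∈ γ with a frame
vector at x and each n-tuple (y₁, …, yₙ) of points of γ with frame vectors at these points. The
tuples are grouped by their set of distinct points {x₁, …, x_k}: a tuple with k distinct values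
factors as x ∘ j, with x injective and j surjective, in exactly k! ways (`sum_tuples`), and the
resulting 1/k! absorbs the two factors √k! that separate W from Iⁿ W. For fixed x₁, …, x_k there are
two kinds of moved points. If x is none of the x_i, only the configuration moves, and the entry
belongs to ∇^Γ_γ Iⁿ W (`gradConfForm_of_notMem`). If x = x_i, the entry is a covariant derivative in
the i-th factor of X^k; as the Levi-Civita connection of a product metric acts factor by factor
(`christoffel_prodMetric`), it belongs to ∇^{X^k} Iⁿ W (`gradConfForm_of_mem`). Hence the integrand
is ∑_k ∑_x Θ_k(γ − x, x), where x runs over the k-tuples of distinct points of γ and Θ_k is the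
integrand of the right hand side (`bochnerIntegrand_eq`).

The Mecke identity, applied k times, turns ∫ ∑_x Θ_k(γ − x, x) μ(dγ) into ∫ Θ_k dμ^{(k)}
(`MeckeIdentity.lintegral_muPow`, `MeckeIdentity.integral_muPow`). This uses that almost surely the
added points are distinct and not in γ, which follows from d ≥ 1 and σ(γ, ·) ≪ m. All integrals
converge: Θ_k vanishes unless all x_i lie in a compact set and is at most C (1 + ⟨χ, γ⟩), at most
⟨χ, γ⟩^k tuples contribute, and ⟨χ, ·⟩ has all moments.

The form is well defined by a continuity argument. At points (γ, x) without coincidences, Iⁿ W is a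
finite sum ∑ F_i(γ) η_i(x) (`FockRep`). As the density of σ is positive, the measures σ^{(k)}(γ)
charge all nonempty open sets, so two such sums that agree μ^{(k)}-a.e. agree, for a.e. γ, at every
x (`FockRep.ae_val_eq`). The Mecke identity carries this over to all configurations γ − z + y near γ
(`FockRep.ae_val_addPoint_eq`, `MeckeIdentity.ae_forall_remove`), so the gradients agree a.e.
(`FockRep.ae_gradients_eq`). Thus the right hand side depends on the classes only, and so does the
Bochner form, which equals it.

Gradients and inner products are defined with charts and frames chosen point by point. Their
continuity, needed for measurability and for the bounds, is obtained by passing to one fixed chart,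
with the transformation law of the Christoffel operator and the inverse Gram matrix. -/

noncomputable section

set_option linter.unusedSectionVars false
set_option maxSynthPendingDepth 3

/-! ### Pairings, and adding or removing points -/

namespace Configuration

section Pairing

variable {X : Type*} [TopologicalSpace X]

lemma finite_inter_support (γ : Configuration X) {f : X → ℝ} (hf : HasCompactSupport f) :
    (γ.1 ∩ Function.support f).Finite :=
  (γ.2 _ hf).subset (inter_subset_inter_right _ (subset_tsupport f))

lemma pairing_eq_sum (γ : Configuration X) (f : X → ℝ) (S : Finset X) (hS : ∀ x ∈ S, x ∈ γ.1)
    (hf : ∀ x ∈ γ.1, x ∉ S → f x = 0) : pairing f γ = ∑ x ∈ S, f x := by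
  unfold pairing
  apply finsum_mem_eq_sum_of_inter_support_eq
  ext x
  constructor
  · rintro ⟨h1, h2⟩
    exact ⟨by by_contra h; exact h2 (hf x h1 h), h2⟩
  · rintro ⟨h1, h2⟩
    exact ⟨hS x h1, h2⟩

lemma pairing_nonneg (γ : Configuration X) {f : X → ℝ} (hf : ∀ x, 0 ≤ f x) : 0 ≤ pairing f γ :=
  finsum_mem_induction (fun x => 0 ≤ x) le_rfl (fun _ _ => add_nonneg) fun x _ => hf x

lemma pairing_add_fun (γ : Configuration X) {f g : X → ℝ} (hf : HasCompactSupport f)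
    (hg : HasCompactSupport g) : pairing (fun x => f x + g x) γ = pairing f γ + pairing g γ :=
  finsum_mem_add_distrib' (γ.finite_inter_support hf) (γ.finite_inter_support hg)

lemma pairing_addPoint (γ : Configuration X) {f : X → ℝ} (hf : HasCompactSupport f) {y : X}
    (hy : y ∉ γ.1) : pairing f (γ.addPoint y) = pairing f γ + f y := by
  unfold pairing addPoint add
  simp only [union_singleton]
  rw [finsum_mem_insert' _ hy (γ.finite_inter_support hf), add_comm]

lemma addPoint_eq_self (γ : Configuration X) {y : X} (hy : y ∈ γ.1) : γ.addPoint y = γ := by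
  apply Subtype.ext
  simp [addPoint, add, insert_eq_of_mem hy]

lemma remove_eq_self (γ : Configuration X) {s : Set X} (hy : Disjoint γ.1 s) : γ.remove s = γ := by
  apply Subtype.ext
  simp [remove, hy]

@[simp] lemma mem_addPoint {γ : Configuration X} {x y : X} :
    x ∈ (γ.addPoint y).1 ↔ x = y ∨ x ∈ γ.1 := by
  simp [addPoint, add]

@[simp] lemma mem_remove {γ : Configuration X} {x : X} {s : Set X} :
    x ∈ (γ.remove s).1 ↔ x ∈ γ.1 ∧ x ∉ s := by
  simp [remove]

@[simp] lemma mem_add {γ : Configuration X} {x : X} {s : Set X} {hs : s.Finite} :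
    x ∈ (γ.add s hs).1 ↔ x ∈ γ.1 ∨ x ∈ s := by
  simp [add]

@[simp] lemma mem_move {γ : Configuration X} {x y z : X} :
    z ∈ (γ.move x y).1 ↔ z = y ∨ z ∈ γ.1 ∧ z ≠ x := by
  simp [move]

@[ext] lemma ext {γ γ' : Configuration X} (h : ∀ x, x ∈ γ.1 ↔ x ∈ γ'.1) : γ = γ' :=
  Subtype.ext (Set.ext h)

lemma remove_addPoint (γ : Configuration X) {y : X} (hy : y ∉ γ.1) :
    (γ.addPoint y).remove {y} = γ := by
  ext x; simp only [mem_remove, mem_addPoint, mem_singleton_iff]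
  constructor
  · rintro ⟨h | h, h'⟩
    · exact absurd h h'
    · exact h
  · intro h
    exact ⟨Or.inr h, fun h' => hy (h' ▸ h)⟩

lemma addPoint_remove (γ : Configuration X) {y : X} (hy : y ∈ γ.1) :
    (γ.remove {y}).addPoint y = γ := by
  ext x; simp only [mem_remove, mem_addPoint, mem_singleton_iff]
  by_cases h : x = y
  · simp [h, hy]
  · simp [h]

lemma pairing_remove_singleton (γ : Configuration X) {f : X → ℝ} (hf : HasCompactSupport f)
    {y : X} (hy : y ∈ γ.1) : pairing f (γ.remove {y}) = pairing f γ - f y := by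
  have := pairing_addPoint (γ.remove {y}) hf (y := y) (by simp)
  rw [addPoint_remove γ hy] at this
  linarith

lemma pairing_mono_fun (γ : Configuration X) {f g : X → ℝ} {K : Set X} (hK : IsCompact K)
    (hf : ∀ x ∉ K, f x = 0) (hg : ∀ x ∉ K, g x = 0) (h : ∀ x ∈ γ.1, f x ≤ g x) :
    pairing f γ ≤ pairing g γ := by
  have hfin := γ.2 K hK
  rw [pairing_eq_sum γ f hfin.toFinset (by simp +contextual) (by
      intro x hx hxS; exact hf x fun hxK => hxS (by simp [hx, hxK])),
    pairing_eq_sum γ g hfin.toFinset (by simp +contextual) (by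
      intro x hx hxS; exact hg x fun hxK => hxS (by simp [hx, hxK]))]
  refine Finset.sum_le_sum fun x hx => h x ?_
  simp at hx; exact hx.1

lemma abs_pairing_le (γ : Configuration X) {f : X → ℝ} {K : Set X} (hK : IsCompact K)
    (hf : ∀ x ∉ K, f x = 0) : |pairing f γ| ≤ pairing (fun x => |f x|) γ := by
  have hfin := γ.2 K hK
  rw [pairing_eq_sum γ f hfin.toFinset (by simp +contextual) (by
      intro x hx hxS; exact hf x fun hxK => hxS (by simp [hx, hxK])),
    pairing_eq_sum γ (fun x => |f x|) hfin.toFinset (by simp +contextual) (by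
      intro x hx hxS; rw [hf x fun hxK => hxS (by simp [hx, hxK]), abs_zero])]
  exact Finset.abs_sum_le_sum_abs _ _

lemma continuous_pairing {f : X → ℝ} (hf : Continuous f) (hc : HasCompactSupport f) :
    Continuous (pairing f) :=
  continuous_iInf_dom (i := (⟨⟨f, hf⟩, hc⟩ : C_c(X, ℝ))) continuous_induced_dom

lemma pairing_const_mul (γ : Configuration X) (c : ℝ) (f : X → ℝ) :
    pairing (fun x => c * f x) γ = c * pairing f γ := by
  by_cases hc : c = 0
  · simp [hc, pairing]
  · simp only [pairing]
    rw [← smul_eq_mul, smul_finsum]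
    congr 1; funext x
    rw [smul_finsum]; simp

end Pairing

/-! ### The vague topology: second countability and measurability -/

section SecondCountable

variable {X : Type*} [MetricSpace X] [LocallyCompactSpace X] [SecondCountableTopology X]

/-- Functions supported in a member K n of a compact exhaustion form a separable set. Replacing f by
an element g of a countable dense subset with |f - g| ≤ δ on K n changes ⟨f, γ⟩ by at most δ times
the number of points of γ in K n. That number is bounded by ⟨χ n, γ⟩, and since the bump χ n belongs
to the family, this bound persists near a given configuration. -/
lemma exists_countable_pairing_topology :
    ∃ 𝒢 : Set (X → ℝ), 𝒢.Countable ∧ (∀ g ∈ 𝒢, Continuous g ∧ HasCompactSupport g) ∧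
      (inferInstance : TopologicalSpace (Configuration X)) =
        ⨅ g : 𝒢, TopologicalSpace.induced (pairing (g : X → ℝ)) inferInstance := by
  classical
  let K := CompactExhaustion.choice X
  let S : ℕ → Set C(X, ℝ) := fun n => {f | ∀ x, x ∉ K n → f x = 0}
  have hD : ∀ n, ∃ D : Set C(X, ℝ), D ⊆ S n ∧ D.Countable ∧ S n ⊆ closure D := fun n =>
    (TopologicalSpace.IsSeparable.of_separableSpace (S n)).exists_countable_dense_subset
  choose D hDS hDc hDd using hD
  have hχ : ∀ n, ∃ χ : C(X, ℝ), (∀ x ∈ K n, χ x = 1) ∧ HasCompactSupport χ ∧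
      ∀ x, χ x ∈ Icc (0 : ℝ) 1 := by
    intro n
    obtain ⟨f, h1, -, h2, h3⟩ := exists_continuous_one_zero_of_isCompact (K.isCompact n)
      (isClosed_empty) (disjoint_empty _)
    exact ⟨f, fun x hx => h1 hx, h2, h3⟩
  choose χ hχ1 hχc hχI using hχ
  have hSc : ∀ n, ∀ f ∈ S n, HasCompactSupport f := fun n f hf =>
    HasCompactSupport.intro (K.isCompact n) fun x hx => hf x hx
  refine ⟨((fun f : C(X, ℝ) => (f : X → ℝ)) '' ⋃ n, D n) ∪ range fun n => (χ n : X → ℝ),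
    ((countable_iUnion hDc).image _).union (countable_range _), ?_, ?_⟩
  · rintro g (⟨f, hf, rfl⟩ | ⟨n, rfl⟩)
    · obtain ⟨n, hn⟩ := mem_iUnion.1 hf
      exact ⟨f.continuous, hSc n f (hDS n hn)⟩
    · exact ⟨(χ n).continuous, hχc n⟩
  · set 𝒢 : Set (X → ℝ) := ((fun f : C(X, ℝ) => (f : X → ℝ)) '' ⋃ n, D n) ∪
      range fun n => (χ n : X → ℝ) with h𝒢
    apply le_antisymm
    · refine le_iInf fun g => ?_
      rw [← continuous_iff_le_induced]
      rcases g with ⟨g, (⟨f, hf, rfl⟩ | ⟨n, rfl⟩)⟩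
      · obtain ⟨n, hn⟩ := mem_iUnion.1 hf
        exact continuous_pairing f.continuous (hSc n f (hDS n hn))
      · exact continuous_pairing (χ n).continuous (hχc n)
    · refine le_iInf fun f => ?_
      rw [← continuous_iff_le_induced]
      let t' : TopologicalSpace (Configuration X) :=
        ⨅ g : 𝒢, TopologicalSpace.induced (pairing (g : X → ℝ)) inferInstance
      have hcont : ∀ g ∈ 𝒢, Continuous[t', _] (pairing g) := fun g hg =>
        continuous_iInf_dom (i := (⟨g, hg⟩ : 𝒢)) continuous_induced_dom
      obtain ⟨n, hn⟩ := K.exists_superset_of_isCompact f.hasCompactSupport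
      have hf0 : ∀ x, x ∉ K n → f x = 0 := fun x hx =>
        image_eq_zero_of_notMem_tsupport fun h => hx (hn h)
      have hfS : (f : C(X, ℝ)) ∈ S n := hf0
      show Continuous[t', _] (pairing f)
      rw [continuous_iff_continuousAt]
      intro γ₀
      rw [ContinuousAt, Metric.tendsto_nhds]
      intro ε hε
      -- M bounds ⟨χ n, γ⟩ for all γ near γ₀. With δ = ε / (3M), each of the three errors (f to g at
      -- γ, g from γ to γ₀, g to f at γ₀) is at most ε / 3.
      set M := pairing (χ n) γ₀ + 1 with hM
      have hMpos : 0 < M := by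
        have := pairing_nonneg γ₀ (f := χ n) fun x => (hχI n x).1
        linarith
      have hδ : 0 < ε / (3 * M) := by positivity
      obtain ⟨g, hgD, hg⟩ : ∃ g ∈ D n, ∀ x ∈ K n, dist (f x) (g x) < ε / (3 * M) := by
        have := hDd n hfS
        rw [mem_closure_iff_nhds] at this
        obtain ⟨g, h1, h2⟩ := this {g | ∀ x ∈ K n, dist (f x) (g x) < ε / (3 * M)} (by
          have h3 := (ContinuousMap.tendsto_iff_forall_isCompact_tendstoUniformlyOn
            (f := (f : C(X, ℝ))) (F := fun g : C(X, ℝ) => g)).1 Filter.tendsto_id (K n)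
              (K.isCompact n)
          exact (Metric.tendstoUniformlyOn_iff.1 h3) _ hδ)
        exact ⟨g, h2, h1⟩
      have hg0 : ∀ x, x ∉ K n → g x = 0 := hDS n hgD
      have key : ∀ γ : Configuration X, |pairing f γ - pairing g γ| ≤
          ε / (3 * M) * pairing (χ n) γ := by
        intro γ
        have h1 : pairing (fun x => f x + (-1) * g x) γ = pairing f γ - pairing g γ := by
          rw [pairing_add_fun γ f.hasCompactSupport
            (HasCompactSupport.intro (K.isCompact n) fun x hx => by simp [hg0 x hx]),
            pairing_const_mul]
          ring
        rw [← h1, ← pairing_const_mul]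
        refine (abs_pairing_le γ (K.isCompact n) fun x hx => by simp [hf0 x hx, hg0 x hx]).trans ?_
        refine pairing_mono_fun γ (K := K n ∪ tsupport (χ n)) ((K.isCompact n).union (hχc n))
          (fun x hx => ?_) (fun x hx => ?_) fun x _ => ?_
        · simp [hf0 x fun h => hx (Or.inl h), hg0 x fun h => hx (Or.inl h)]
        · simp [image_eq_zero_of_notMem_tsupport fun h => hx (Or.inr h)]
        · by_cases hx : x ∈ K n
          · rw [hχ1 n x hx]
            have := hg x hx
            rw [Real.dist_eq] at this
            have h2 : f x + -1 * g x = f x - g x := by ring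
            rw [h2]; linarith
          · simp only [hf0 x hx, hg0 x hx, mul_zero, add_zero, abs_zero]
            exact mul_nonneg hδ.le (hχI n x).1
      have hg𝒢 : (g : X → ℝ) ∈ 𝒢 := Or.inl ⟨g, mem_iUnion.2 ⟨n, hgD⟩, rfl⟩
      have hχ𝒢 : (χ n : X → ℝ) ∈ 𝒢 := Or.inr ⟨n, rfl⟩
      have e1 := (Metric.tendsto_nhds.1 ((hcont _ hg𝒢).tendsto γ₀)) (ε / 3) (by positivity)
      have e2 := (Metric.tendsto_nhds.1 ((hcont _ hχ𝒢).tendsto γ₀)) 1 one_pos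
      filter_upwards [e1, e2] with γ h1 h2
      rw [Real.dist_eq] at h1 h2 ⊢
      have k1 := key γ
      have k2 := key γ₀
      have b1 : pairing (χ n) γ ≤ M := by rw [hM]; linarith [(abs_lt.1 h2).2]
      have b2 : pairing (χ n) γ₀ ≤ M := by rw [hM]; linarith
      have c1 : ε / (3 * M) * pairing (χ n) γ ≤ ε / 3 := by
        calc _ ≤ ε / (3 * M) * M := by gcongr
          _ = ε / 3 := by field_simp
      have c2 : ε / (3 * M) * pairing (χ n) γ₀ ≤ ε / 3 := by
        calc _ ≤ ε / (3 * M) * M := by gcongr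
          _ = ε / 3 := by field_simp
      have k1' := abs_le.1 (k1.trans c1)
      have k2' := abs_le.1 (k2.trans c2)
      have h1' := abs_lt.1 h1
      rw [abs_lt]
      constructor <;> linarith

instance : SecondCountableTopology (Configuration X) := by
  obtain ⟨𝒢, hc, -, h⟩ := exists_countable_pairing_topology (X := X)
  have : Countable 𝒢 := hc.to_subtype
  have h' : (inferInstance : TopologicalSpace (Configuration X)) =
      TopologicalSpace.induced (fun γ (g : 𝒢) => pairing (g : X → ℝ) γ) inferInstance := by
    rw [h]; exact (induced_to_pi _).symm
  exact (Topology.IsInducing.mk h').secondCountableTopology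

/-- By countability of the family, the Borel σ-algebra is pulled back from the product σ-algebra of
a countable power of ℝ, so measurability can be tested on pairings. -/
lemma measurable_of_pairing {α : Type*} [MeasurableSpace α] {h : α → Configuration X}
    (hh : ∀ f : X → ℝ, Continuous f → HasCompactSupport f → Measurable fun a => pairing f (h a)) :
    Measurable h := by
  obtain ⟨𝒢, hc, h1, h2⟩ := exists_countable_pairing_topology (X := X)
  have : Countable 𝒢 := hc.to_subtype
  have h' : (inferInstance : TopologicalSpace (Configuration X)) =
      TopologicalSpace.induced (fun γ (g : 𝒢) => pairing (g : X → ℝ) γ) inferInstance := by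
    rw [h2]; exact (induced_to_pi _).symm
  have h3 : (inferInstance : MeasurableSpace (Configuration X)) =
      MeasurableSpace.comap (fun γ (g : 𝒢) => pairing (g : X → ℝ) γ) MeasurableSpace.pi := by
    have : (inferInstance : MeasurableSpace (Configuration X)) =
      @borel _ (inferInstance : TopologicalSpace (Configuration X)) := rfl
    rw [this, h', borel_comap, BorelSpace.measurable_eq (α := 𝒢 → ℝ)]
  have h4 : Measurable[_, MeasurableSpace.comap (fun γ (g : 𝒢) => pairing (g : X → ℝ) γ)
      MeasurableSpace.pi] h := by
    rw [measurable_comap_iff]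
    exact measurable_pi_iff.2 fun g => hh g (h1 g g.2).1 (h1 g g.2).2
  intro s hs
  exact h4 (h3 ▸ hs)

lemma measurable_pairing {f : X → ℝ} (hf : Continuous f) (hc : HasCompactSupport f) :
    Measurable (pairing f) := (continuous_pairing hf hc).measurable

variable [MeasurableSpace X] [BorelSpace X]

lemma isClosed_val (γ : Configuration X) : IsClosed γ.1 := by
  rw [← isOpen_compl_iff, isOpen_iff_mem_nhds]
  intro x hx
  obtain ⟨K, hK, hKx⟩ := exists_compact_mem_nhds x
  have h1 : (γ.1 ∩ K)ᶜ ∈ 𝓝 x :=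
    (γ.2 K hK).isClosed.isOpen_compl.mem_nhds fun h => hx h.1
  filter_upwards [h1, hKx] with y hy hyK h
  exact hy ⟨h, hyK⟩

/-- For y ∉ γ take a bump f with f(y) = 1 and f = 0 on γ. Nearby pairs satisfy ⟨f, γ'⟩ < 1/2 <
f(y'), whereas y' ∈ γ' would force f(y') ≤ ⟨f, γ'⟩. -/
lemma isOpen_notMem : IsOpen {p : Configuration X × X | p.2 ∉ p.1.1} := by
  rw [isOpen_iff_mem_nhds]
  rintro ⟨γ, y⟩ hy
  obtain ⟨f, h1, h2, h3, h4⟩ := exists_continuous_one_zero_of_isCompact (isCompact_singleton (x := y))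
    γ.isClosed_val (disjoint_singleton_left.2 hy)
  have h0 : pairing f γ = 0 := by
    rw [pairing_eq_sum γ f ∅ (by simp) fun x hx _ => h2 hx]; simp
  have e1 : ∀ᶠ p : Configuration X × X in 𝓝 (γ, y), pairing f p.1 < 1 / 2 := by
    have : Continuous fun p : Configuration X × X => pairing f p.1 :=
      (continuous_pairing f.continuous h3).comp continuous_fst
    refine this.continuousAt.eventually_lt continuousAt_const ?_
    simp [h0]
  have e2 : ∀ᶠ p : Configuration X × X in 𝓝 (γ, y), 1 / 2 < f p.2 := by
    have : Continuous fun p : Configuration X × X => f p.2 := f.continuous.comp continuous_snd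
    refine continuousAt_const.eventually_lt this.continuousAt ?_
    have := h1 (mem_singleton y)
    simp only [this, Pi.one_apply]; norm_num
  filter_upwards [e1, e2] with p hp1 hp2 hp3
  have h5 : f p.2 ≤ pairing f p.1 := by
    have := pairing_remove_singleton p.1 h3 hp3
    have := pairing_nonneg (p.1.remove {p.2}) (f := f) fun x => (h4 x).1
    linarith
  linarith

lemma measurableSet_mem : MeasurableSet {p : Configuration X × X | p.2 ∈ p.1.1} := by
  have := (isOpen_notMem (X := X)).measurableSet.compl
  convert this using 1
  ext p; simp

/-- `addPoint` is a union of sets, so a point already present is not counted twice; the pairing is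
therefore given by two cases, separated by the measurable relation y ∈ γ. -/
lemma measurable_addPoint : Measurable fun p : Configuration X × X => p.1.addPoint p.2 := by
  classical
  refine measurable_of_pairing fun f hf hc => ?_
  have : (fun p : Configuration X × X => pairing f (p.1.addPoint p.2)) = fun p =>
      if p.2 ∈ p.1.1 then pairing f p.1 else pairing f p.1 + f p.2 := by
    funext p
    split_ifs with h
    · rw [addPoint_eq_self _ h]
    · rw [pairing_addPoint _ hc h]
  rw [this]
  exact Measurable.ite measurableSet_mem ((measurable_pairing hf hc).comp measurable_fst)
    (((measurable_pairing hf hc).comp measurable_fst).add (hf.measurable.comp measurable_snd))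

lemma measurable_remove_singleton :
    Measurable fun p : Configuration X × X => p.1.remove {p.2} := by
  classical
  refine measurable_of_pairing fun f hf hc => ?_
  have : (fun p : Configuration X × X => pairing f (p.1.remove {p.2})) = fun p =>
      if p.2 ∈ p.1.1 then pairing f p.1 - f p.2 else pairing f p.1 := by
    funext p
    split_ifs with h
    · rw [pairing_remove_singleton _ hc h]
    · rw [remove_eq_self _ (disjoint_singleton_right.2 h)]
  rw [this]
  exact Measurable.ite measurableSet_mem
    (((measurable_pairing hf hc).comp measurable_fst).sub (hf.measurable.comp measurable_snd))
    ((measurable_pairing hf hc).comp measurable_fst)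

lemma remove_range_cons {k : ℕ} (γ : Configuration X) (y : X) (x : Fin k → X) :
    γ.remove (range (Fin.cons y x : Fin (k + 1) → X)) = (γ.remove {y}).remove (range x) := by
  ext z
  simp [not_or, eq_comm, and_assoc]

lemma add_range_cons {k : ℕ} (γ : Configuration X) (y : X) (x : Fin k → X) :
    γ.add (range (Fin.cons y x : Fin (k + 1) → X)) (finite_range _) =
      (γ.addPoint y).add (range x) (finite_range x) := by
  ext z
  simp only [mem_add, mem_range, Fin.exists_fin_succ, Fin.cons_zero, Fin.cons_succ, mem_addPoint]
  constructor
  · rintro (h | rfl | h)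
    exacts [Or.inl (Or.inr h), Or.inl (Or.inl rfl), Or.inr h]
  · rintro ((rfl | h) | h)
    exacts [Or.inr (Or.inl rfl), Or.inl h, Or.inr (Or.inr h)]

lemma measurable_remove_range (k : ℕ) :
    Measurable fun p : Configuration X × (Fin k → X) => p.1.remove (range p.2) := by
  induction k with
  | zero =>
    have : (fun p : Configuration X × (Fin 0 → X) => p.1.remove (range p.2)) = Prod.fst := by
      funext p; exact remove_eq_self _ (by simp)
    rw [this]; exact measurable_fst
  | succ k ih =>
    have : (fun p : Configuration X × (Fin (k + 1) → X) => p.1.remove (range p.2)) = fun p =>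
        (p.1.remove {p.2 0}).remove (range (Fin.tail p.2)) := by
      funext p
      conv_lhs => rw [← Fin.cons_self_tail p.2]
      exact remove_range_cons _ _ _
    rw [this]
    refine ih.comp (Measurable.prodMk (measurable_remove_singleton.comp
      (measurable_fst.prodMk ((measurable_pi_apply 0).comp measurable_snd))) ?_)
    exact measurable_pi_iff.2 fun i => (measurable_pi_apply i.succ).comp measurable_snd

lemma measurable_add_range (k : ℕ) :
    Measurable fun p : Configuration X × (Fin k → X) => p.1.add (range p.2) (finite_range p.2) := by
  induction k with
  | zero =>
    have : (fun p : Configuration X × (Fin 0 → X) => p.1.add (range p.2) (finite_range p.2)) =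
        Prod.fst := by
      funext p; ext x; simp
    rw [this]; exact measurable_fst
  | succ k ih =>
    have : (fun p : Configuration X × (Fin (k + 1) → X) => p.1.add (range p.2) (finite_range p.2))
        = fun p => (p.1.addPoint (p.2 0)).add (range (Fin.tail p.2)) (finite_range _) := by
      funext p
      have := add_range_cons p.1 (p.2 0) (Fin.tail p.2)
      rw [← this]
      congr 2
      exact (Fin.cons_self_tail p.2).symm
    rw [this]
    refine ih.comp (Measurable.prodMk (measurable_addPoint.comp
      (measurable_fst.prodMk ((measurable_pi_apply 0).comp measurable_snd))) ?_)
    exact measurable_pi_iff.2 fun i => (measurable_pi_apply i.succ).comp measurable_snd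

/-! ### The counting kernel -/

/-- The counting measure of a configuration. -/
def countMeasure (γ : Configuration X) : Measure X := Measure.sum fun x : γ.1 => Measure.dirac (x : X)

lemma lintegral_countMeasure (γ : Configuration X) {f : X → ENNReal} (hf : Measurable f) :
    ∫⁻ x, f x ∂γ.countMeasure = ∑' x : γ.1, f x := by
  simp [countMeasure, lintegral_sum_measure, lintegral_dirac' _ hf]

lemma countMeasure_apply (γ : Configuration X) {s : Set X} (hs : MeasurableSet s) :
    γ.countMeasure s = ∑' x : γ.1, s.indicator 1 (x : X) := by
  simp [countMeasure, Measure.sum_apply _ hs, Measure.dirac_apply' _ hs]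

lemma countMeasure_compact_lt_top (γ : Configuration X) {K : Set X} (hK : IsCompact K) :
    γ.countMeasure K < ⊤ := by
  classical
  rw [countMeasure_apply _ hK.measurableSet,
    tsum_eq_sum (s := (Set.Finite.preimage (Subtype.val_injective.injOn) (γ.2 K hK)).toFinset
      (s := ((↑) : γ.1 → X) ⁻¹' (γ.1 ∩ K)))]
  · refine ENNReal.sum_lt_top.2 fun x _ => ?_
    by_cases hx : (x : X) ∈ K <;> simp [hx]
  · intro x hx
    simp at hx
    simp [hx]

/-- The number of points in an open set O is the supremum of the continuous functions ⟨f, ·⟩ over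
bumps 0 ≤ f ≤ 1 of compact support vanishing off O: choose f equal to 1 on a large finite part of γ
∩ O. -/
lemma lowerSemicontinuous_countMeasure {O : Set X} (hO : IsOpen O) :
    LowerSemicontinuous fun γ : Configuration X => γ.countMeasure O := by
  classical
  intro γ c hc
  simp only [countMeasure_apply _ hO.measurableSet] at hc
  obtain ⟨T, hT⟩ : ∃ T : Finset γ.1, c < ∑ x ∈ T, O.indicator (1 : X → ENNReal) (x : X) := by
    rw [ENNReal.tsum_eq_iSup_sum] at hc
    exact lt_iSup_iff.1 hc
  set T' : Finset X := (T.image ((↑) : γ.1 → X)).filter (· ∈ O) with hT'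
  have hcard : ∑ x ∈ T, O.indicator (1 : X → ENNReal) (x : X) = (T'.card : ENNReal) := by
    rw [hT', Finset.card_filter, Finset.sum_image (fun _ _ _ _ h => Subtype.ext h)]
    push_cast
    refine Finset.sum_congr rfl fun x _ => ?_
    by_cases hx : (x : X) ∈ O <;> simp [hx]
  rw [hcard] at hT
  have hT'γ : ∀ x ∈ T', x ∈ γ.1 ∧ x ∈ O := by
    intro x hx; simp [hT'] at hx; exact ⟨hx.1.choose, hx.2⟩
  obtain ⟨f, h1, h2, h3, h4⟩ := exists_continuous_one_zero_of_isCompact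
    (T'.finite_toSet.isCompact) hO.isClosed_compl (by
      rw [disjoint_compl_right_iff_subset]; intro x hx; exact (hT'γ x hx).2)
  have hp : (T'.card : ℝ) ≤ pairing f γ := by
    have hfin := γ.2 _ (h3.isCompact.union T'.finite_toSet.isCompact)
    rw [pairing_eq_sum γ f hfin.toFinset (by simp +contextual) (by
      intro x hx hxS; exact image_eq_zero_of_notMem_tsupport fun h => hxS (by simp [hx, h]))]
    have : (T'.card : ℝ) = ∑ x ∈ T', f x := by
      rw [Finset.sum_congr rfl fun x hx => h1 (Finset.mem_coe.2 hx)]; simp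
    rw [this]
    refine Finset.sum_le_sum_of_subset_of_nonneg ?_ fun x _ _ => (h4 x).1
    intro x hx
    simp [hx, (hT'γ x hx).1]
  have hle : ∀ γ' : Configuration X, ENNReal.ofReal (pairing f γ') ≤ γ'.countMeasure O := by
    intro γ'
    have hfin := γ'.2 _ h3.isCompact
    rw [pairing_eq_sum γ' f hfin.toFinset (by simp +contextual) (by
      intro x hx hxS; exact image_eq_zero_of_notMem_tsupport fun h => hxS (by simp [hx, h])),
      ENNReal.ofReal_sum_of_nonneg fun x _ => (h4 x).1, countMeasure_apply _ hO.measurableSet]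
    have : ∑ x ∈ hfin.toFinset, ENNReal.ofReal (f x) =
        ∑ x ∈ hfin.toFinset.attach.image (fun x => (⟨x.1,
          (hfin.mem_toFinset.1 x.2).1⟩ : γ'.1)), ENNReal.ofReal (f x) := by
      rw [Finset.sum_image (by
        intro a _ b _ h; exact Subtype.ext (congrArg (fun z : γ'.1 => (z : X)) h)),
        Finset.sum_attach hfin.toFinset (fun x => ENNReal.ofReal (f x))]
    rw [this]
    refine le_trans (Finset.sum_le_sum fun x _ => ?_) (ENNReal.sum_le_tsum _)
    by_cases hx : (x : X) ∈ O
    · simp [hx, (h4 x).2]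
    · simp [hx, h2 (show (x : X) ∈ Oᶜ from hx)]
  have hclt : c < ENNReal.ofReal (pairing f γ) :=
    hT.trans_le (by rw [← ENNReal.ofReal_natCast]; exact ENNReal.ofReal_le_ofReal hp)
  have := (ENNReal.continuous_ofReal.comp (continuous_pairing f.continuous h3)).continuousAt
    (x := γ)
  filter_upwards [continuousAt_const.eventually_lt this hclt] with γ' h'
  exact h'.trans_le (hle γ')

/-- Open sets are handled by semicontinuity. The passage from this π-system to all Borel sets
requires finite measures, hence the restriction to interiors of compact sets and the increasing
limit at the end. -/
lemma measurable_countMeasure : Measurable (countMeasure : Configuration X → Measure X) := by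
  let K := CompactExhaustion.choice X
  have hfin : ∀ n (γ : Configuration X), IsFiniteMeasure (γ.countMeasure.restrict (interior (K n))) :=
    fun n γ => ⟨by
      rw [Measure.restrict_apply_univ]
      exact (measure_mono interior_subset).trans_lt (γ.countMeasure_compact_lt_top (K.isCompact n))⟩
  have h1 : ∀ n, Measurable fun γ : Configuration X => γ.countMeasure.restrict (interior (K n)) := by
    intro n
    have := hfin n
    refine Measurable.measure_of_isPiSystem (S := {s : Set X | IsOpen s})
      (BorelSpace.measurable_eq (α := X)) isPiSystem_isOpen ?_ ?_
    · intro s hs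
      simp_rw [Measure.restrict_apply (IsOpen.measurableSet hs)]
      exact (lowerSemicontinuous_countMeasure (hs.inter isOpen_interior)).measurable
    · simp_rw [Measure.restrict_apply_univ]
      exact (lowerSemicontinuous_countMeasure isOpen_interior).measurable
  refine Measure.measurable_of_measurable_coe _ fun s hs => ?_
  have h2 : (fun γ : Configuration X => γ.countMeasure s) = fun γ =>
      ⨆ n, γ.countMeasure.restrict (interior (K n)) s := by
    funext γ
    simp_rw [Measure.restrict_apply hs]
    rw [← Directed.measure_iUnion]
    · rw [← inter_iUnion]
      congr 1
      have : ⋃ n, interior (K n) = univ := by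
        refine eq_univ_of_forall fun x => ?_
        obtain ⟨n, hn⟩ := K.exists_mem_nhds x
        exact mem_iUnion.2 ⟨n, mem_interior_iff_mem_nhds.2 hn⟩
      rw [this, inter_univ]
    · refine (monotone_nat_of_le_succ fun n => ?_).directed_le
      exact inter_subset_inter_right _ (interior_mono (K.subset_succ n))
  rw [h2]
  exact Measurable.iSup fun n => (Measure.measurable_coe hs).comp (h1 n)

/-- The kernel associating with a configuration its counting measure. -/
def countKernel (X : Type*) [MetricSpace X] [LocallyCompactSpace X] [SecondCountableTopology X]
    [MeasurableSpace X] [BorelSpace X] : Kernel (Configuration X) X :=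
  ⟨countMeasure, measurable_countMeasure⟩

lemma countKernel_apply (γ : Configuration X) : countKernel X γ = γ.countMeasure := rfl

/-- A configuration has finitely many points in each shell A n of a compact exhaustion, but with no
bound uniform in γ. The kernel is therefore also cut according to the number j of points of γ in the
shell, which makes the piece (n, j) bounded by j + 1. -/
instance : IsSFiniteKernel (countKernel X) := by
  classical
  let K := CompactExhaustion.choice X
  let A : ℕ → Set X := disjointed fun n => (K n : Set X)
  have hA : ∀ n, MeasurableSet (A n) :=
    fun n => MeasurableSet.disjointed (fun n => (K.isCompact n).measurableSet) n
  have hAU : ⋃ n, A n = univ := by rw [iUnion_disjointed]; exact K.iUnion_eq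
  have hAK : ∀ n, A n ⊆ K n := fun n => disjointed_subset _ n
  have hms : ∀ p : ℕ × ℕ, MeasurableSet {γ : Configuration X |
      ⌊(γ.countMeasure (A p.1)).toReal⌋₊ = p.2} := fun p =>
    (Nat.measurable_floor.comp (ENNReal.measurable_toReal.comp
      ((Measure.measurable_coe (hA p.1)).comp measurable_countMeasure))) (measurableSet_singleton _)
  let κ : ℕ × ℕ → Kernel (Configuration X) X := fun p =>
    Kernel.piecewise (hms p) ((countKernel X).restrict (hA p.1)) 0
  have hκ : ∀ p, IsFiniteKernel (κ p) := fun p => ⟨(p.2 : ENNReal) + 1, by simp, fun γ => by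
    simp only [κ, Kernel.piecewise_apply]
    split_ifs with h
    · rw [Kernel.restrict_apply, Measure.restrict_apply_univ, countKernel_apply]
      have h1 : γ.countMeasure (A p.1) < ⊤ :=
        (measure_mono (hAK p.1)).trans_lt (γ.countMeasure_compact_lt_top (K.isCompact p.1))
      rw [← ENNReal.ofReal_toReal h1.ne]
      have h2 : (γ.countMeasure (A p.1)).toReal ≤ (p.2 : ℝ) + 1 := by
        have h3 := Nat.lt_floor_add_one (γ.countMeasure (A p.1)).toReal
        rw [mem_ofPred_eq] at h
        rw [h] at h3
        exact h3.le
      refine (ENNReal.ofReal_le_ofReal h2).trans ?_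
      rw [ENNReal.ofReal_add (by positivity) zero_le_one]; simp
    · simp⟩
  have hsum : countKernel X = Kernel.sum κ := by
    refine Kernel.ext fun γ => ?_
    rw [Kernel.sum_apply]
    refine Measure.ext fun s hs => ?_
    rw [Measure.sum_apply _ hs, ENNReal.tsum_prod (f := fun i j => κ (i, j) γ s)]
    have h1 : ∀ n, ∑' j, κ (n, j) γ s = γ.countMeasure (s ∩ A n) := by
      intro n
      rw [tsum_eq_single ⌊(γ.countMeasure (A n)).toReal⌋₊]
      · simp only [κ, Kernel.piecewise_apply]
        rw [if_pos (by simp), Kernel.restrict_apply, Measure.restrict_apply hs, countKernel_apply]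
      · intro j hj
        simp only [κ, Kernel.piecewise_apply]
        rw [if_neg (by simpa using hj.symm)]
        simp
    simp_rw [h1]
    rw [← measure_iUnion, ← inter_iUnion, hAU, inter_univ, countKernel_apply]
    · intro i j hij
      exact (disjoint_disjointed _ hij).mono inter_subset_right inter_subset_right
    · exact fun n => hs.inter (hA n)
  rw [hsum]
  exact Kernel.isSFiniteKernel_sum

/-- The sum over γ is an integral against the s-finite counting kernel, to which the measurability
part of Tonelli's theorem applies. -/
lemma measurable_tsum_mem {Z : Type*} [MeasurableSpace Z] {f : (Configuration X × Z) × X → ENNReal}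
    (hf : Measurable f) :
    Measurable fun p : Configuration X × Z => ∑' x : p.1.1, f (p, x) := by
  have h := (hf.lintegral_kernel_prod_right' (κ := (countKernel X).comap
    (Prod.fst : Configuration X × Z → Configuration X) measurable_fst))
  convert h using 2 with p
  exact (lintegral_countMeasure p.1 (f := fun b => f (p, b))
    (hf.comp (measurable_const.prodMk measurable_id))).symm

lemma countable_val (γ : Configuration X) : γ.1.Countable := by
  let K := CompactExhaustion.choice X
  have : γ.1 = ⋃ n, γ.1 ∩ K n := by rw [← inter_iUnion, K.iUnion_eq, inter_univ]
  rw [this]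
  exact countable_iUnion fun n => (γ.2 _ (K.isCompact n)).countable

instance (γ : Configuration X) : Countable γ.1 := γ.countable_val.to_subtype

lemma tsum_cons {k : ℕ} (γ : Configuration X) (f : (Fin (k + 1) → X) → ENNReal) :
    ∑' x : Fin (k + 1) → γ.1, f (fun i => x i) =
      ∑' x : Fin k → γ.1, ∑' y : γ.1, f (Fin.cons (y : X) fun i => (x i : X)) := by
  rw [← (Fin.consEquiv fun _ : Fin (k + 1) => γ.1).tsum_eq, ENNReal.tsum_prod', ENNReal.tsum_comm]
  refine tsum_congr fun x => tsum_congr fun y => ?_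
  congr 1
  funext i
  refine Fin.cases ?_ (fun j => ?_) i <;> simp [Fin.consEquiv]

lemma measurable_tsum_tuple {k : ℕ} {f : Configuration X × (Fin k → X) → ENNReal}
    (hf : Measurable f) :
    Measurable fun γ : Configuration X => ∑' x : Fin k → γ.1, f (γ, fun i => x i) := by
  induction k with
  | zero =>
    have : (fun γ : Configuration X => ∑' x : Fin 0 → γ.1, f (γ, fun i => x i)) =
        fun γ => f (γ, Fin.elim0) := by
      funext γ
      rw [tsum_fintype, Fintype.sum_unique]
      congr 2
      exact Subsingleton.elim _ _
    rw [this]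
    exact hf.comp (measurable_id.prodMk measurable_const)
  | succ k ih =>
    simp_rw [fun γ => tsum_cons γ fun x => f (γ, x)]
    refine ih (f := fun p => ∑' y : p.1.1, f (p.1, Fin.cons (y : X) p.2)) ?_
    refine measurable_tsum_mem (f := fun q => f (q.1.1, Fin.cons q.2 q.1.2)) ?_
    refine hf.comp (Measurable.prodMk (measurable_fst.comp measurable_fst) ?_)
    refine measurable_pi_iff.2 fun i => Fin.cases ?_ (fun j => ?_) i
    · exact measurable_snd
    · exact (measurable_pi_apply j).comp (measurable_snd.comp measurable_fst)

end SecondCountable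
end Configuration

/-! ### The iterated Mecke identity -/

section Mecke

open Configuration

variable {X : Type*} [MetricSpace X] [LocallyCompactSpace X] [SecondCountableTopology X]
  [MeasurableSpace X] [BorelSpace X]

lemma measurable_fin_cons (k : ℕ) :
    Measurable fun p : X × (Fin k → X) => (Fin.cons p.1 p.2 : Fin (k + 1) → X) := by
  refine measurable_pi_iff.2 fun i => Fin.cases ?_ (fun j => ?_) i
  · exact measurable_fst
  · exact (measurable_pi_apply j).comp measurable_snd

/-- The measures `sigmaPow σ k γ` as a kernel. -/
def sigmaKernel (σ : Kernel (Configuration X) X) : ∀ k : ℕ, Kernel (Configuration X) (Fin k → X)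
  | 0 => Kernel.const _ (Measure.dirac Fin.elim0)
  | k + 1 => (σ ⊗ₖ ((sigmaKernel σ k).comap (fun p : Configuration X × X => p.1.addPoint p.2)
      measurable_addPoint)).map fun p => (Fin.cons p.1 p.2 : Fin (k + 1) → X)

instance (σ : Kernel (Configuration X) X) [IsSFiniteKernel σ] (k : ℕ) :
    IsSFiniteKernel (sigmaKernel σ k) := by
  induction k with
  | zero => unfold sigmaKernel; infer_instance
  | succ k ih => unfold sigmaKernel; infer_instance

variable (μ : Measure (Configuration X)) [SFinite μ] (σ : Kernel (Configuration X) X)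
  [IsSFiniteKernel σ]

/-- `Measure.bind` is meaningful only for measurable families. The recursion defining `sigmaPow` is
measurable at each stage, so the calculus of composition products of kernels is available. -/
lemma sigmaKernel_apply (k : ℕ) (γ : Configuration X) : sigmaKernel σ k γ = sigmaPow σ k γ := by
  induction k generalizing γ with
  | zero => simp [sigmaKernel, sigmaPow]
  | succ k ih =>
    refine Measure.ext fun s hs => ?_
    simp only [sigmaKernel, sigmaPow]
    rw [Kernel.map_apply' _ (measurable_fin_cons k) _ hs,
      Kernel.compProd_apply (measurable_fin_cons k hs)]
    simp_rw [← ih]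
    have hm : Measurable fun y => γ.addPoint y :=
      measurable_addPoint.comp (measurable_const.prodMk measurable_id)
    have hmy : ∀ y : X, Measurable fun x => (Fin.cons y x : Fin (k + 1) → X) := fun y =>
      (measurable_fin_cons k).comp (measurable_const.prodMk measurable_id)
    rw [Measure.bind_apply hs]
    · refine lintegral_congr fun y => ?_
      rw [Measure.map_apply (hmy y) hs, Kernel.comap_apply]
      rfl
    · refine (Measure.measurable_of_measurable_coe _ fun t ht => ?_).aemeasurable
      simp_rw [fun y => Measure.map_apply (μ := sigmaKernel σ k (γ.addPoint y)) (hmy y) ht]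
      exact Kernel.measurable_kernel_prodMk_left (κ := (sigmaKernel σ k).comap _ hm)
        (measurable_fin_cons k ht)

lemma muPow_eq_compProd (k : ℕ) : muPow μ σ k = μ ⊗ₘ sigmaKernel σ k := by
  refine Measure.ext fun s hs => ?_
  unfold muPow
  simp_rw [← sigmaKernel_apply]
  rw [Measure.bind_apply hs, Measure.compProd_apply hs]
  · refine lintegral_congr fun γ => ?_
    rw [Measure.map_apply measurable_prodMk_left hs]
  · refine (Measure.measurable_of_measurable_coe _ fun t ht => ?_).aemeasurable
    simp_rw [fun γ => Measure.map_apply (μ := sigmaKernel σ k γ)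
      (measurable_prodMk_left (x := γ)) ht]
    exact Kernel.measurable_kernel_prodMk_left ht

lemma lintegral_sigmaKernel_succ (k : ℕ) (γ : Configuration X) {f : (Fin (k + 1) → X) → ENNReal}
    (hf : Measurable f) : ∫⁻ x, f x ∂(sigmaKernel σ (k + 1) γ) =
      ∫⁻ y, ∫⁻ x, f (Fin.cons y x) ∂(sigmaKernel σ k (γ.addPoint y)) ∂(σ γ) := by
  simp only [sigmaKernel]
  rw [Kernel.lintegral_map _ (measurable_fin_cons k) _ hf]
  exact Kernel.lintegral_compProd _ _ _ (hf.comp (measurable_fin_cons k))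

variable {μ σ}

/-- Apply the Mecke identity to F(γ, x) = 1_N(γ), where N is a measurable null set containing the
exceptional configurations: the left side is zero, and the right side integrates 1_N(γ + ε_y). -/
lemma MeckeIdentity.ae_addPoint (hm : MeckeIdentity μ σ) {P : Configuration X → Prop}
    (h : ∀ᵐ γ ∂μ, P γ) : ∀ᵐ γ ∂μ, ∀ᵐ y ∂(σ γ), P (γ.addPoint y) := by
  set N := toMeasurable μ {γ | ¬ P γ} with hN
  have hN0 : μ N = 0 := by rw [hN, measure_toMeasurable]; exact h
  have hNm : MeasurableSet N := measurableSet_toMeasurable _ _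
  have h1 := hm (fun p => N.indicator 1 p.1)
    ((measurable_one.indicator hNm).comp measurable_fst)
  have h2 : ∫⁻ γ, ∑' _ : γ.1, N.indicator (1 : Configuration X → ENNReal) γ ∂μ = 0 := by
    rw [lintegral_eq_zero_iff' ]
    · have : ∀ᵐ γ ∂μ, γ ∉ N := by rw [ae_iff]; simpa using hN0
      filter_upwards [this] with γ hγ
      simp [hγ]
    · have := measurable_tsum_mem (X := X) (Z := Unit)
        (f := fun q => N.indicator (1 : Configuration X → ENNReal) q.1.1)
        ((measurable_one.indicator hNm).comp (measurable_fst.comp measurable_fst))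
      exact (this.comp (measurable_id.prodMk (measurable_const (a := ())))).aemeasurable
  rw [h2] at h1
  have hmm : Measurable fun p : Configuration X × X =>
      N.indicator (1 : Configuration X → ENNReal) (p.1.addPoint p.2) :=
    (measurable_one.indicator hNm).comp measurable_addPoint
  have h3 := (lintegral_eq_zero_iff (hmm.lintegral_kernel_prod_right' (κ := σ))).1 h1.symm
  filter_upwards [h3] with γ hγ
  have h4 := (lintegral_eq_zero_iff (hmm.comp (measurable_const.prodMk measurable_id))).1 hγ
  filter_upwards [h4] with y hy
  by_contra hP
  have : γ.addPoint y ∈ N := subset_toMeasurable _ _ hP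
  simp [this] at hy

/-- Apply the Mecke identity to F(γ, x) = 1_N(γ - ε_x). On the right this becomes 1_N((γ + ε_x) -
ε_x) = 1_N(γ), provided that x ∉ γ. The conclusion holds for every z ∈ γ at once, because a sum over
γ vanishes only if each term does. -/
lemma MeckeIdentity.ae_forall_remove (hm : MeckeIdentity μ σ)
    (h0 : ∀ᵐ γ ∂μ, ∀ᵐ y ∂(σ γ), y ∉ γ.1) {P : Configuration X → Prop}
    (h : ∀ᵐ γ ∂μ, P γ) : ∀ᵐ γ ∂μ, ∀ z ∈ γ.1, P (γ.remove {z}) := by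
  set N := toMeasurable μ {γ | ¬ P γ} with hN
  have hN0 : μ N = 0 := by rw [hN, measure_toMeasurable]; exact h
  have hNm : MeasurableSet N := measurableSet_toMeasurable _ _
  have hmm : Measurable fun p : Configuration X × X =>
      N.indicator (1 : Configuration X → ENNReal) (p.1.remove {p.2}) :=
    (measurable_one.indicator hNm).comp measurable_remove_singleton
  have h1 := hm _ hmm
  have h2 : ∫⁻ γ, ∫⁻ x, N.indicator (1 : Configuration X → ENNReal)
      ((γ.addPoint x).remove {x}) ∂(σ γ) ∂μ = 0 := by
    have : ∀ᵐ γ ∂μ, γ ∉ N := by rw [ae_iff]; simpa using hN0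
    rw [← lintegral_zero (μ := μ)]
    refine lintegral_congr_ae ?_
    filter_upwards [this, h0] with γ hγ hγ0
    rw [← lintegral_zero (μ := σ γ)]
    refine lintegral_congr_ae ?_
    filter_upwards [hγ0] with y hy
    rw [remove_addPoint _ hy]
    simp [hγ]
  simp only at h1
  rw [h2] at h1
  have hm2 := measurable_tsum_mem (X := X) (Z := Unit)
    (f := fun q => N.indicator (1 : Configuration X → ENNReal) (q.1.1.remove {q.2}))
    (hmm.comp ((measurable_fst.comp measurable_fst).prodMk measurable_snd))
  have h3 := (lintegral_eq_zero_iff (hm2.comp (measurable_id.prodMk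
    (measurable_const (a := ()))))).1 h1
  filter_upwards [h3] with γ hγ z hz
  have h4 := ENNReal.tsum_eq_zero.1 hγ ⟨z, hz⟩
  by_contra hP
  have : γ.remove {z} ∈ N := subset_toMeasurable _ _ hP
  simp [this] at h4

lemma measurableSet_injective (k : ℕ) : MeasurableSet {x : Fin k → X | Function.Injective x} := by
  have : {x : Fin k → X | Function.Injective x} = ⋂ (i) (j) (_ : i ≠ j), {x | x i = x j}ᶜ := by
    ext x
    simp only [mem_ofPred_eq, mem_iInter, mem_compl_iff, Function.Injective]
    exact ⟨fun h i j hij he => hij (h he), fun h i j he => by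
      by_contra hij; exact h i j hij he⟩
  rw [this]
  exact MeasurableSet.iInter fun i => MeasurableSet.iInter fun j => MeasurableSet.iInter fun _ =>
    (measurableSet_eq_fun (measurable_pi_apply i) (measurable_pi_apply j)).compl

lemma measurableSet_injective_disjoint (k : ℕ) : MeasurableSet
    {p : Configuration X × (Fin k → X) | Function.Injective p.2 ∧ ∀ i, p.2 i ∉ p.1.1} := by
  refine MeasurableSet.inter (measurable_snd (measurableSet_injective k)) ?_
  have : {p : Configuration X × (Fin k → X) | ∀ i, p.2 i ∉ p.1.1} =
      ⋂ i, (fun p : Configuration X × (Fin k → X) => (p.1, p.2 i)) ⁻¹'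
        {q : Configuration X × X | q.2 ∈ q.1.1}ᶜ := by
    ext p; simp
  have h2 : MeasurableSet {p : Configuration X × (Fin k → X) | ∀ i, p.2 i ∉ p.1.1} := by
    rw [this]
    exact MeasurableSet.iInter fun i =>
      (measurable_fst.prodMk ((measurable_pi_apply i).comp measurable_snd)) measurableSet_mem.compl
  exact h2

/-- Split off the first point y. The induction hypothesis at γ + ε_y makes the remaining points
distinct and different both from the points of γ and from y. -/
lemma MeckeIdentity.ae_injective_disjoint' (hm : MeckeIdentity μ σ)
    (h0 : ∀ᵐ γ ∂μ, ∀ᵐ y ∂(σ γ), y ∉ γ.1) (k : ℕ) :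
    ∀ᵐ γ ∂μ, ∀ᵐ x ∂(sigmaKernel σ k γ), Function.Injective x ∧ ∀ i, x i ∉ γ.1 := by
  induction k with
  | zero => exact .of_forall fun γ => .of_forall fun x =>
      ⟨fun i => i.elim0, fun i => i.elim0⟩
  | succ k ih =>
    filter_upwards [h0, hm.ae_addPoint ih] with γ hγ0 hγ
    have hms : ∀ k, MeasurableSet {x : Fin k → X | Function.Injective x ∧ ∀ i, x i ∉ γ.1} :=
      fun k => (measurable_const.prodMk measurable_id) (measurableSet_injective_disjoint k)
    simp only [sigmaKernel]
    rw [Kernel.map_apply _ (measurable_fin_cons k),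
      ae_map_iff (measurable_fin_cons k).aemeasurable (hms (k + 1))]
    refine (Kernel.ae_compProd_iff (measurable_fin_cons k (hms (k + 1)))).2 ?_
    filter_upwards [hγ0, hγ] with y hy0 hy
    rw [Kernel.comap_apply]
    filter_upwards [hy] with x hx
    show Function.Injective _ ∧ ∀ i, _
    refine ⟨Fin.cons_injective_iff.2 ⟨?_, hx.1⟩, fun i => Fin.cases ?_ (fun j => ?_) i⟩
    · rintro ⟨i, rfl⟩
      exact hx.2 i (by simp)
    · exact hy0
    · intro h
      exact hx.2 j (by simp only [Fin.cons_succ] at h; simp [h])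

lemma MeckeIdentity.ae_injective_disjoint (hm : MeckeIdentity μ σ)
    (h0 : ∀ᵐ γ ∂μ, ∀ᵐ y ∂(σ γ), y ∉ γ.1) (k : ℕ) :
    ∀ᵐ p ∂(muPow μ σ k), Function.Injective p.2 ∧ ∀ i, p.2 i ∉ p.1.1 := by
  rw [muPow_eq_compProd, Measure.ae_compProd_iff (measurableSet_injective_disjoint k)]
  exact hm.ae_injective_disjoint' h0 k

/-- The iterated Mecke identity. -/
theorem MeckeIdentity.lintegral_muPow (hm : MeckeIdentity μ σ)
    (h0 : ∀ᵐ γ ∂μ, ∀ᵐ y ∂(σ γ), y ∉ γ.1) (k : ℕ) {Φ : Configuration X × (Fin k → X) → ENNReal}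
    (hΦ : Measurable Φ) :
    ∫⁻ γ, ∑' x : Fin k → γ.1, {p : Configuration X × (Fin k → X) | Function.Injective p.2}.indicator
        Φ (γ, fun i => (x i : X)) ∂μ =
      ∫⁻ p, Φ (p.1.add (range p.2) (finite_range _), p.2) ∂(muPow μ σ k) := by
  rw [muPow_eq_compProd]
  have hadd : ∀ k, Measurable fun p : Configuration X × (Fin k → X) =>
      (p.1.add (range p.2) (finite_range _), p.2) := fun k =>
    (measurable_add_range k).prodMk measurable_snd
  induction k with
  | zero =>
    refine Eq.trans ?_ (Measure.lintegral_compProd (hΦ.comp (hadd 0))).symm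
    refine lintegral_congr fun γ => ?_
    simp only [sigmaKernel, Kernel.const_apply]
    refine Eq.trans ?_ (lintegral_dirac' _ (hΦ.comp ((hadd 0).comp
      (measurable_const.prodMk measurable_id)))).symm
    rw [tsum_fintype, Fintype.sum_unique, indicator_of_mem]
    · congr 1
      refine Prod.ext ?_ (Subsingleton.elim _ _)
      ext x; simp
    · exact fun i => i.elim0
  | succ k ih =>
    have hA : Measurable fun p : Configuration X × X =>
        ∫⁻ x, Φ (p.1.add (range x) (finite_range _), Fin.cons p.2 x) ∂(sigmaKernel σ k p.1) := by
      refine Measurable.lintegral_kernel_prod_right' (κ := (sigmaKernel σ k).comap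
        (Prod.fst : Configuration X × X → Configuration X) measurable_fst)
        (f := fun q => Φ (q.1.1.add (range q.2) (finite_range _), Fin.cons q.1.2 q.2)) ?_
      refine hΦ.comp (Measurable.prodMk ?_ ?_)
      · exact (measurable_add_range k).comp
          ((measurable_fst.comp measurable_fst).prodMk measurable_snd)
      · exact (measurable_fin_cons k).comp
          ((measurable_snd.comp measurable_fst).prodMk measurable_snd)
    have step1 : ∫⁻ p, Φ (p.1.add (range p.2) (finite_range _), p.2) ∂(μ ⊗ₘ sigmaKernel σ (k + 1))
        = ∫⁻ γ, ∫⁻ y, ∫⁻ x, Φ ((γ.addPoint y).add (range x) (finite_range _), Fin.cons y x)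
          ∂(sigmaKernel σ k (γ.addPoint y)) ∂(σ γ) ∂μ := by
      refine (Measure.lintegral_compProd (hΦ.comp (hadd (k + 1)))).trans ?_
      refine lintegral_congr fun γ => ?_
      refine (lintegral_sigmaKernel_succ σ k γ
        (hΦ.comp ((hadd (k + 1)).comp (measurable_const.prodMk measurable_id)))).trans ?_
      refine lintegral_congr fun y => lintegral_congr fun x => ?_
      exact congrArg (fun q => Φ (q, Fin.cons y x)) (add_range_cons γ y x)
    -- The Mecke identity in the first added point y: the integral over σ(γ) with γ + ε_y inside
    -- becomes a sum over y ∈ γ.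
    have step2 := hm _ hA
    rw [step1, ← step2]
    -- Excluding y ∈ range x has two effects. For x disjoint from γ, the sum over γ + x reduces to
    -- the sum over γ. Also, (y, x) is injective exactly when x is injective and y ∉ range x, so the
    -- induction hypothesis for Ψ yields the sum over injective (k + 1)-tuples.
    set Ψ : Configuration X × (Fin k → X) → ENNReal := fun p =>
      ∑' y : p.1.1, {q : (Configuration X × (Fin k → X)) × X | q.2 ∉ range q.1.2}.indicator
        (fun q => Φ (q.1.1, Fin.cons q.2 q.1.2)) (p, (y : X)) with hΨdef
    have hset : MeasurableSet {q : (Configuration X × (Fin k → X)) × X | q.2 ∉ range q.1.2} := by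
      have : {q : (Configuration X × (Fin k → X)) × X | q.2 ∉ range q.1.2} =
          ⋂ i, {q | q.1.2 i = q.2}ᶜ := by ext q; simp
      rw [this]
      exact MeasurableSet.iInter fun i => (measurableSet_eq_fun
        ((measurable_pi_apply i).comp (measurable_snd.comp measurable_fst)) measurable_snd).compl
    have hΨ : Measurable Ψ := by
      refine measurable_tsum_mem (Measurable.indicator ?_ hset)
      exact hΦ.comp ((measurable_fst.comp measurable_fst).prodMk ((measurable_fin_cons k).comp
        (measurable_snd.prodMk (measurable_snd.comp measurable_fst))))
    have step3 : ∫⁻ γ, ∑' y : γ.1, ∫⁻ x, Φ (γ.add (range x) (finite_range _), Fin.cons (y : X) x)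
        ∂(sigmaKernel σ k γ) ∂μ =
        ∫⁻ p, Ψ (p.1.add (range p.2) (finite_range _), p.2) ∂(μ ⊗ₘ sigmaKernel σ k) := by
      refine Eq.trans ?_ (Measure.lintegral_compProd (hΨ.comp (hadd k))).symm
      refine lintegral_congr_ae ?_
      filter_upwards [hm.ae_injective_disjoint' h0 k] with γ hγ
      rw [← lintegral_tsum]
      · refine lintegral_congr_ae ?_
        filter_upwards [hγ] with x hx
        simp only [hΨdef, Function.comp]
        rw [tsum_subtype γ.1 (fun y => Φ (γ.add (range x) (finite_range _), Fin.cons y x)),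
          tsum_subtype (γ.add (range x) (finite_range _)).1 (fun y =>
            {q : (Configuration X × (Fin k → X)) × X | q.2 ∉ range q.1.2}.indicator
              (fun q => Φ (q.1.1, Fin.cons q.2 q.1.2))
              ((γ.add (range x) (finite_range _), x), y))]
        refine tsum_congr fun y => ?_
        by_cases hy : y ∈ γ.1
        · have h1 : y ∉ range x := by rintro ⟨i, rfl⟩; exact hx.2 i hy
          rw [indicator_of_mem hy, indicator_of_mem (by simp [hy]), indicator_of_mem h1]
        · rw [indicator_of_notMem hy]
          by_cases h1 : y ∈ range x
          · rw [indicator_of_mem (by rw [Configuration.mem_add]; exact Or.inr h1),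
              indicator_of_notMem (by simpa using h1)]
          · rw [indicator_of_notMem (by rw [Configuration.mem_add]; tauto)]
      · intro y
        refine (hΦ.comp (Measurable.prodMk ?_ ?_)).aemeasurable
        · exact (measurable_add_range k).comp (measurable_const.prodMk measurable_id)
        · exact (measurable_fin_cons k).comp (measurable_const.prodMk measurable_id)
    rw [step3, ← ih hΨ]
    refine lintegral_congr fun γ => ?_
    rw [tsum_cons γ fun x => {p : Configuration X × (Fin (k + 1) → X) |
      Function.Injective p.2}.indicator Φ (γ, x)]
    refine tsum_congr fun x => ?_
    by_cases hx : Function.Injective fun i => (x i : X)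
    · rw [indicator_of_mem hx]
      refine tsum_congr fun y => ?_
      by_cases hy : (y : X) ∈ range fun i => (x i : X)
      · rw [indicator_of_notMem (by
          rw [mem_ofPred_eq, Fin.cons_injective_iff]; tauto), indicator_of_notMem (by simpa using hy)]
      · rw [indicator_of_mem (by
          rw [mem_ofPred_eq, Fin.cons_injective_iff]; tauto), indicator_of_mem hy]
    · rw [indicator_of_notMem hx]
      refine ENNReal.tsum_eq_zero.2 fun y => indicator_of_notMem ?_ _
      rw [mem_ofPred_eq, Fin.cons_injective_iff]; tauto

/-- The projection of U to the first coordinate is open and nonempty, hence charged by σ(γ). Over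
each y in it the slice is open and nonempty, hence charged by the measure at γ + ε_y for almost
every y. -/
lemma MeckeIdentity.ae_isOpenPos (hm : MeckeIdentity μ σ)
    (hσ : ∀ᵐ γ ∂μ, ∀ U : Set X, IsOpen U → U.Nonempty → σ γ U ≠ 0) (k : ℕ) :
    ∀ᵐ γ ∂μ, ∀ U : Set (Fin k → X), IsOpen U → U.Nonempty → sigmaKernel σ k γ U ≠ 0 := by
  induction k with
  | zero =>
    refine .of_forall fun γ U hU hne => ?_
    have : U = univ := by
      obtain ⟨u, hu⟩ := hne
      exact eq_univ_of_forall fun x => Subsingleton.elim u x ▸ hu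
    simp [sigmaKernel, this]
  | succ k ih =>
    filter_upwards [hσ, hm.ae_addPoint ih] with γ hγ0 hγ U hU hne h
    have hcont : Continuous fun p : X × (Fin k → X) => (Fin.cons p.1 p.2 : Fin (k + 1) → X) := by
      refine continuous_pi fun i => Fin.cases ?_ (fun j => ?_) i
      · exact continuous_fst
      · exact (continuous_apply j).comp continuous_snd
    have hU' := hU.preimage hcont
    simp only [sigmaKernel] at h
    rw [Kernel.map_apply' _ (measurable_fin_cons k) _ hU.measurableSet,
      Kernel.compProd_apply hU'.measurableSet, lintegral_eq_zero_iff
        (Kernel.measurable_kernel_prodMk_left' hU'.measurableSet γ)] at h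
    have hV := isOpenMap_fst _ hU'
    refine hγ0 _ hV ?_ ?_
    · obtain ⟨u, hu⟩ := hne
      exact ⟨u 0, (u 0, Fin.tail u), by simpa using hu, rfl⟩
    · have h2 : ∀ᵐ y ∂(σ γ), y ∉ Prod.fst ''
          ((fun p : X × (Fin k → X) => (Fin.cons p.1 p.2 : Fin (k + 1) → X)) ⁻¹' U) := by
        filter_upwards [h, hγ] with y hy1 hy2
        rintro ⟨⟨y', x⟩, hyx, rfl⟩
        refine hy2 _ (hU'.preimage (Continuous.prodMk_right y')) ⟨x, hyx⟩ ?_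
        simpa [Kernel.comap_apply] using hy1
      rw [ae_iff] at h2
      simpa only [not_not, Set.ofPred_mem_eq] using h2

/-- This is the version for integrands that see γ without the chosen points: for almost every (γ, x)
the tuple x is disjoint from γ, and removing it undoes its addition. -/
lemma MeckeIdentity.lintegral_muPow_remove (hm : MeckeIdentity μ σ)
    (h0 : ∀ᵐ γ ∂μ, ∀ᵐ y ∂(σ γ), y ∉ γ.1) (k : ℕ) {Φ : Configuration X × (Fin k → X) → ENNReal}
    (hΦ : Measurable Φ) :
    ∫⁻ γ, ∑' x : Fin k → γ.1, {x : Fin k → X | Function.Injective x}.indicator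
        (fun x => Φ (γ.remove (range x), x)) (fun i => (x i : X)) ∂μ =
      ∫⁻ p, Φ p ∂(muPow μ σ k) := by
  have h := hm.lintegral_muPow h0 k (Φ := fun p => Φ (p.1.remove (range p.2), p.2))
    (hΦ.comp ((measurable_remove_range k).prodMk measurable_snd))
  refine Eq.trans ?_ (h.trans (lintegral_congr_ae ?_))
  · refine lintegral_congr fun γ => tsum_congr fun x => ?_
    by_cases hx : Function.Injective fun i => (x i : X)
    · rw [indicator_of_mem hx, indicator_of_mem hx]
    · rw [indicator_of_notMem hx, indicator_of_notMem hx]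
  · filter_upwards [hm.ae_injective_disjoint h0 k] with p hp
    have : (p.1.add (range p.2) (finite_range _)).remove (range p.2) = p.1 := by
      ext z
      simp only [mem_remove, Configuration.mem_add]
      constructor
      · rintro ⟨h | h, h'⟩
        exacts [h, absurd h h']
      · intro hz
        refine ⟨Or.inl hz, ?_⟩
        rintro ⟨i, rfl⟩
        exact hp.2 i hz
    simp only [this]

lemma measurable_indicator_remove {k : ℕ} {β : Type*} [MeasurableSpace β] [Zero β]
    {Φ : Configuration X × (Fin k → X) → β} (hΦ : Measurable Φ) :
    Measurable fun p : Configuration X × (Fin k → X) =>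
      {x : Fin k → X | Function.Injective x}.indicator (fun x => Φ (p.1.remove (range x), x)) p.2 := by
  have : (fun p : Configuration X × (Fin k → X) =>
      {x : Fin k → X | Function.Injective x}.indicator (fun x => Φ (p.1.remove (range x), x)) p.2) =
      (Prod.snd ⁻¹' {x : Fin k → X | Function.Injective x}).indicator
        fun p => Φ (p.1.remove (range p.2), p.2) := by
    funext p
    by_cases h : Function.Injective p.2
    · rw [indicator_of_mem h, indicator_of_mem (by exact h)]
    · rw [indicator_of_notMem h, indicator_of_notMem (by exact h)]
  rw [this]
  exact (hΦ.comp ((measurable_remove_range k).prodMk measurable_snd)).indicator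
    (measurable_snd (measurableSet_injective k))

/-- The iterated Mecke identity for functions of at most linear growth in the number of points
of `γ` in a compact set. -/
theorem MeckeIdentity.integral_muPow (hm : MeckeIdentity μ σ)
    (h0 : ∀ᵐ γ ∂μ, ∀ᵐ y ∂(σ γ), y ∉ γ.1) {k : ℕ} {Θ : Configuration X × (Fin k → X) → ℝ}
    (hΘ : Measurable Θ) {K : Set X} (hK : IsCompact K)
    (hsupp : ∀ γ x, (∃ i, x i ∉ K) → Θ (γ, x) = 0) {C : ℝ} (hC : 0 ≤ C) {χ : C_c(X, ℝ)}
    (hχ0 : ∀ x, 0 ≤ χ x) (hχ1 : ∀ x ∈ K, 1 ≤ χ x)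
    (hbound : ∀ γ x, |Θ (γ, x)| ≤ C * (1 + pairing χ γ))
    (hmom : ∀ j : ℕ, Integrable (fun γ => pairing χ γ ^ j) μ) :
    Integrable Θ (muPow μ σ k) ∧
    Integrable (fun γ => ∑' x : Fin k → γ.1, {x : Fin k → X | Function.Injective x}.indicator
        (fun x => Θ (γ.remove (range x), x)) (fun i => (x i : X))) μ ∧
    ∫ γ, ∑' x : Fin k → γ.1, {x : Fin k → X | Function.Injective x}.indicator
        (fun x => Θ (γ.remove (range x), x)) (fun i => (x i : X)) ∂μ =
      ∫ p, Θ p ∂(muPow μ σ k) := by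
  classical
  set D : Configuration X → (Fin k → X) → ℝ := fun γ =>
    {x : Fin k → X | Function.Injective x}.indicator (fun x => Θ (γ.remove (range x), x)) with hD
  have hDm : Measurable fun p : Configuration X × (Fin k → X) => D p.1 p.2 :=
    measurable_indicator_remove hΘ
  have hpn : ∀ γ, 0 ≤ pairing χ γ := fun γ => pairing_nonneg γ hχ0
  have hDsupp : ∀ γ x, (∃ i, x i ∉ K) → D γ x = 0 := by
    intro γ x hx
    simp only [hD, indicator_apply_eq_zero]
    exact fun _ => hsupp _ _ hx
  have hDb : ∀ γ x, |D γ x| ≤ C * (1 + pairing χ γ) := by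
    intro γ x
    by_cases hx : Function.Injective x
    · simp only [hD]
      rw [indicator_of_mem hx]
      refine (hbound _ _).trans ?_
      have : pairing χ (γ.remove (range x)) ≤ pairing χ γ := by
        have hfin := γ.2 _ χ.hasCompactSupport.isCompact
        rw [pairing_eq_sum γ χ hfin.toFinset (by simp +contextual) (by
            intro x hx hxS; exact image_eq_zero_of_notMem_tsupport fun h => hxS (by simp [hx, h])),
          pairing_eq_sum (γ.remove (range x)) χ (hfin.toFinset.filter (· ∉ range x))
            (by intro y hy; simp at hy ⊢; tauto) (by
            intro y hy hyS
            refine image_eq_zero_of_notMem_tsupport fun h => hyS ?_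
            simp at hy ⊢; tauto)]
        exact Finset.sum_le_sum_of_subset_of_nonneg (Finset.filter_subset _ _) fun x _ _ => hχ0 x
      gcongr
    · simp only [hD]
      rw [indicator_of_notMem hx, abs_zero]
      have := hpn γ; positivity
  -- Only tuples in K contribute, and since χ ≥ 1 on K there are at most ⟨χ, γ⟩^k of them.
  have hfin : ∀ γ : Configuration X, ∃ T : Finset (Fin k → γ.1),
      (∀ x ∉ T, D γ (fun i => (x i : X)) = 0) ∧ (T.card : ℝ) ≤ pairing χ γ ^ k := by
    intro γ
    have hf := γ.2 K hK
    have hf' : (((↑) : γ.1 → X) ⁻¹' (γ.1 ∩ K)).Finite := hf.preimage Subtype.val_injective.injOn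
    refine ⟨Fintype.piFinset fun _ => hf'.toFinset, fun x hx => hDsupp _ _ ?_, ?_⟩
    · rw [Fintype.mem_piFinset] at hx
      push Not at hx
      obtain ⟨i, hi⟩ := hx
      refine ⟨i, fun h => hi ?_⟩
      rw [Finite.mem_toFinset]
      exact ⟨(x i).2, h⟩
    · rw [Fintype.card_piFinset]
      simp only [Finset.prod_const, Finset.card_univ, Fintype.card_fin]
      push_cast
      gcongr
      have hfc := γ.2 _ (hK.union χ.hasCompactSupport.isCompact)
      rw [pairing_eq_sum γ χ hfc.toFinset (by simp +contextual) (by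
            intro x hx hxS; exact image_eq_zero_of_notMem_tsupport fun h => hxS (by simp [hx, h]))]
      have : (hf'.toFinset.card : ℝ) ≤ ∑ x ∈ hf'.toFinset.image ((↑) : γ.1 → X), χ x := by
        rw [Finset.sum_image Subtype.val_injective.injOn, Finset.card_eq_sum_ones]
        push_cast
        refine Finset.sum_le_sum fun x hx => hχ1 _ ?_
        rw [Finite.mem_toFinset] at hx
        exact hx.2
      refine this.trans (Finset.sum_le_sum_of_subset_of_nonneg ?_ fun x _ _ => hχ0 x)
      intro x hx
      rw [Finset.mem_image] at hx
      obtain ⟨y, hy, rfl⟩ := hx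
      rw [Finite.mem_toFinset] at hy ⊢
      exact ⟨hy.1, Or.inl hy.2⟩
  choose T hT0 hTc using hfin
  -- Used for g the absolute value, the positive part and the negative part; g 0 = 0 makes g
  -- compatible with the extension of D by zero to non-injective tuples.
  have hkey : ∀ g : ℝ → ENNReal, g 0 = 0 → Measurable g →
      ∫⁻ γ, ∑' x : Fin k → γ.1, g (D γ fun i => (x i : X)) ∂μ = ∫⁻ p, g (Θ p) ∂(muPow μ σ k) := by
    intro g hg0 hg
    refine Eq.trans ?_ (hm.lintegral_muPow_remove h0 k (hg.comp hΘ))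
    refine lintegral_congr fun γ => tsum_congr fun x => ?_
    by_cases hx : Function.Injective fun i => (x i : X)
    · simp only [hD]
      rw [indicator_of_mem hx, indicator_of_mem hx]
    · simp only [hD]
      rw [indicator_of_notMem hx, indicator_of_notMem hx, hg0]
  have hmeas : ∀ g : ℝ → ENNReal, Measurable g →
      Measurable fun γ : Configuration X => ∑' x : Fin k → γ.1, g (D γ fun i => (x i : X)) :=
    fun g hg => measurable_tsum_tuple (f := fun p => g (D p.1 p.2)) (hg.comp hDm)
  have hsum : ∀ g : ℝ → ENNReal, g 0 = 0 → ∀ γ : Configuration X,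
      ∑' x : Fin k → γ.1, g (D γ fun i => (x i : X)) = ∑ x ∈ T γ, g (D γ fun i => (x i : X)) :=
    fun g hg γ => tsum_eq_sum fun x hx => by rw [hT0 γ x hx, hg]
  -- The number of terms times their bound is C (⟨χ, γ⟩^k + ⟨χ, γ⟩^(k + 1)), so the moments of order
  -- k and k + 1 suffice.
  have habs : ∫⁻ γ, ∑' x : Fin k → γ.1, ‖D γ fun i => (x i : X)‖ₑ ∂μ < ⊤ := by
    have hint : Integrable (fun γ => C * (pairing χ γ ^ k + pairing χ γ ^ (k + 1))) μ :=
      ((hmom k).add (hmom (k + 1))).const_mul C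
    refine lt_of_le_of_lt (lintegral_mono fun γ => ?_) hint.2
    rw [hsum (fun r => ‖r‖ₑ) (by simp) γ]
    calc ∑ x ∈ T γ, ‖D γ fun i => (x i : X)‖ₑ
        ≤ ∑ x ∈ T γ, ENNReal.ofReal (C * (1 + pairing χ γ)) := by
          refine Finset.sum_le_sum fun x _ => ?_
          rw [Real.enorm_eq_ofReal_abs]
          exact ENNReal.ofReal_le_ofReal (hDb γ _)
      _ = ENNReal.ofReal ((T γ).card * (C * (1 + pairing χ γ))) := by
          rw [Finset.sum_const, nsmul_eq_mul, ENNReal.ofReal_mul (Nat.cast_nonneg _),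
            ENNReal.ofReal_natCast]
      _ ≤ ENNReal.ofReal (C * (pairing χ γ ^ k + pairing χ γ ^ (k + 1))) := by
          refine ENNReal.ofReal_le_ofReal ?_
          have h1 := hTc γ
          have h2 : 0 ≤ C * (1 + pairing χ γ) := by have := hpn γ; positivity
          calc _ ≤ pairing χ γ ^ k * (C * (1 + pairing χ γ)) := by gcongr
            _ = _ := by ring
      _ ≤ _ := by
          rw [← ofReal_norm_eq_enorm]
          exact ENNReal.ofReal_le_ofReal (le_abs_self _)
  have hIΘ : Integrable Θ (muPow μ σ k) := by
    refine ⟨hΘ.aestronglyMeasurable, ?_⟩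
    rw [HasFiniteIntegral, ← hkey (fun r => ‖r‖ₑ) (by simp) (by fun_prop)]
    exact habs
  have hlt : ∀ g : ℝ → ENNReal, (∀ r, g r ≤ ‖r‖ₑ) →
      ∫⁻ γ, ∑' x : Fin k → γ.1, g (D γ fun i => (x i : X)) ∂μ < ⊤ := fun g hg =>
    lt_of_le_of_lt (lintegral_mono fun γ => ENNReal.tsum_le_tsum fun x => hg _) habs
  have hle1 : ∀ r : ℝ, ENNReal.ofReal r ≤ ‖r‖ₑ := fun r => by
    rw [Real.enorm_eq_ofReal_abs]; exact ENNReal.ofReal_le_ofReal (le_abs_self r)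
  have hle2 : ∀ r : ℝ, ENNReal.ofReal (-r) ≤ ‖r‖ₑ := fun r => by
    rw [Real.enorm_eq_ofReal_abs]; exact ENNReal.ofReal_le_ofReal (neg_le_abs r)
  have hm1 := hmeas (fun r => ENNReal.ofReal r) (by fun_prop)
  have hm2 := hmeas (fun r => ENNReal.ofReal (-r)) (by fun_prop)
  have hl1 := hlt _ hle1
  have hl2 := hlt _ hle2
  have hpt : (fun γ : Configuration X => ∑' x : Fin k → γ.1, D γ fun i => (x i : X)) = fun γ =>
      (∑' x : Fin k → γ.1, ENNReal.ofReal (D γ fun i => (x i : X))).toReal -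
      (∑' x : Fin k → γ.1, ENNReal.ofReal (-(D γ fun i => (x i : X)))).toReal := by
    funext γ
    rw [hsum (fun r => ENNReal.ofReal r) (by simp) γ, hsum (fun r => ENNReal.ofReal (-r)) (by simp) γ,
      tsum_eq_sum (hT0 γ), ENNReal.toReal_sum (by simp), ENNReal.toReal_sum (by simp),
      ← Finset.sum_sub_distrib]
    refine Finset.sum_congr rfl fun x _ => ?_
    rw [ENNReal.toReal_ofReal', ENNReal.toReal_ofReal', max_zero_sub_eq_self]
  have hi1 := integrable_toReal_of_lintegral_ne_top hm1.aemeasurable hl1.ne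
  have hi2 := integrable_toReal_of_lintegral_ne_top hm2.aemeasurable hl2.ne
  refine ⟨hIΘ, ?_, ?_⟩
  · rw [hpt]; exact hi1.sub hi2
  · rw [hpt, integral_sub hi1 hi2, integral_toReal hm1.aemeasurable (ae_lt_top hm1 hl1.ne),
      integral_toReal hm2.aemeasurable (ae_lt_top hm2 hl2.ne),
      integral_eq_lintegral_pos_part_sub_lintegral_neg_part hIΘ,
      hkey (fun r => ENNReal.ofReal r) (by simp) (by fun_prop),
      hkey (fun r => ENNReal.ofReal (-r)) (by simp) (by fun_prop)]

end Mecke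

/-! ### Christoffel operators of a metric on a vector space -/

section Christoffel

variable {F : Type*} [NormedAddCommGroup F] [NormedSpace ℝ F]

/-- `G` is, on the open set `s`, a smooth Riemannian metric, given by the bilinear forms `B`. -/
structure IsMetricOn (G : F → F → F → ℝ) (B : F → F →L[ℝ] F →L[ℝ] ℝ) (s : Set F) : Prop where
  isOpen : IsOpen s
  contDiffOn : ContDiffOn ℝ ∞ B s
  eq : ∀ q ∈ s, ∀ u v, G q u v = B q u v
  symm : ∀ q ∈ s, ∀ u v, B q u v = B q v u
  pos : ∀ q ∈ s, ∀ u, u ≠ 0 → 0 < B q u u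

/-- Half the right hand side of Koszul's formula. -/
def koszul (B : F → F →L[ℝ] F →L[ℝ] ℝ) (p u v : F) : F →L[ℝ] ℝ :=
  (2⁻¹ : ℝ) • (fderiv ℝ B p u v + fderiv ℝ B p v u - ((fderiv ℝ B p).flip u).flip v)

namespace IsMetricOn

variable {G : F → F → F → ℝ} {B : F → F →L[ℝ] F →L[ℝ] ℝ} {s : Set F}

lemma hasFDerivAt (h : IsMetricOn G B s) {p : F} (hp : p ∈ s) : HasFDerivAt B (fderiv ℝ B p) p :=
  ((h.contDiffOn.contDiffAt (h.isOpen.mem_nhds hp)).differentiableAt (by simp)).hasFDerivAt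

lemma eventuallyEq (h : IsMetricOn G B s) {p : F} (hp : p ∈ s) (u v : F) :
    (fun q => G q u v) =ᶠ[𝓝 p] fun q => B q u v := by
  filter_upwards [h.isOpen.mem_nhds hp] with q hq using h.eq q hq u v

lemma fderiv_eq (h : IsMetricOn G B s) {p : F} (hp : p ∈ s) (u v w : F) :
    fderiv ℝ (fun q => G q u v) p w = fderiv ℝ B p w u v := by
  rw [(h.eventuallyEq hp u v).fderiv_eq]
  have h1 := ((h.hasFDerivAt hp).clm_apply (hasFDerivAt_const u p)).clm_apply
    (hasFDerivAt_const v p)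
  rw [h1.fderiv]
  simp

lemma injective (h : IsMetricOn G B s) {p : F} (hp : p ∈ s) : Function.Injective (B p) := by
  refine (injective_iff_map_eq_zero (B p)).2 fun u hu => ?_
  by_contra hne
  have := h.pos p hp u hne
  simp [hu] at this

variable [FiniteDimensional ℝ F]

/-- The musical isomorphism of a metric. -/
def flatEquiv (h : IsMetricOn G B s) {p : F} (hp : p ∈ s) : F ≃L[ℝ] (F →L[ℝ] ℝ) :=
  (LinearMap.linearEquivOfInjective (B p : F →ₗ[ℝ] (F →L[ℝ] ℝ)) (h.injective hp) (by
    rw [← (LinearMap.toContinuousLinearMap (𝕜 := ℝ) (E := F) (F' := ℝ)).finrank_eq]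
    exact (Subspace.dual_finrank_eq (K := ℝ) (V := F)).symm)).toContinuousLinearEquiv

lemma coe_flatEquiv (h : IsMetricOn G B s) {p : F} (hp : p ∈ s) :
    (h.flatEquiv hp : F →L[ℝ] (F →L[ℝ] ℝ)) = B p := by
  ext u v; rfl

/-- B p is nondegenerate, so Koszul's identity has exactly one solution; hence the vector selected
by `Classical.epsilon` in `christoffel` is determined. -/
lemma koszul_iff (h : IsMetricOn G B s) {p : F} (hp : p ∈ s) (u v w : F) :
    (∀ z : F, 2 * G p w z = fderiv ℝ (fun q => G q v z) p u + fderiv ℝ (fun q => G q u z) p v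
        - fderiv ℝ (fun q => G q u v) p z) ↔ w = (B p).inverse (koszul B p u v) := by
  have h1 : w = (B p).inverse (koszul B p u v) ↔ B p w = koszul B p u v := by
    rw [← h.coe_flatEquiv hp, ContinuousLinearMap.inverse_equiv]
    exact ContinuousLinearEquiv.eq_symm_apply _
  rw [h1, ContinuousLinearMap.ext_iff]
  refine forall_congr' fun z => ?_
  rw [h.fderiv_eq hp, h.fderiv_eq hp, h.fderiv_eq hp, h.eq p hp]
  simp only [koszul, ContinuousLinearMap.smul_apply, ContinuousLinearMap.sub_apply,
    ContinuousLinearMap.add_apply, ContinuousLinearMap.flip_apply, smul_eq_mul]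
  constructor <;> intro h <;> linarith

lemma christoffel_eq (h : IsMetricOn G B s) {p : F} (hp : p ∈ s) (u v : F) :
    christoffel G p u v = (B p).inverse (koszul B p u v) := by
  rw [← h.koszul_iff hp]
  exact Classical.epsilon_spec (p := fun w => ∀ z : F,
    2 * G p w z = fderiv ℝ (fun q => G q v z) p u + fderiv ℝ (fun q => G q u z) p v
        - fderiv ℝ (fun q => G q u v) p z) ⟨_, (h.koszul_iff hp u v _).2 rfl⟩

lemma eq_christoffel (h : IsMetricOn G B s) {p : F} (hp : p ∈ s) {u v w : F}
    (hw : ∀ z : F, 2 * G p w z = fderiv ℝ (fun q => G q v z) p u +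
      fderiv ℝ (fun q => G q u z) p v - fderiv ℝ (fun q => G q u v) p z) :
    w = christoffel G p u v := by
  rw [h.christoffel_eq hp]; exact (h.koszul_iff hp u v w).1 hw

lemma flat_christoffel (h : IsMetricOn G B s) {p : F} (hp : p ∈ s) (u v : F) :
    B p (christoffel G p u v) = koszul B p u v := by
  rw [h.christoffel_eq hp, ← h.coe_flatEquiv hp, ContinuousLinearMap.inverse_equiv]
  exact (h.flatEquiv hp).apply_symm_apply _

/-- The Christoffel operator as a bilinear map. -/
def christoffelL (h : IsMetricOn G B s) {p : F} (hp : p ∈ s) : F →ₗ[ℝ] F →ₗ[ℝ] F :=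
  LinearMap.mk₂ ℝ (christoffel G p)
    (fun u u' v => by
      rw [h.christoffel_eq hp, h.christoffel_eq hp, h.christoffel_eq hp, ← map_add]
      congr 1; ext z; simp [koszul]; ring)
    (fun c u v => by
      rw [h.christoffel_eq hp, h.christoffel_eq hp, ← map_smul]
      congr 1; ext z; simp [koszul]; ring)
    (fun u v v' => by
      rw [h.christoffel_eq hp, h.christoffel_eq hp, h.christoffel_eq hp, ← map_add]
      congr 1; ext z; simp [koszul]; ring)
    (fun c u v => by
      rw [h.christoffel_eq hp, h.christoffel_eq hp, ← map_smul]
      congr 1; ext z; simp [koszul]; ring)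

lemma parallelExt_eq (h : IsMetricOn G B s) {p : F} (hp : p ∈ s) (v q : F) :
    parallelExt G p v q = v - h.christoffelL hp (q - p) v := rfl

lemma parallelExt_self (h : IsMetricOn G B s) {p : F} (hp : p ∈ s) (v : F) :
    parallelExt G p v p = v := by
  rw [h.parallelExt_eq hp]; simp

lemma parallelExt_zero (h : IsMetricOn G B s) {p : F} (hp : p ∈ s) (q : F) :
    parallelExt G p 0 q = 0 := by
  rw [h.parallelExt_eq hp]; simp

lemma hasFDerivAt_parallelExt (h : IsMetricOn G B s) {p : F} (hp : p ∈ s) (v q : F) :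
    HasFDerivAt (parallelExt G p v)
      (-(LinearMap.toContinuousLinearMap ((h.christoffelL hp).flip v))) q := by
  have h1 : HasFDerivAt (fun q => (LinearMap.toContinuousLinearMap ((h.christoffelL hp).flip v))
      (q - p)) (LinearMap.toContinuousLinearMap ((h.christoffelL hp).flip v)) q :=
    (ContinuousLinearMap.hasFDerivAt _).comp q ((hasFDerivAt_id q).sub_const p)
  have h2 := (hasFDerivAt_const v q).sub h1
  rw [zero_sub] at h2
  exact h2

/-- The derivative of B is continuous, and inversion of operators is continuous at invertible ones.
-/
lemma continuousOn_christoffel (h : IsMetricOn G B s) (u v : F) :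
    ContinuousOn (fun p => christoffel G p u v) s := by
  have h1 : ContinuousOn (fun p => (B p).inverse (koszul B p u v)) s := by
    have hd : ContinuousOn (fderiv ℝ B) s :=
      h.contDiffOn.continuousOn_fderiv_of_isOpen h.isOpen (by simp)
    have hi : ContinuousOn (fun p => (B p).inverse) s := by
      intro p hp
      have h2 : ContinuousAt (ContinuousLinearMap.inverse : (F →L[ℝ] F →L[ℝ] ℝ) → _) (B p) := by
        rw [← h.coe_flatEquiv hp]
        exact (contDiffAt_map_inverse (n := 0) (h.flatEquiv hp)).continuousAt
      exact h2.comp_continuousWithinAt (h.contDiffOn.continuousOn p hp)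
    refine hi.clm_apply ?_
    unfold koszul
    refine ContinuousOn.fun_const_smul ?_ _
    refine ContinuousOn.sub (ContinuousOn.add ?_ ?_) ?_
    · exact (hd.clm_apply continuousOn_const).clm_apply continuousOn_const
    · exact (hd.clm_apply continuousOn_const).clm_apply continuousOn_const
    · have h3 : Continuous fun A : F →L[ℝ] F →L[ℝ] F →L[ℝ] ℝ => (A.flip u).flip v := by
        have e1 : Continuous fun A : F →L[ℝ] F →L[ℝ] F →L[ℝ] ℝ => A.flip :=
          (ContinuousLinearMap.flipₗᵢ ℝ F F (F →L[ℝ] ℝ)).continuous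
        have e2 : Continuous fun A : F →L[ℝ] F →L[ℝ] ℝ => A.flip :=
          (ContinuousLinearMap.flipₗᵢ ℝ F F ℝ).continuous
        have e3 : Continuous fun A : F →L[ℝ] F →L[ℝ] F →L[ℝ] ℝ => A.flip u :=
          e1.clm_apply continuous_const
        exact (e2.comp e3).clm_apply continuous_const
      exact h3.comp_continuousOn hd
  exact h1.congr fun p hp => h.christoffel_eq hp u v

/-- The transformation law of the Christoffel operator under a change of coordinates. -/
lemma fderiv_christoffel (h : IsMetricOn G B s) {G' : F → F → F → ℝ}
    {B' : F → F →L[ℝ] F →L[ℝ] ℝ} {s' : Set F} (h' : IsMetricOn G' B' s') {p : F} (hp' : p ∈ s')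
    {ψ : F → F} (hψ : ContDiffAt ℝ ∞ ψ p) (hp : ψ p ∈ s)
    (hG : ∀ᶠ q in 𝓝 p, ∀ u v, G' q u v = G (ψ q) (fderiv ℝ ψ q u) (fderiv ℝ ψ q v))
    (hsurj : Function.Surjective (fderiv ℝ ψ p)) (u v : F) :
    fderiv ℝ ψ p (christoffel G' p u v) =
      christoffel G (ψ p) (fderiv ℝ ψ p u) (fderiv ℝ ψ p v) + fderiv ℝ (fderiv ℝ ψ) p u v := by
  have hψ1 : HasFDerivAt ψ (fderiv ℝ ψ p) p := (hψ.differentiableAt (by simp)).hasFDerivAt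
  have hψ2 : HasFDerivAt (fderiv ℝ ψ) (fderiv ℝ (fderiv ℝ ψ) p) p :=
    ((hψ.fderiv_right (m := 1) (by norm_cast)).differentiableAt (by simp)).hasFDerivAt
  have hsym : ∀ a b, fderiv ℝ (fderiv ℝ ψ) p a b = fderiv ℝ (fderiv ℝ ψ) p b a := fun a b =>
    (hψ.isSymmSndFDerivAt (by simp only [minSmoothness_of_isRCLikeNormedField]; exact ENat.LEInfty.out)) a b
  -- By uniqueness in Koszul's identity, it suffices that the preimage w of the right hand side
  -- solves this identity for G'.
  obtain ⟨w, hw⟩ := hsurj (christoffel G (ψ p) (fderiv ℝ ψ p u) (fderiv ℝ ψ p v) +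
    fderiv ℝ (fderiv ℝ ψ) p u v)
  rw [← hw]
  congr 1
  symm
  refine h'.eq_christoffel hp' fun z => ?_
  have hd : ∀ a b c, fderiv ℝ (fun q => G' q a b) p c =
      fderiv ℝ B (ψ p) (fderiv ℝ ψ p c) (fderiv ℝ ψ p a) (fderiv ℝ ψ p b) +
        B (ψ p) (fderiv ℝ (fderiv ℝ ψ) p c a) (fderiv ℝ ψ p b) +
        B (ψ p) (fderiv ℝ ψ p a) (fderiv ℝ (fderiv ℝ ψ) p c b) := by
    intro a b c
    have e1 : (fun q => G' q a b) =ᶠ[𝓝 p]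
        fun q => B (ψ q) (fderiv ℝ ψ q a) (fderiv ℝ ψ q b) := by
      filter_upwards [hG, hψ1.continuousAt (h.isOpen.mem_nhds hp)] with q hq1 hq2
      rw [hq1, h.eq _ hq2]
    rw [e1.fderiv_eq]
    have e2 := (((h.hasFDerivAt hp).comp p hψ1).clm_apply
      (hψ2.clm_apply (hasFDerivAt_const a p))).clm_apply (hψ2.clm_apply (hasFDerivAt_const b p))
    have e3 := congrArg (fun L : F →L[ℝ] ℝ => L c) e2.fderiv
    refine e3.trans ?_
    simp
    ring
  -- Of the six terms with second derivatives of ψ, four cancel by the symmetry of D²ψ and of the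
  -- metric. The other two add up to 2 G(D²ψ(u, v), Dψ z), the inhomogeneous term of the
  -- transformation law.
  rw [hd, hd, hd, hG.self_of_nhds, h.eq _ hp, hw, map_add, ContinuousLinearMap.add_apply,
    h.flat_christoffel hp]
  simp only [koszul, ContinuousLinearMap.smul_apply, ContinuousLinearMap.sub_apply,
    ContinuousLinearMap.add_apply, ContinuousLinearMap.flip_apply, smul_eq_mul]
  rw [hsym v u, hsym z u, hsym z v, h.symm _ hp (fderiv ℝ ψ p v) (fderiv ℝ (fderiv ℝ ψ) p u z)]
  ring

end IsMetricOn

/-- A metric with smooth coefficients. -/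
lemma exists_isMetricOn [FiniteDimensional ℝ F] {G : F → F → F → ℝ} {s : Set F} (hs : IsOpen s)
    (hadd : ∀ q ∈ s, ∀ u u' v, G q (u + u') v = G q u v + G q u' v)
    (hsmul : ∀ q ∈ s, ∀ (c : ℝ) u v, G q (c • u) v = c * G q u v)
    (hsymm : ∀ q ∈ s, ∀ u v, G q u v = G q v u)
    (hpos : ∀ q ∈ s, ∀ u, u ≠ 0 → 0 < G q u u)
    (hG : ∀ u v, ContDiffOn ℝ ∞ (fun q => G q u v) s) :
    ∃ B, IsMetricOn G B s := by
  let b := Module.finBasis ℝ F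
  let c : Fin (Module.finrank ℝ F) → F →L[ℝ] ℝ := fun i => LinearMap.toContinuousLinearMap (b.coord i)
  let B : F → F →L[ℝ] F →L[ℝ] ℝ := fun q =>
    ∑ i, ∑ j, G q (b i) (b j) • (c i).smulRight (c j)
  have hadd' : ∀ q ∈ s, ∀ u v v', G q u (v + v') = G q u v + G q u v' := fun q hq u v v' => by
    rw [hsymm q hq, hadd q hq, hsymm q hq v, hsymm q hq v']
  have hsmul' : ∀ q ∈ s, ∀ (c : ℝ) u v, G q u (c • v) = c * G q u v := fun q hq c u v => by
    rw [hsymm q hq, hsmul q hq, hsymm q hq v]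
  have heq : ∀ q ∈ s, ∀ u v, G q u v = B q u v := by
    intro q hq u v
    let L : F →ₗ[ℝ] F →ₗ[ℝ] ℝ := LinearMap.mk₂ ℝ (G q) (hadd q hq) (hsmul q hq) (hadd' q hq)
      (hsmul' q hq)
    have h1 : G q u v = L u v := rfl
    rw [h1]
    conv_lhs => rw [← b.sum_repr u, ← b.sum_repr v]
    simp only [map_sum, map_smul, _root_.sum_apply, smul_eq_mul, B,
      ContinuousLinearMap.smul_apply, ContinuousLinearMap.smulRight_apply, c, LinearMap.coe_toContinuousLinearMap',
      Module.Basis.coord_apply]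
    have h2 : ∀ y, (∑ x, b.repr u x • L (b x)) y = ∑ x, b.repr u x * G q (b x) y := fun y => by
      rw [LinearMap.sum_apply]; rfl
    simp only [h2, Finset.mul_sum]
    rw [Finset.sum_comm]
    refine Finset.sum_congr rfl fun i _ => Finset.sum_congr rfl fun j _ => ?_
    ring
  refine ⟨B, hs, ?_, heq, fun q hq u v => ?_, fun q hq u hu => ?_⟩
  · exact ContDiffOn.sum fun i _ => ContDiffOn.sum fun j _ => (hG _ _).smul contDiffOn_const
  · rw [← heq q hq, ← heq q hq, hsymm q hq]
  · rw [← heq q hq]; exact hpos q hq u hu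

end Christoffel

/-! ### The metric in charts, and changes of charts -/

section ChartGeometry

variable {d : ℕ} {X : Type*} [MetricSpace X] [ChartedSpace (EuclideanSpace ℝ (Fin d)) X]

local notation "𝔼" => EuclideanSpace ℝ (Fin d)

/-- The domain of the coordinates in the preferred chart around `x`. -/
abbrev coordDom (x : X) : Set 𝔼 := (chartAt 𝔼 x).target

/-- The set of coordinates, in the preferred chart around `x`, of the points in the domain of the
preferred chart around `x'`. -/
def overlap (x x' : X) : Set 𝔼 :=
  (chartAt 𝔼 x).target ∩ (chartAt 𝔼 x).symm ⁻¹' (chartAt 𝔼 x').source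

/-- The change of coordinates. -/
def transition (x x' : X) : 𝔼 → 𝔼 := chartAt 𝔼 x' ∘ (chartAt 𝔼 x).symm

lemma isOpen_overlap (x x' : X) : IsOpen (overlap (d := d) x x') :=
  (chartAt 𝔼 x).isOpen_inter_preimage_symm (chartAt 𝔼 x').open_source

lemma coordAt_mem (x : X) : coordAt d x ∈ coordDom (d := d) x :=
  (chartAt 𝔼 x).map_source (mem_chart_source _ x)

@[simp] lemma pointAt_coordAt (x : X) : pointAt x (coordAt d x) = x :=
  (chartAt 𝔼 x).left_inv (mem_chart_source _ x)

lemma continuousOn_pointAt (x : X) : ContinuousOn (pointAt (d := d) x) (coordDom x) :=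
  (chartAt 𝔼 x).continuousOn_symm

lemma continuousAt_pointAt {x : X} {q : 𝔼} (hq : q ∈ coordDom x) :
    ContinuousAt (pointAt (d := d) x) q :=
  (continuousOn_pointAt x).continuousAt ((chartAt 𝔼 x).open_target.mem_nhds hq)

lemma overlap_subset (x x' : X) : overlap (d := d) x x' ⊆ coordDom x := inter_subset_left

lemma transition_mem {x x' : X} {q : 𝔼} (hq : q ∈ overlap x x') : transition x x' q ∈ coordDom x' :=
  (chartAt 𝔼 x').map_source hq.2

lemma pointAt_transition {x x' : X} {q : 𝔼} (hq : q ∈ overlap x x') :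
    pointAt x' (transition x x' q) = pointAt x q :=
  (chartAt 𝔼 x').left_inv hq.2

/-- The domain of the product coordinates. -/
abbrev prodDom {k : ℕ} (x : Fin k → X) : Set (Fin k → 𝔼) := univ.pi fun i => coordDom (x i)

lemma isOpen_prodDom {k : ℕ} (x : Fin k → X) : IsOpen (prodDom (d := d) x) :=
  isOpen_set_pi finite_univ fun i _ => (chartAt 𝔼 (x i)).open_target

/-- A tangent vector given by its coordinates in the model space. -/
abbrev vecAtE (x : X) (q : 𝔼) : 𝔼 →L[ℝ] 𝔼 := mfderiv (𝓡 d) (𝓡 d) (chartAt 𝔼 x).symm q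

variable [IsManifold (𝓡 d) ∞ X]

lemma contDiffOn_transition (x x' : X) : ContDiffOn ℝ ∞ (transition (d := d) x x') (overlap x x') := by
  have h1 : ContMDiffOn (𝓡 d) (𝓡 d) ∞ (chartAt 𝔼 x').toFun (chartAt 𝔼 x').source :=
    contMDiffOn_chart
  have h2 : ContMDiffOn (𝓡 d) (𝓡 d) ∞ (chartAt 𝔼 x).symm (chartAt 𝔼 x).target :=
    contMDiffOn_chart_symm
  have h3 : ContMDiffOn (𝓡 d) (𝓡 d) ∞ (transition (d := d) x x') (overlap x x') :=
    h1.comp (h2.mono inter_subset_left) inter_subset_right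
  exact h3.contDiffOn

lemma mdifferentiableAt_chart_symm {x : X} {q : 𝔼} (hq : q ∈ coordDom x) :
    MDifferentiableAt (𝓡 d) (𝓡 d) (chartAt 𝔼 x).symm q :=
  mdifferentiableAt_atlas_symm (chart_mem_atlas _ x) hq

lemma vecAtE_transition {x x' : X} {q : 𝔼} (hq : q ∈ overlap x x') :
    (vecAtE x' (transition x x' q)).comp (fderiv ℝ (transition x x') q) = vecAtE x q := by
  have h1 : HasMFDerivAt (𝓡 d) (𝓡 d) (transition (d := d) x x') q (fderiv ℝ (transition x x') q) :=
    (((contDiffOn_transition x x').contDiffAt ((isOpen_overlap x x').mem_nhds hq)).differentiableAt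
      (by simp)).hasFDerivAt.hasMFDerivAt
  have h2 := (mdifferentiableAt_chart_symm (d := d) (transition_mem hq)).hasMFDerivAt
  have h3 := HasMFDerivAt.comp q h2 h1
  have h4 : (chartAt 𝔼 x).symm =ᶠ[𝓝 q] (chartAt 𝔼 x').symm ∘ transition (d := d) x x' := by
    filter_upwards [(isOpen_overlap x x').mem_nhds hq] with r hr
    exact (pointAt_transition hr).symm
  have h5 := h3.congr_of_eventuallyEq h4
  exact h5.mfderiv.symm

lemma vecAtE_injective {x : X} {q : 𝔼} (hq : q ∈ coordDom x) :
    Function.Injective (vecAtE (d := d) x q) :=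
  (mdifferentiable_chart x).symm.mfderiv_injective hq

lemma fderiv_transition_injective {x x' : X} {q : 𝔼} (hq : q ∈ overlap x x') :
    Function.Injective (fderiv ℝ (transition (d := d) x x') q) := by
  have h := vecAtE_injective (d := d) (overlap_subset _ _ hq)
  rw [← vecAtE_transition hq, ContinuousLinearMap.coe_comp'] at h
  exact h.of_comp

lemma fderiv_transition_surjective {x x' : X} {q : 𝔼} (hq : q ∈ overlap x x') :
    Function.Surjective (fderiv ℝ (transition (d := d) x x') q) :=
  (LinearMap.injective_iff_surjective (f := (fderiv ℝ (transition (d := d) x x') q).toLinearMap)).1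
    (fderiv_transition_injective hq)

/-- The coordinates of tangent vectors at `y`, in the preferred chart around `x`. -/
abbrev coordDeriv (x y : X) : 𝔼 →L[ℝ] 𝔼 := mfderiv (𝓡 d) (𝓡 d) (chartAt 𝔼 x) y

lemma vecAtE_coordDeriv {x y : X} (hy : y ∈ (chartAt 𝔼 x).source) :
    (vecAtE x (chartAt 𝔼 x y)).comp (coordDeriv x y) = ContinuousLinearMap.id ℝ 𝔼 :=
  (mdifferentiable_chart x).symm_comp_deriv hy

lemma coordDeriv_transition {x x' y : X} (hy : y ∈ (chartAt 𝔼 x).source)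
    (hy' : y ∈ (chartAt 𝔼 x').source) :
    (fderiv ℝ (transition x x') (chartAt 𝔼 x y)).comp (coordDeriv x y) = coordDeriv x' y := by
  have hq : chartAt 𝔼 x y ∈ overlap (d := d) x x' :=
    ⟨(chartAt 𝔼 x).map_source hy, by
      rw [mem_preimage, (chartAt 𝔼 x).left_inv hy]; exact hy'⟩
  have ht : transition (d := d) x x' (chartAt 𝔼 x y) = chartAt 𝔼 x' y := by
    simp [transition, (chartAt 𝔼 x).left_inv hy]
  have h1 := vecAtE_transition hq
  have h2 := vecAtE_coordDeriv (d := d) hy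
  have h3 := vecAtE_coordDeriv (d := d) hy'
  rw [← h1, ht] at h2
  ext1 v
  apply vecAtE_injective (d := d) (x := x') (q := chartAt 𝔼 x' y) ((chartAt 𝔼 x').map_source hy')
  have h2' := DFunLike.congr_fun h2 v
  have h3' := DFunLike.congr_fun h3 v
  simp only [ContinuousLinearMap.comp_apply] at h2' h3' ⊢
  rw [h2', h3']

/-- A `k`-tuple of points together with linear families of tangent vectors at these points. -/
abbrev PointedFam (d : ℕ) (X : Type*) [MetricSpace X] [ChartedSpace (EuclideanSpace ℝ (Fin d)) X]
    (k : ℕ) : Type _ :=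
  Σ x : Fin k → X, ∀ i, EuclideanSpace ℝ (Fin d) → TangentSpace (𝓡 d) (x i)

/-- Tangent spaces at points that are only provably equal are distinct as dependent types. Packing
points and vectors in one sigma type lets any expression in both be transported by `congrArg`. -/
lemma pointedFam_ext {k : ℕ} {y y' : Fin k → X} (h : y = y') (f f' : Fin k → 𝔼 → 𝔼) (hf : f = f') :
    (⟨y, f⟩ : PointedFam d X k) = ⟨y', f'⟩ := by
  subst h; subst hf; rfl

lemma pointedFam_transition {k : ℕ} {x x' : Fin k → X} {q : Fin k → 𝔼}
    (hq : ∀ i, q i ∈ overlap (x i) (x' i)) :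
    (⟨fun i => pointAt (x i) (q i), fun i => vecAt (x i) (q i)⟩ : PointedFam d X k) =
      ⟨fun i => pointAt (x' i) (transition (x i) (x' i) (q i)),
        fun i v => vecAt (x' i) (transition (x i) (x' i) (q i))
          (fderiv ℝ (transition (x i) (x' i)) (q i) v)⟩ := by
  refine pointedFam_ext (funext fun i => (pointAt_transition (hq i)).symm) _ _ ?_
  funext i v
  exact (DFunLike.congr_fun (vecAtE_transition (hq i)) v).symm

lemma pointedFam_coordDeriv {k : ℕ} {x y : Fin k → X}
    (hy : ∀ i, y i ∈ (chartAt 𝔼 (x i)).source) :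
    (⟨fun i => pointAt (x i) (chartAt 𝔼 (x i) (y i)),
        fun i v => vecAt (x i) (chartAt 𝔼 (x i) (y i)) (coordDeriv (x i) (y i) v)⟩ :
        PointedFam d X k) = ⟨y, fun _ v => v⟩ := by
  refine pointedFam_ext (funext fun i => (chartAt 𝔼 (x i)).left_inv (hy i)) _ _ ?_
  funext i v
  exact DFunLike.congr_fun (vecAtE_coordDeriv (hy i)) v

variable [RiemannianBundle (fun x : X => TangentSpace (𝓡 d) x)]
    [IsContMDiffRiemannianBundle (𝓡 d) ∞ (EuclideanSpace ℝ (Fin d))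
      (fun x : X => TangentSpace (𝓡 d) x)]

lemma chartMetric_transition {x x' : X} {q : 𝔼} (hq : q ∈ overlap x x') (u v : 𝔼) :
    chartMetric x q u v = chartMetric x' (transition x x' q) (fderiv ℝ (transition x x') q u)
      (fderiv ℝ (transition x x') q v) :=
  congrArg (fun s : PointedFam d X 1 => inner ℝ (s.2 0 u) (s.2 0 v))
    (pointedFam_transition (x := fun _ : Fin 1 => x) (x' := fun _ => x') (q := fun _ => q)
      fun _ => hq)

/-- A vector field with constant coordinates is the tangent map of the inverse chart applied to a
constant section, hence smooth, and the bundle metric takes smooth sections to smooth functions. -/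
lemma contDiffOn_chartMetric (x : X) (u v : 𝔼) :
    ContDiffOn ℝ ∞ (fun q => chartMetric x q u v) (coordDom x) := by
  have hsec : ∀ w : 𝔼, ContMDiffOn (𝓡 d) ((𝓡 d).prod 𝓘(ℝ, 𝔼)) ∞
      (fun q : 𝔼 => (⟨pointAt x q, vecAt x q w⟩ : TotalSpace 𝔼 (TangentSpace (𝓡 d) : X → Type _)))
      (coordDom x) := by
    intro w
    have h1 : ContMDiffOn (𝓡 d) (𝓡 d) ∞ (chartAt 𝔼 x).symm (chartAt 𝔼 x).target :=
      contMDiffOn_chart_symm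
    have h2 := h1.contMDiffOn_tangentMapWithin (m := ∞) (by simp)
      (chartAt 𝔼 x).open_target.uniqueMDiffOn
    have h3 : ContMDiffOn (𝓡 d) ((𝓡 d).prod 𝓘(ℝ, 𝔼)) ∞
        (fun q : 𝔼 => (⟨q, w⟩ : TangentBundle (𝓡 d) 𝔼)) (coordDom x) :=
      contMDiffOn_vectorSpace_iff_contDiffOn.2 contDiffOn_const
    refine (h2.comp h3 fun q hq => hq).congr fun q hq => ?_
    simp only [Function.comp, tangentMapWithin]
    rw [mfderivWithin_of_isOpen (chartAt 𝔼 x).open_target hq]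
    rfl
  have := (hsec u).inner_bundle (hsec v)
  exact this.contDiffOn

lemma exists_isMetricOn_chartMetric (x : X) :
    ∃ B, IsMetricOn (chartMetric (d := d) x) B (coordDom x) := by
  refine exists_isMetricOn (chartAt 𝔼 x).open_target ?_ ?_ ?_ ?_ (contDiffOn_chartMetric x)
  · intro q _ u u' v
    exact (congrArg (fun w : TangentSpace (𝓡 d) (pointAt x q) => inner ℝ w (vecAt x q v))
      (map_add (vecAtE x q) u u')).trans (inner_add_left (𝕜 := ℝ) _ _ _)
  · intro q _ c u v
    exact (congrArg (fun w : TangentSpace (𝓡 d) (pointAt x q) => inner ℝ w (vecAt x q v))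
      (map_smul (vecAtE x q) c u)).trans (real_inner_smul_left _ _ _)
  · intro q _ u v
    exact real_inner_comm _ _
  · intro q hq u hu
    refine real_inner_self_pos.2 fun h0 => hu ?_
    exact vecAtE_injective hq (h0.trans (map_zero (vecAtE x q)).symm)

lemma exists_isMetricOn_prodMetric {k : ℕ} (x : Fin k → X) :
    ∃ B, IsMetricOn (prodMetric (d := d) x) B (prodDom x) := by
  choose B hB using fun i => exists_isMetricOn_chartMetric (d := d) (x i)
  refine exists_isMetricOn (isOpen_prodDom x) ?_ ?_ ?_ ?_ ?_
  · intro q hq u u' v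
    simp only [prodMetric]
    rw [← Finset.sum_add_distrib]
    refine Finset.sum_congr rfl fun i _ => ?_
    have hi := hq i (mem_univ i)
    rw [(hB i).eq _ hi, (hB i).eq _ hi, (hB i).eq _ hi]; simp
  · intro q hq c u v
    simp only [prodMetric]
    rw [Finset.mul_sum]
    refine Finset.sum_congr rfl fun i _ => ?_
    have hi := hq i (mem_univ i)
    rw [(hB i).eq _ hi, (hB i).eq _ hi]; simp
  · intro q hq u v
    exact Finset.sum_congr rfl fun i _ => real_inner_comm _ _
  · intro q hq u hu
    obtain ⟨i, hi⟩ := Function.ne_iff.1 hu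
    refine Finset.sum_pos' (fun j _ => real_inner_self_nonneg) ⟨i, Finset.mem_univ i, ?_⟩
    have hi' := hq i (mem_univ i)
    rw [(hB i).eq _ hi']
    exact (hB i).pos _ hi' _ hi
  · intro u v
    refine ContDiffOn.sum fun i _ => ?_
    exact (contDiffOn_chartMetric (x i) (u i) (v i)).comp (contDiff_apply ℝ 𝔼 i).contDiffOn
      fun q hq => hq i (mem_univ i)

/-- The i-th summand of the product metric involves only the i-th coordinate, so Koszul's identity
is the sum of those of the factors, and its solution is unique. This is what identifies moving the
single point x_i with a covariant derivative on X^k. -/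
lemma christoffel_prodMetric {k : ℕ} (x : Fin k → X) {p : Fin k → 𝔼} (hp : p ∈ prodDom x)
    (u v : Fin k → 𝔼) :
    christoffel (prodMetric x) p u v = fun i => christoffel (chartMetric (x i)) (p i) (u i) (v i) := by
  obtain ⟨B, hB⟩ := exists_isMetricOn_prodMetric (d := d) x
  choose C hC using fun i => exists_isMetricOn_chartMetric (d := d) (x i)
  symm
  refine hB.eq_christoffel hp fun z => ?_
  have hd : ∀ a b c : Fin k → 𝔼, fderiv ℝ (fun q => prodMetric x q a b) p c =
      ∑ i, fderiv ℝ (C i) (p i) (c i) (a i) (b i) := by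
    intro a b c
    have h1 : ∀ i, HasFDerivAt (fun q : Fin k → 𝔼 => chartMetric (x i) (q i) (a i) (b i))
        ((fderiv ℝ (fun q => chartMetric (x i) q (a i) (b i)) (p i)).comp
          (ContinuousLinearMap.proj i)) p := by
      intro i
      have h2 := (((contDiffOn_chartMetric (x i) (a i) (b i)).contDiffAt
        ((hC i).isOpen.mem_nhds (hp i (mem_univ i)))).differentiableAt (by simp)).hasFDerivAt
      exact HasFDerivAt.comp (f := fun q : Fin k → 𝔼 => q i) p h2 (hasFDerivAt_apply i p)
    have h3 := HasFDerivAt.fun_sum fun i (_ : i ∈ Finset.univ) => h1 i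
    have h4 := congrArg (fun L : (Fin k → 𝔼) →L[ℝ] ℝ => L c) h3.fderiv
    refine h4.trans ?_
    rw [ContinuousLinearMap.sum_apply]
    refine Finset.sum_congr rfl fun i _ => ?_
    exact (hC i).fderiv_eq (hp i (mem_univ i)) _ _ _
  rw [hd, hd, hd]
  simp only [prodMetric]
  rw [Finset.mul_sum, ← Finset.sum_add_distrib, ← Finset.sum_sub_distrib]
  refine Finset.sum_congr rfl fun i _ => ?_
  have hi := hp i (mem_univ i)
  rw [(hC i).eq _ hi, (hC i).flat_christoffel hi]
  simp only [koszul, ContinuousLinearMap.smul_apply, ContinuousLinearMap.sub_apply,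
    ContinuousLinearMap.add_apply, ContinuousLinearMap.flip_apply, smul_eq_mul]
  ring

lemma parallelExt_prodMetric {k : ℕ} (x : Fin k → X) {p : Fin k → 𝔼} (hp : p ∈ prodDom x)
    (v q : Fin k → 𝔼) (i : Fin k) :
    parallelExt (prodMetric x) p v q i = parallelExt (chartMetric (x i)) (p i) (v i) (q i) := by
  unfold parallelExt
  rw [christoffel_prodMetric x hp]
  rfl

end ChartGeometry

/-! ### Multilinear forms: smoothness and Hilbert-Schmidt products -/

section Multilinear

variable {F V : Type*} [NormedAddCommGroup F] [NormedSpace ℝ F] [NormedAddCommGroup V]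
  [NormedSpace ℝ V] [FiniteDimensional ℝ V] {n : ℕ}

/-- A multilinear map depending smoothly on a parameter is smooth in all variables. -/
lemma contDiffOn_multilinear {A : F → MultilinearMap ℝ (fun _ : Fin n => V) ℝ} {s : Set F}
    (hA : ∀ w, ContDiffOn ℝ ∞ (fun q => A q w) s) :
    ContDiffOn ℝ ∞ (fun z : F × (Fin n → V) => A z.1 z.2) (s ×ˢ univ) := by
  classical
  let b := Module.finBasis ℝ V
  have h : (fun z : F × (Fin n → V) => A z.1 z.2) = fun z =>
      ∑ J : Fin n → Fin (Module.finrank ℝ V), (∏ m, LinearMap.toContinuousLinearMap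
        (b.coord (J m)) (z.2 m)) * A z.1 fun m => b (J m) := by
    funext z
    have h1 : z.2 = fun m => ∑ i, b.repr (z.2 m) i • b i := by
      funext m; exact (b.sum_repr (z.2 m)).symm
    conv_lhs => rw [h1]
    rw [MultilinearMap.map_sum]
    refine Finset.sum_congr rfl fun J _ => ?_
    rw [MultilinearMap.map_smul_univ]
    rfl
  rw [h]
  refine ContDiffOn.sum fun J _ => ContDiffOn.mul ?_ ?_
  · refine contDiffOn_prod fun m _ => ?_
    exact ((ContinuousLinearMap.contDiff _).comp ((contDiff_apply ℝ V m).comp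
      contDiff_snd)).contDiffOn
  · exact (hA fun m => b (J m)).comp contDiff_fst.contDiffOn fun z hz => hz.1

/-- The Hilbert-Schmidt product of multilinear forms, in terms of the inverse of the Gram
matrix `M` of a basis. -/
lemma sum_multilinear_eq_gram {ι : Type*} [Fintype ι] [DecidableEq ι] (b : Module.Basis ι ℝ V)
    (e : ι → V) {G : V → V → ℝ} (B : V →L[ℝ] V →L[ℝ] ℝ) (hB : ∀ u v, G u v = B u v)
    (he : ∀ i j, G (e i) (e j) = if i = j then 1 else 0)
    (α β : MultilinearMap ℝ (fun _ : Fin n => V) ℝ) :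
    ∑ J : Fin n → ι, α (fun m => e (J m)) * β (fun m => e (J m)) =
      ∑ I : Fin n → ι, ∑ I' : Fin n → ι,
        (∏ m, (Matrix.of fun i j => G (b i) (b j))⁻¹ (I m) (I' m)) *
          (α (fun m => b (I m)) * β (fun m => b (I' m))) ∧
      (Matrix.of fun i j => G (b i) (b j)).det ≠ 0 := by
  set M : Matrix ι ι ℝ := Matrix.of fun i j => G (b i) (b j) with hM
  set C : Matrix ι ι ℝ := Matrix.of fun i j => b.repr (e i) j with hC
  have hexp : ∀ i, e i = ∑ j, C i j • b j := fun i => (b.sum_repr (e i)).symm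
  -- Orthonormality of e, written in the basis b with coefficient matrix C. It gives M⁻¹ = Cᵀ C, and
  -- expanding each e (J m) in the basis then produces the products of entries of M⁻¹.
  have h1 : C * (M * C.transpose) = 1 := by
    ext i j
    have h2 : G (e i) (e j) = ∑ x, ∑ y, C i x * (M x y * C j y) := by
      rw [hB, hexp i, hexp j]
      simp only [map_sum, map_smul, _root_.sum_apply, ContinuousLinearMap.smul_apply, smul_eq_mul,
        Finset.mul_sum]
      rw [Finset.sum_comm]
      refine Finset.sum_congr rfl fun x _ => Finset.sum_congr rfl fun y _ => ?_
      simp only [hM, Matrix.of_apply, hB]; ring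
    rw [Matrix.one_apply, ← he, h2]
    simp only [Matrix.mul_apply, Finset.mul_sum, Matrix.transpose_apply]
  have h2 : M⁻¹ = C.transpose * C := by
    refine Matrix.inv_eq_right_inv ?_
    rw [← Matrix.mul_assoc]
    exact mul_eq_one_comm.1 h1
  refine ⟨?_, fun h0 => ?_⟩
  swap
  · have := congrArg Matrix.det h1
    simp [Matrix.det_mul, h0] at this
  have h3 : ∀ (α : MultilinearMap ℝ (fun _ : Fin n => V) ℝ) (J : Fin n → ι),
      α (fun m => e (J m)) = ∑ I : Fin n → ι, (∏ m, C (J m) (I m)) * α fun m => b (I m) := by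
    intro α J
    simp_rw [hexp]
    rw [MultilinearMap.map_sum]
    refine Finset.sum_congr rfl fun I _ => ?_
    rw [MultilinearMap.map_smul_univ, smul_eq_mul]
  have h4 : ∀ I I' : Fin n → ι, ∏ m, M⁻¹ (I m) (I' m) =
      ∑ J : Fin n → ι, (∏ m, C (J m) (I m)) * ∏ m, C (J m) (I' m) := by
    intro I I'
    simp_rw [h2, Matrix.mul_apply, Matrix.transpose_apply, ← Finset.prod_mul_distrib]
    rw [Finset.prod_univ_sum, Fintype.piFinset_univ]
  simp_rw [h3, h4, Finset.sum_mul_sum, Finset.sum_mul]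
  rw [Finset.sum_comm]
  refine Finset.sum_congr rfl fun I _ => ?_
  rw [Finset.sum_comm]
  refine Finset.sum_congr rfl fun I' _ => Finset.sum_congr rfl fun J _ => ?_
  ring

end Multilinear

/-! ### The covariant derivative of forms on X ^ k, and continuity of inner products -/

section CovariantDerivative

variable {d : ℕ} {X : Type*} [MetricSpace X] [ChartedSpace (EuclideanSpace ℝ (Fin d)) X]

local notation "𝔼" => EuclideanSpace ℝ (Fin d)

variable {n k : ℕ} [IsManifold (𝓡 d) ∞ X]

/-- The form `η` in the product of the preferred charts around `x₁, …, x_k`. -/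
def formIn (η : ∀ x : Fin k → X, PowFormAt d n x) (x : Fin k → X) (q : Fin k → 𝔼) :
    MultilinearMap ℝ (fun _ : Fin n => Fin k → 𝔼) ℝ :=
  (η fun i => pointAt (x i) (q i)).toMultilinearMap.compLinearMap fun _ =>
    LinearMap.pi fun i => (vecAtE (x i) (q i)).toLinearMap.comp
      (LinearMap.proj i : (Fin k → 𝔼) →ₗ[ℝ] 𝔼)

lemma formIn_apply (η : ∀ x : Fin k → X, PowFormAt d n x) (x : Fin k → X) (q : Fin k → 𝔼)
    (w : Fin n → Fin k → 𝔼) :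
    formIn η x q w = η (fun i => pointAt (x i) (q i)) fun m i => vecAt (x i) (q i) (w m i) := rfl

/-- Smoothness of a form on `X ^ k`. -/
def SmoothForm (η : ∀ x : Fin k → X, PowFormAt d n x) : Prop :=
  ∀ (x : Fin k → X) (v : Fin n → Fin k → 𝔼),
    ContDiffOn ℝ ∞ (fun q : Fin k → 𝔼 =>
      η (fun i => pointAt (x i) (q i)) fun m i => vecAt (x i) (q i) (v m i)) (prodDom x)

lemma SmoothForm.contDiffOn_formIn {η : ∀ x : Fin k → X, PowFormAt d n x} (hη : SmoothForm η)
    (x : Fin k → X) : ContDiffOn ℝ ∞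
      (fun z : (Fin k → 𝔼) × (Fin n → Fin k → 𝔼) => formIn η x z.1 z.2) (prodDom x ×ˢ univ) :=
  contDiffOn_multilinear (A := formIn η x) fun w => hη x w

lemma SmoothForm.differentiableAt_formIn {η : ∀ x : Fin k → X, PowFormAt d n x}
    (hη : SmoothForm η) {x : Fin k → X} {p : Fin k → 𝔼} (hp : p ∈ prodDom x)
    (w : Fin n → Fin k → 𝔼) : DifferentiableAt ℝ
      (fun z : (Fin k → 𝔼) × (Fin n → Fin k → 𝔼) => formIn η x z.1 z.2) (p, w) :=
  ((hη.contDiffOn_formIn x).contDiffAt (((isOpen_prodDom (d := d) x).prod isOpen_univ).mem_nhds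
      ⟨hp, mem_univ _⟩)).differentiableAt (by simp)

variable [RiemannianBundle (fun x : X => TangentSpace (𝓡 d) x)]
    [IsContMDiffRiemannianBundle (𝓡 d) ∞ (EuclideanSpace ℝ (Fin d))
      (fun x : X => TangentSpace (𝓡 d) x)]

/-- The covariant derivative of `η` in the product of the preferred charts around
`x₁, …, x_k`. -/
def covIn (η : ∀ x : Fin k → X, PowFormAt d n x) (x : Fin k → X) (p u : Fin k → 𝔼)
    (v : Fin n → Fin k → 𝔼) : ℝ :=
  fderiv ℝ (fun q => formIn η x q fun m => parallelExt (prodMetric x) p (v m) q) p u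

lemma gradPow_eq_covIn (η : ∀ x : Fin k → X, PowFormAt d n x) (x : Fin k → X)
    (u : ∀ i, TangentSpace (𝓡 d) (x i)) (v : Fin n → ∀ i, TangentSpace (𝓡 d) (x i)) :
    gradPow η x u v = covIn η x (fun i => coordAt d (x i)) (fun i => vecCoord (x i) (u i))
      fun m i => vecCoord (x i) (v m i) := rfl

/-- Chain rule for q ↦ (q, V₁(q), …, Vₙ(q)), in which V_m has derivative -Γ_p(u, v_m) in direction u
at p. This is the classical expression of the covariant derivative by Christoffel symbols. -/
lemma SmoothForm.hasFDerivAt_formIn_parallelExt {η : ∀ x : Fin k → X, PowFormAt d n x}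
    (hη : SmoothForm η) {x : Fin k → X} {p : Fin k → 𝔼} (hp : p ∈ prodDom x)
    (v : Fin n → Fin k → 𝔼) :
    ∃ L : (Fin k → 𝔼) →L[ℝ] ℝ, HasFDerivAt
      (fun q => formIn η x q fun m => parallelExt (prodMetric x) p (v m) q) L p ∧
      ∀ u, L u = fderiv ℝ (fun z : (Fin k → 𝔼) × (Fin n → Fin k → 𝔼) => formIn η x z.1 z.2) (p, v)
        (u, fun m => -christoffel (prodMetric x) p u (v m)) := by
  obtain ⟨B, hB⟩ := exists_isMetricOn_prodMetric (d := d) x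
  have h1 : HasFDerivAt (fun q => fun m => parallelExt (prodMetric x) p (v m) q)
      (ContinuousLinearMap.pi fun m =>
        -(LinearMap.toContinuousLinearMap ((hB.christoffelL hp).flip (v m)))) p :=
    hasFDerivAt_pi.2 fun m => hB.hasFDerivAt_parallelExt hp (v m) p
  have h2 := (hasFDerivAt_id p).prodMk h1
  have h3 := (hη.differentiableAt_formIn hp v).hasFDerivAt
  have h4 : (id p, fun m => parallelExt (prodMetric x) p (v m) p) = (p, v) := by
    simp only [hB.parallelExt_self hp]; rfl
  rw [← h4] at h3
  have h5 := HasFDerivAt.comp (f := fun q => (id q, fun m => parallelExt (prodMetric x) p (v m) q))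
    p h3 h2
  refine ⟨_, h5, fun u => ?_⟩
  rw [h4]
  rfl

lemma SmoothForm.covIn_eq {η : ∀ x : Fin k → X, PowFormAt d n x}
    (hη : SmoothForm η) {x : Fin k → X} {p : Fin k → 𝔼} (hp : p ∈ prodDom x) (u : Fin k → 𝔼)
    (v : Fin n → Fin k → 𝔼) :
    covIn η x p u v = fderiv ℝ (fun z : (Fin k → 𝔼) × (Fin n → Fin k → 𝔼) => formIn η x z.1 z.2)
      (p, v) (u, fun m => -christoffel (prodMetric x) p u (v m)) := by
  obtain ⟨L, h1, h2⟩ := hη.hasFDerivAt_formIn_parallelExt hp v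
  rw [← h2, covIn, h1.fderiv]

lemma SmoothForm.continuousOn_covIn {η : ∀ x : Fin k → X, PowFormAt d n x} (hη : SmoothForm η)
    (x : Fin k → X) (u : Fin k → 𝔼) (v : Fin n → Fin k → 𝔼) :
    ContinuousOn (fun p => covIn η x p u v) (prodDom x) := by
  obtain ⟨B, hB⟩ := exists_isMetricOn_prodMetric (d := d) x
  have h1 := (hη.contDiffOn_formIn x).continuousOn_fderiv_of_isOpen
    ((isOpen_prodDom (d := d) x).prod isOpen_univ) (by simp)
  have h2 : ContinuousOn (fun p => fderiv ℝ (fun z : (Fin k → 𝔼) × (Fin n → Fin k → 𝔼) =>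
      formIn η x z.1 z.2) (p, v)) (prodDom x) :=
    h1.comp (by fun_prop) fun p hp => ⟨hp, mem_univ _⟩
  refine (h2.clm_apply (g := fun p => (u, fun m => -christoffel (prodMetric x) p u (v m)))
    ?_).congr fun p hp => hη.covIn_eq hp u v
  exact continuousOn_const.prodMk (continuousOn_pi.2 fun m => (hB.continuousOn_christoffel u (v m)).neg)

/-- The covariant derivative at `p` as a multilinear map. -/
def SmoothForm.covMultilinear {η : ∀ x : Fin k → X, PowFormAt d n x} (hη : SmoothForm η)
    {x : Fin k → X} {p : Fin k → 𝔼} (hp : p ∈ prodDom x) :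
    (Fin k → 𝔼) →ₗ[ℝ] MultilinearMap ℝ (fun _ : Fin n => Fin k → 𝔼) ℝ where
  toFun u :=
    { toFun := covIn η x p u
      map_update_add' := by
        intro _ v m a b
        obtain ⟨B, hB⟩ := exists_isMetricOn_prodMetric (d := d) x
        obtain ⟨L, h1, -⟩ := hη.hasFDerivAt_formIn_parallelExt hp (Function.update v m a)
        obtain ⟨L', h1', -⟩ := hη.hasFDerivAt_formIn_parallelExt hp (Function.update v m b)
        have e : ∀ w : Fin k → 𝔼, ∀ q, (fun m' => parallelExt (prodMetric x) p
            (Function.update v m w m') q) = Function.update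
              (fun m' => parallelExt (prodMetric x) p (v m') q) m
              (parallelExt (prodMetric x) p w q) := by
          intro w q; funext m'
          by_cases hm : m' = m
          · subst hm; simp
          · simp [hm]
        have e2 : (fun q => formIn η x q fun m' => parallelExt (prodMetric x) p
            (Function.update v m (a + b) m') q) = fun q =>
            (formIn η x q fun m' => parallelExt (prodMetric x) p (Function.update v m a m') q) +
            (formIn η x q fun m' => parallelExt (prodMetric x) p (Function.update v m b m') q) := by
          funext q
          rw [e, e, e, ← MultilinearMap.map_update_add]
          congr 2
          simp only [hB.parallelExt_eq hp, map_add]; abel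
        simp only [covIn]
        rw [e2, (h1.fun_add h1').fderiv, h1.fderiv, h1'.fderiv]; rfl
      map_update_smul' := by
        intro _ v m c a
        obtain ⟨B, hB⟩ := exists_isMetricOn_prodMetric (d := d) x
        obtain ⟨L, h1, -⟩ := hη.hasFDerivAt_formIn_parallelExt hp (Function.update v m a)
        have e : ∀ w : Fin k → 𝔼, ∀ q, (fun m' => parallelExt (prodMetric x) p
            (Function.update v m w m') q) = Function.update
              (fun m' => parallelExt (prodMetric x) p (v m') q) m
              (parallelExt (prodMetric x) p w q) := by
          intro w q; funext m'
          by_cases hm : m' = m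
          · subst hm; simp
          · simp [hm]
        have e2 : (fun q => formIn η x q fun m' => parallelExt (prodMetric x) p
            (Function.update v m (c • a) m') q) = fun q => c •
            (formIn η x q fun m' => parallelExt (prodMetric x) p (Function.update v m a m') q) := by
          funext q
          rw [e, e, ← MultilinearMap.map_update_smul]
          congr 2
          simp only [hB.parallelExt_eq hp, map_smul, smul_sub]
        simp only [covIn]
        rw [e2, (h1.fun_const_smul c).fderiv, h1.fderiv]; rfl }
  map_add' u u' := by
    exact MultilinearMap.ext fun v => map_add (fderiv ℝ (fun q => formIn η x q fun m =>
      parallelExt (prodMetric x) p (v m) q) p) u u'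
  map_smul' c u := by
    exact MultilinearMap.ext fun v => map_smul (fderiv ℝ (fun q => formIn η x q fun m =>
      parallelExt (prodMetric x) p (v m) q) p) c u

/-- The covariant derivative does not depend on the charts. -/
lemma SmoothForm.covIn_transition {η : ∀ x : Fin k → X, PowFormAt d n x} (hη : SmoothForm η)
    {x x' : Fin k → X} {p : Fin k → 𝔼} (hp : ∀ i, p i ∈ overlap (x i) (x' i)) (u : Fin k → 𝔼)
    (v : Fin n → Fin k → 𝔼) :
    covIn η x p u v = covIn η x' (fun i => transition (x i) (x' i) (p i))
      (fun i => fderiv ℝ (transition (x i) (x' i)) (p i) (u i))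
      fun m i => fderiv ℝ (transition (x i) (x' i)) (p i) (v m i) := by
  obtain ⟨B, hB⟩ := exists_isMetricOn_prodMetric (d := d) x
  obtain ⟨B', hB'⟩ := exists_isMetricOn_prodMetric (d := d) x'
  set ψ : (Fin k → 𝔼) → (Fin k → 𝔼) := fun q i => transition (x i) (x' i) (q i) with hψdef
  have hO : IsOpen (univ.pi fun i => overlap (d := d) (x i) (x' i)) :=
    isOpen_set_pi finite_univ fun i _ => isOpen_overlap _ _
  have hpO : p ∈ univ.pi fun i => overlap (d := d) (x i) (x' i) := fun i _ => hp i
  have hψ : ContDiffOn ℝ ∞ ψ (univ.pi fun i => overlap (d := d) (x i) (x' i)) := by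
    refine contDiffOn_pi.2 fun i => ?_
    exact (contDiffOn_transition (x i) (x' i)).comp (contDiff_apply ℝ 𝔼 i).contDiffOn
      fun q hq => hq i (mem_univ i)
  have hDψ : ∀ q ∈ univ.pi fun i => overlap (d := d) (x i) (x' i), ∀ w i, fderiv ℝ ψ q w i =
      fderiv ℝ (transition (x i) (x' i)) (q i) (w i) := by
    intro q hq w i
    have h1 : ∀ i, HasFDerivAt (fun q : Fin k → 𝔼 => transition (x i) (x' i) (q i))
        ((fderiv ℝ (transition (x i) (x' i)) (q i)).comp (ContinuousLinearMap.proj i)) q := by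
      intro i
      have h2 := (((contDiffOn_transition (x i) (x' i)).contDiffAt ((isOpen_overlap _ _).mem_nhds
        (hq i (mem_univ i)))).differentiableAt (by simp)).hasFDerivAt
      exact HasFDerivAt.comp (f := fun q : Fin k → 𝔼 => q i) q h2 (hasFDerivAt_apply i q)
    have h3 : HasFDerivAt ψ (ContinuousLinearMap.pi fun i =>
        (fderiv ℝ (transition (x i) (x' i)) (q i)).comp (ContinuousLinearMap.proj i)) q :=
      hasFDerivAt_pi.2 h1
    rw [h3.fderiv]; rfl
  have hpx : p ∈ prodDom x := fun i _ => overlap_subset _ _ (hp i)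
  have hpx' : ψ p ∈ prodDom x' := fun i _ => transition_mem (hp i)
  have hψp : ContDiffAt ℝ ∞ ψ p := hψ.contDiffAt (hO.mem_nhds hpO)
  have hψ1 : HasFDerivAt ψ (fderiv ℝ ψ p) p := (hψp.differentiableAt (by simp)).hasFDerivAt
  have hψ2 : HasFDerivAt (fderiv ℝ ψ) (fderiv ℝ (fderiv ℝ ψ) p) p :=
    ((hψp.fderiv_right (m := 1) (by norm_cast)).differentiableAt (by simp)).hasFDerivAt
  have hform : ∀ q ∈ univ.pi fun i => overlap (d := d) (x i) (x' i), ∀ w : Fin n → Fin k → 𝔼,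
      formIn η x q w = formIn η x' (ψ q) fun m => fderiv ℝ ψ q (w m) := by
    intro q hq w
    rw [formIn_apply, formIn_apply]
    have h1 := congrArg (fun s : PointedFam d X k => η s.1 fun m i => s.2 i (w m i))
      (pointedFam_transition (x := x) (x' := x') (q := q) fun i => hq i (mem_univ i))
    refine h1.trans ?_
    simp only [hDψ q hq]
    rfl
  have hmet : ∀ᶠ q in 𝓝 p, ∀ u v, prodMetric x q u v =
      prodMetric x' (ψ q) (fderiv ℝ ψ q u) (fderiv ℝ ψ q v) := by
    filter_upwards [hO.mem_nhds hpO] with q hq u v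
    refine Finset.sum_congr rfl fun i _ => ?_
    rw [chartMetric_transition (hq i (mem_univ i)), hDψ q hq, hDψ q hq]
  have hsurj : Function.Surjective (fderiv ℝ ψ p) := by
    intro w
    choose z hz using fun i => fderiv_transition_surjective (hp i) (w i)
    refine ⟨z, funext fun i => ?_⟩
    rw [hDψ p hpO, hz]
  have e1 : (fun q => formIn η x q fun m => parallelExt (prodMetric x) p (v m) q) =ᶠ[𝓝 p]
      fun q => formIn η x' (ψ q) fun m => fderiv ℝ ψ q (parallelExt (prodMetric x) p (v m) q) := by
    filter_upwards [hO.mem_nhds hpO] with q hq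
    rw [hform q hq]
  have h1 : HasFDerivAt (fun q => fun m => fderiv ℝ ψ q (parallelExt (prodMetric x) p (v m) q))
      (ContinuousLinearMap.pi fun m => (fderiv ℝ ψ p).comp
        (-(LinearMap.toContinuousLinearMap ((hB.christoffelL hpx).flip (v m)))) +
        (fderiv ℝ (fderiv ℝ ψ) p).flip (v m)) p := by
    refine hasFDerivAt_pi.2 fun m => ?_
    have := hψ2.clm_apply (hB.hasFDerivAt_parallelExt hpx (v m) p)
    rw [hB.parallelExt_self hpx] at this
    exact this
  have h2 := hψ1.prodMk h1
  have h3 := (hη.differentiableAt_formIn hpx' fun m => fderiv ℝ ψ p (v m)).hasFDerivAt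
  have h4 : (ψ p, fun m => fderiv ℝ ψ p (parallelExt (prodMetric x) p (v m) p)) =
      (ψ p, fun m => fderiv ℝ ψ p (v m)) := by
    simp only [hB.parallelExt_self hpx]
  rw [← h4] at h3
  have h5 := HasFDerivAt.comp
    (f := fun q => (ψ q, fun m => fderiv ℝ ψ q (parallelExt (prodMetric x) p (v m) q))) p h3 h2
  have e2 : covIn η x p u v = covIn η x' (ψ p) (fderiv ℝ ψ p u) fun m => fderiv ℝ ψ p (v m) := by
    rw [hη.covIn_eq hpx', covIn, e1.fderiv_eq]
    refine (congrArg (fun L : (Fin k → 𝔼) →L[ℝ] ℝ => L u) h5.fderiv).trans ?_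
    rw [h4]
    refine congrArg (fderiv ℝ (fun z : (Fin k → 𝔼) × (Fin n → Fin k → 𝔼) => formIn η x' z.1 z.2)
      (ψ p, fun m => fderiv ℝ ψ p (v m))) ?_
    refine Prod.ext rfl (funext fun m => ?_)
    -- The image under Dψ of the field extending v_m need not be the corresponding field in the new
    -- chart, but by the transformation law both have the same first derivative at the base point,
    -- and nothing else enters.
    have h6 := hB'.fderiv_christoffel hB hpx hψp hpx' hmet hsurj u (v m)
    show fderiv ℝ ψ p (-christoffel (prodMetric x) p u (v m)) + fderiv ℝ (fderiv ℝ ψ) p u (v m) =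
      -christoffel (prodMetric x') (ψ p) (fderiv ℝ ψ p u) (fderiv ℝ ψ p (v m))
    rw [map_neg, h6]; abel
  rw [e2]
  congr 1
  · exact funext fun i => hDψ p hpO u i
  · exact funext fun m => funext fun i => hDψ p hpO (v m) i

/-- The covariant derivative in the charts around `x₁, …, x_k`. -/
lemma SmoothForm.gradPow_eq {η : ∀ x : Fin k → X, PowFormAt d n x} (hη : SmoothForm η)
    {x y : Fin k → X} (hy : ∀ i, y i ∈ (chartAt 𝔼 (x i)).source)
    (u : ∀ i, TangentSpace (𝓡 d) (y i)) (v : Fin n → ∀ i, TangentSpace (𝓡 d) (y i)) :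
    gradPow η y u v = covIn η x (fun i => chartAt 𝔼 (x i) (y i))
      (fun i => coordDeriv (x i) (y i) (u i)) fun m i => coordDeriv (x i) (y i) (v m i) := by
  rw [gradPow_eq_covIn]
  have hp : ∀ i, coordAt d (y i) ∈ overlap (y i) (x i) := fun i =>
    ⟨coordAt_mem _, by
      show pointAt (y i) (coordAt d (y i)) ∈ (chartAt 𝔼 (x i)).source
      rw [pointAt_coordAt (d := d)]; exact hy i⟩
  rw [hη.covIn_transition hp]
  have h1 : ∀ i (w : 𝔼), fderiv ℝ (transition (y i) (x i)) (coordAt d (y i))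
      (coordDeriv (y i) (y i) w) = coordDeriv (x i) (y i) w := fun i w =>
    DFunLike.congr_fun (coordDeriv_transition (mem_chart_source 𝔼 (y i)) (hy i)) w
  have h2 : ∀ i, transition (y i) (x i) (coordAt d (y i)) = chartAt 𝔼 (x i) (y i) := fun i => by
    show chartAt 𝔼 (x i) (pointAt (y i) (coordAt d (y i))) = _
    rw [pointAt_coordAt]
  congr 1
  · exact funext h2
  · exact funext fun i => h1 i (u i)
  · exact funext fun m => funext fun i => h1 i (v m i)

/-- The orthonormal basis of `T_y X ^ k` made of the bases `frame (y i)`. -/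
def powFrame (y : Fin k → X) (J : Σ _ : Fin k, Fin d) : ∀ i, TangentSpace (𝓡 d) (y i) :=
  Pi.single J.1 (frame (y J.1) J.2)

lemma innerPow_eq_sum (y : Fin k → X) (α β : (Fin n → ∀ i, TangentSpace (𝓡 d) (y i)) → ℝ) :
    innerPow y α β = ∑ J : Fin n → Σ _ : Fin k, Fin d,
      α (fun m => powFrame y (J m)) * β (fun m => powFrame y (J m)) := by
  unfold innerPow
  rw [← Fintype.sum_prod_type']
  refine Fintype.sum_equiv ((Equiv.arrowProdEquivProdArrow (Fin n) (fun _ => Fin k)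
    (fun _ => Fin d)).symm.trans (Equiv.arrowCongr (Equiv.refl _) (Equiv.sigmaEquivProd _ _).symm))
    _ _ fun J => rfl

lemma innerGradPow_eq_sum (y : Fin k → X) (A B : (∀ i, TangentSpace (𝓡 d) (y i)) →
      (Fin n → ∀ i, TangentSpace (𝓡 d) (y i)) → ℝ) :
    innerGradPow y A B = ∑ J : Fin (n + 1) → Σ _ : Fin k, Fin d,
      A (powFrame y (J 0)) (fun m => powFrame y (J m.succ)) *
        B (powFrame y (J 0)) (fun m => powFrame y (J m.succ)) := by
  unfold innerGradPow
  rw [← (Fin.consEquiv fun _ : Fin (n + 1) => Σ _ : Fin k, Fin d).sum_comp, Fintype.sum_prod_type,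
    Fintype.sum_sigma]
  refine Finset.sum_congr rfl fun i _ => Finset.sum_congr rfl fun a _ => ?_
  rw [innerPow_eq_sum]
  rfl

/-- The standard basis of `𝔼 ^ k`. -/
def coordBasis (d k : ℕ) : Module.Basis (Σ _ : Fin k, Fin d) ℝ (Fin k → EuclideanSpace ℝ (Fin d)) :=
  Pi.basis fun _ => (EuclideanSpace.basisFun (Fin d) ℝ).toBasis

/-- The matrix of the metric in the charts around `x₁, …, x_k`, at the point `y`. -/
def gramAt (x y : Fin k → X) : Matrix (Σ _ : Fin k, Fin d) (Σ _ : Fin k, Fin d) ℝ :=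
  Matrix.of fun I J => prodMetric x (fun i => chartAt 𝔼 (x i) (y i))
    (coordBasis d k I)
    (coordBasis d k J)

lemma prodMetric_powFrame {x y : Fin k → X} (hy : ∀ i, y i ∈ (chartAt 𝔼 (x i)).source)
    (I J : Σ _ : Fin k, Fin d) :
    prodMetric x (fun i => chartAt 𝔼 (x i) (y i))
      (fun i => coordDeriv (x i) (y i) (powFrame y I i))
      (fun i => coordDeriv (x i) (y i) (powFrame y J i)) = if I = J then 1 else 0 := by
  have h1 := congrArg (fun s : PointedFam d X k => ∑ i, (inner ℝ (s.2 i (powFrame y I i))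
    (s.2 i (powFrame y J i)) : ℝ)) (pointedFam_coordDeriv hy)
  refine h1.trans ?_
  show ∑ i, (inner ℝ (powFrame y I i) (powFrame y J i) : ℝ) = _
  obtain ⟨i, a⟩ := I
  obtain ⟨j, b⟩ := J
  rw [Finset.sum_eq_single i]
  · simp only [powFrame, Pi.single_eq_same]
    by_cases hij : i = j
    · subst hij
      rw [Pi.single_eq_same, orthonormal_iff_ite.1 (frame (y i)).orthonormal]
      simp
    · rw [Pi.single_eq_of_ne hij, inner_zero_right, if_neg]
      intro h; exact hij (congrArg Sigma.fst h)
  · intro i' _ hi'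
    simp only [powFrame]
    rw [Pi.single_eq_of_ne hi', inner_zero_left]
  · simp

/-- The bases `frame` are chosen independently at each point and need not depend continuously on it.
Sums over them are rewritten with the inverse Gram matrix of the coordinate basis, which does. -/
lemma prodMetric_gram {x y : Fin k → X} (hy : ∀ i, y i ∈ (chartAt 𝔼 (x i)).source)
    (α β : MultilinearMap ℝ (fun _ : Fin n => Fin k → 𝔼) ℝ) :
    ∑ J : Fin n → Σ _ : Fin k, Fin d,
      α (fun m i => coordDeriv (x i) (y i) (powFrame (d := d) y (J m) i)) *
        β (fun m i => coordDeriv (x i) (y i) (powFrame (d := d) y (J m) i)) =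
      ∑ I : Fin n → Σ _ : Fin k, Fin d, ∑ I' : Fin n → Σ _ : Fin k, Fin d,
        (∏ m, (gramAt (d := d) x y)⁻¹ (I m) (I' m)) *
          (α (fun m => coordBasis d k (I m)) *
          β (fun m => coordBasis d k (I' m))) ∧ (gramAt (d := d) x y).det ≠ 0 := by
  obtain ⟨B, hB⟩ := exists_isMetricOn_prodMetric (d := d) x
  have hp : (fun i => chartAt 𝔼 (x i) (y i)) ∈ prodDom x := fun i _ =>
    (chartAt 𝔼 (x i)).map_source (hy i)
  exact sum_multilinear_eq_gram (n := n) (coordBasis d k)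
    (fun J : Σ _ : Fin k, Fin d => fun i => coordDeriv (x i) (y i) (powFrame y J i)) (B _) (hB.eq _ hp)
    (fun I J => prodMetric_powFrame hy I J) α β

lemma continuousAt_prodChart (y₀ : Fin k → X) :
    ContinuousAt (fun y : Fin k → X => fun i => chartAt 𝔼 (y₀ i) (y i)) y₀ := by
  refine continuousAt_pi.2 fun i => ?_
  exact ContinuousAt.comp (f := fun y : Fin k → X => y i)
    ((chartAt 𝔼 (y₀ i)).continuousAt (mem_chart_source 𝔼 (y₀ i))) (continuousAt_apply i y₀)

lemma eventually_mem_source (y₀ : Fin k → X) :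
    ∀ᶠ y in 𝓝 y₀, ∀ i, y i ∈ (chartAt 𝔼 (y₀ i)).source :=
  Filter.eventually_all.2 fun i => (continuousAt_apply i y₀).eventually
    ((chartAt 𝔼 (y₀ i)).open_source.mem_nhds (mem_chart_source 𝔼 (y₀ i)))

lemma prodChart_mem {x y : Fin k → X} (hy : ∀ i, y i ∈ (chartAt 𝔼 (x i)).source) :
    (fun i => chartAt 𝔼 (x i) (y i)) ∈ prodDom x :=
  fun i _ => (chartAt 𝔼 (x i)).map_source (hy i)

lemma continuousAt_gramAt_inv (y₀ : Fin k → X) (I J : Σ _ : Fin k, Fin d) :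
    ContinuousAt (fun y => (gramAt (d := d) y₀ y)⁻¹ I J) y₀ := by
  obtain ⟨B, hB⟩ := exists_isMetricOn_prodMetric (d := d) y₀
  have hs : ∀ i, y₀ i ∈ (chartAt 𝔼 (y₀ i)).source := fun i => mem_chart_source _ _
  have hM : ContinuousAt (fun y => gramAt (d := d) y₀ y) y₀ := by
    refine continuousAt_pi.2 fun I => continuousAt_pi.2 fun J => ?_
    have h1 : ∀ u v, ContinuousOn (fun q => prodMetric y₀ q u v) (prodDom (d := d) y₀) := fun u v =>
      ((hB.contDiffOn.continuousOn.clm_apply continuousOn_const).clm_apply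
        continuousOn_const).congr fun q hq => hB.eq q hq u v
    exact ContinuousAt.comp (f := fun y : Fin k → X => fun i => chartAt 𝔼 (y₀ i) (y i))
      ((h1 _ _).continuousAt ((isOpen_prodDom y₀).mem_nhds (prodChart_mem hs)))
      (continuousAt_prodChart y₀)
  -- Only the nonvanishing of the determinant is wanted, so the forms are irrelevant.
  have hdet := (prodMetric_gram (n := 0) hs 0 0).2
  have h2 : ContinuousAt (fun y => (gramAt (d := d) y₀ y).det) y₀ :=
    ContinuousAt.comp (g := Matrix.det) (continuous_id.matrix_det.continuousAt) hM
  have h3 : ContinuousAt (fun y => (gramAt (d := d) y₀ y).adjugate) y₀ :=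
    ContinuousAt.comp (g := Matrix.adjugate) (continuous_id.matrix_adjugate.continuousAt) hM
  have h4 : (fun y => (gramAt (d := d) y₀ y)⁻¹ I J) = fun y =>
      (gramAt (d := d) y₀ y).det⁻¹ * (gramAt (d := d) y₀ y).adjugate I J := by
    funext y
    rw [Matrix.inv_def, Ring.inverse_eq_inv']; rfl
  rw [h4]
  exact (h2.inv₀ hdet).mul (continuousAt_pi.1 (continuousAt_pi.1 h3 I) J)

lemma continuousAt_of_gram {f : (Fin k → X) → ℝ} {y₀ : Fin k → X}
    {α β : (Fin k → 𝔼) → (Fin n → Fin k → 𝔼) → ℝ}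
    (hα : ∀ v, ContinuousOn (fun p => α p v) (prodDom y₀))
    (hβ : ∀ v, ContinuousOn (fun p => β p v) (prodDom y₀))
    (hf : ∀ y, (∀ i, y i ∈ (chartAt 𝔼 (y₀ i)).source) → f y =
      ∑ I : Fin n → Σ _ : Fin k, Fin d, ∑ I' : Fin n → Σ _ : Fin k, Fin d,
        (∏ m, (gramAt (d := d) y₀ y)⁻¹ (I m) (I' m)) *
          (α (fun i => chartAt 𝔼 (y₀ i) (y i))
            (fun m => coordBasis d k (I m)) *
          β (fun i => chartAt 𝔼 (y₀ i) (y i))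
            (fun m => coordBasis d k (I' m)))) : ContinuousAt f y₀ := by
  have hs : ∀ i, y₀ i ∈ (chartAt 𝔼 (y₀ i)).source := fun i => mem_chart_source _ _
  have hc : ∀ g : (Fin k → 𝔼) → ℝ, ContinuousOn g (prodDom y₀) →
      ContinuousAt (fun y : Fin k → X => g fun i => chartAt 𝔼 (y₀ i) (y i)) y₀ := fun g hg =>
    ContinuousAt.comp (f := fun y : Fin k → X => fun i => chartAt 𝔼 (y₀ i) (y i))
      (hg.continuousAt ((isOpen_prodDom y₀).mem_nhds (prodChart_mem hs))) (continuousAt_prodChart y₀)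
  refine ContinuousAt.congr ?_ ((eventually_mem_source (d := d) y₀).mono fun y hy => (hf y hy).symm)
  · refine tendsto_finsetSum _ fun I _ => tendsto_finsetSum _ fun I' _ => ?_
    refine ContinuousAt.mul ?_ (ContinuousAt.mul ?_ ?_)
    · exact tendsto_finsetProd _ fun m _ => continuousAt_gramAt_inv y₀ _ _
    · exact hc (fun p => α p _) (hα _)
    · exact hc (fun p => β p _) (hβ _)

theorem SmoothForm.continuous_innerPow {η η' : ∀ x : Fin k → X, PowFormAt d n x}
    (hη : SmoothForm η) (hη' : SmoothForm η') : Continuous fun y => innerPow y (η y) (η' y) := by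
  refine continuous_iff_continuousAt.2 fun y₀ => ?_
  refine continuousAt_of_gram (α := fun p => formIn η y₀ p) (β := fun p => formIn η' y₀ p)
    (fun v => (hη y₀ v).continuousOn) (fun v => (hη' y₀ v).continuousOn) fun y hy => ?_
  refine Eq.trans ?_ (prodMetric_gram hy (formIn η y₀ _) (formIn η' y₀ _)).1
  rw [innerPow_eq_sum]
  have h : ∀ (η : ∀ x : Fin k → X, PowFormAt d n x) (J : Fin n → Σ _ : Fin k, Fin d),
      formIn η y₀ (fun i => chartAt 𝔼 (y₀ i) (y i))
        (fun m i => coordDeriv (y₀ i) (y i) (powFrame y (J m) i)) =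
      η y fun m => powFrame y (J m) := fun η J =>
    congrArg (fun s : PointedFam d X k => η s.1 fun m i => s.2 i (powFrame y (J m) i))
      (pointedFam_coordDeriv hy)
  simp only [h]

/-- The covariant derivative at `p` as a multilinear map in all arguments. -/
def SmoothForm.covUncurried {η : ∀ x : Fin k → X, PowFormAt d n x} (hη : SmoothForm η)
    {x : Fin k → X} {p : Fin k → 𝔼} (hp : p ∈ prodDom x) :
    MultilinearMap ℝ (fun _ : Fin (n + 1) => Fin k → 𝔼) ℝ :=
  LinearMap.uncurryLeft (M := fun _ : Fin (n + 1) => Fin k → 𝔼) (hη.covMultilinear hp)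

lemma SmoothForm.covUncurried_apply {η : ∀ x : Fin k → X, PowFormAt d n x} (hη : SmoothForm η)
    {x : Fin k → X} {p : Fin k → 𝔼} (hp : p ∈ prodDom x) (v : Fin (n + 1) → Fin k → 𝔼) :
    hη.covUncurried hp v = covIn η x p (v 0) fun m => v m.succ := rfl

/-- `gradPow` at y is computed in the charts around y, which jump with y. Near y₀ it is expressed in
the charts around y₀ by `SmoothForm.gradPow_eq`; with the direction of differentiation as an
additional argument, the covariant derivative is an (n + 1)-linear form, to which the Gram matrix
formula applies. -/
theorem SmoothForm.continuous_innerGradPow {η η' : ∀ x : Fin k → X, PowFormAt d n x}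
    (hη : SmoothForm η) (hη' : SmoothForm η') :
    Continuous fun y => innerGradPow y (gradPow η y) (gradPow η' y) := by
  refine continuous_iff_continuousAt.2 fun y₀ => ?_
  refine continuousAt_of_gram (n := n + 1)
    (α := fun p v => covIn η y₀ p (v 0) fun m => v m.succ)
    (β := fun p v => covIn η' y₀ p (v 0) fun m => v m.succ)
    (fun v => hη.continuousOn_covIn _ _ _) (fun v => hη'.continuousOn_covIn _ _ _) fun y hy => ?_
  have h := (prodMetric_gram hy
    (hη.covUncurried (prodChart_mem hy)) (hη'.covUncurried (prodChart_mem hy))).1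
  simp only [covUncurried_apply] at h
  refine Eq.trans ?_ h
  rw [innerGradPow_eq_sum]
  refine Finset.sum_congr rfl fun J _ => ?_
  rw [hη.gradPow_eq hy, hη'.gradPow_eq hy]

end CovariantDerivative

/-! ### Gradients of functions on X, seen as 0-forms on X ^ 1 -/

section ScalarGradient

variable {d : ℕ} {X : Type*} [MetricSpace X] [ChartedSpace (EuclideanSpace ℝ (Fin d)) X]

local notation "𝔼" => EuclideanSpace ℝ (Fin d)

/-- The differential of a function on `X`. -/
def diffAt (φ : X → ℝ) (z : X) (u : TangentSpace (𝓡 d) z) : ℝ :=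
  fderiv ℝ (fun q : 𝔼 => φ (pointAt z q)) (coordAt d z) (vecCoord z u)

/-- A function on `X` as a `0`-form on `X ^ 1`. -/
def scalarForm (d : ℕ) {X : Type*} [MetricSpace X] [ChartedSpace (EuclideanSpace ℝ (Fin d)) X]
    (φ : X → ℝ) (x : Fin 1 → X) : PowFormAt d 0 x :=
  AlternatingMap.constOfIsEmpty ℝ _ (Fin 0) (φ (x 0))

lemma diffAt_eq_zero {φ : X → ℝ} {z : X} (hz : z ∉ tsupport φ) (u : TangentSpace (𝓡 d) z) :
    diffAt φ z u = 0 := by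
  have h1 : φ =ᶠ[𝓝 z] 0 := notMem_tsupport_iff_eventuallyEq.1 hz
  have h2 : (fun q : 𝔼 => φ (pointAt z q)) =ᶠ[𝓝 (coordAt d z)] fun _ => 0 := by
    have h3 : Filter.Tendsto (pointAt (d := d) z) (𝓝 (coordAt d z)) (𝓝 z) := by
      have := continuousAt_pointAt (coordAt_mem (d := d) z)
      rwa [ContinuousAt, pointAt_coordAt] at this
    exact h3.eventually h1
  rw [diffAt, h2.fderiv_eq]; simp

variable [IsManifold (𝓡 d) ∞ X]

lemma contDiffOn_comp_pointAt {φ : X → ℝ} (hφ : ContMDiff (𝓡 d) 𝓘(ℝ, ℝ) ∞ φ) (x : X) :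
    ContDiffOn ℝ ∞ (fun q : 𝔼 => φ (pointAt x q)) (coordDom x) :=
  (hφ.comp_contMDiffOn (s := (chartAt 𝔼 x).target) contMDiffOn_chart_symm).contDiffOn

lemma hasFDerivAt_comp_pointAt {φ : X → ℝ} (hφ : ContMDiff (𝓡 d) 𝓘(ℝ, ℝ) ∞ φ) (x : X) :
    HasFDerivAt (fun q : 𝔼 => φ (pointAt x q))
      (fderiv ℝ (fun q : 𝔼 => φ (pointAt x q)) (coordAt d x)) (coordAt d x) :=
  (((contDiffOn_comp_pointAt hφ x).contDiffAt ((chartAt 𝔼 x).open_target.mem_nhds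
    (coordAt_mem x))).differentiableAt (by simp)).hasFDerivAt

lemma smoothForm_scalarForm {φ : X → ℝ} (hφ : ContMDiff (𝓡 d) 𝓘(ℝ, ℝ) ∞ φ) :
    SmoothForm (scalarForm d φ) := fun x _ =>
  (contDiffOn_comp_pointAt hφ (x 0)).comp (contDiff_apply ℝ 𝔼 (0 : Fin 1)).contDiffOn
    fun _ hq => hq 0 (mem_univ _)

variable [RiemannianBundle (fun x : X => TangentSpace (𝓡 d) x)]
    [IsContMDiffRiemannianBundle (𝓡 d) ∞ (EuclideanSpace ℝ (Fin d))
      (fun x : X => TangentSpace (𝓡 d) x)]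

lemma gradPow_scalarForm {φ : X → ℝ} (hφ : ContMDiff (𝓡 d) 𝓘(ℝ, ℝ) ∞ φ) (x : Fin 1 → X)
    (u : ∀ i, TangentSpace (𝓡 d) (x i)) (v : Fin 0 → ∀ i, TangentSpace (𝓡 d) (x i)) :
    gradPow (scalarForm d φ) x u v = diffAt φ (x 0) (u 0) := by
  have h := HasFDerivAt.comp (f := fun q : Fin 1 → 𝔼 => q 0) (fun i => coordAt d (x i))
    (hasFDerivAt_comp_pointAt hφ (x 0)) (hasFDerivAt_apply 0 (fun i => coordAt d (x i)))
  exact congrArg (fun L : (Fin 1 → 𝔼) →L[ℝ] ℝ => L fun i => vecCoord (x i) (u i)) h.fderiv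

/-- The inner product of the gradients of two functions on `X`. -/
def gradInner (d : ℕ) {X : Type*} [MetricSpace X] [ChartedSpace (EuclideanSpace ℝ (Fin d)) X]
    [RiemannianBundle (fun x : X => TangentSpace (𝓡 d) x)] (φ ψ : X → ℝ) (z : X) : ℝ :=
  ∑ a : Fin d, diffAt φ z (frame z a) * diffAt ψ z (frame z a)

/-- The continuity theorem for covariant derivatives of forms, in the case of order 0 on X^1. -/
lemma continuous_gradInner {φ ψ : X → ℝ} (hφ : ContMDiff (𝓡 d) 𝓘(ℝ, ℝ) ∞ φ)
    (hψ : ContMDiff (𝓡 d) 𝓘(ℝ, ℝ) ∞ ψ) : Continuous (gradInner d φ ψ) := by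
  have h := ((smoothForm_scalarForm hφ).continuous_innerGradPow (smoothForm_scalarForm hψ)).comp
    (continuous_pi fun _ => continuous_id : Continuous fun z : X => fun _ : Fin 1 => z)
  refine h.congr fun z => ?_
  simp only [Function.comp, innerGradPow, innerPow, gradPow_scalarForm hφ, gradPow_scalarForm hψ,
    Finset.univ_unique, Finset.sum_singleton]
  exact Finset.sum_congr rfl fun a _ => by simp [Pi.single, Function.update]

lemma gradInner_eq_zero {φ ψ : X → ℝ} {z : X} (hz : z ∉ tsupport φ) : gradInner d φ ψ z = 0 :=
  Finset.sum_eq_zero fun a _ => by rw [diffAt_eq_zero hz, zero_mul]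

lemma hasCompactSupport_gradInner {φ ψ : X → ℝ} (hφ : HasCompactSupport φ) :
    HasCompactSupport (gradInner d φ ψ) :=
  HasCompactSupport.intro hφ fun _ hz => gradInner_eq_zero hz

end ScalarGradient

/-- The data of a cylinder function `γ ↦ g (⟨φ₁, γ⟩, …, ⟨φ_N, γ⟩)`. -/
structure CylinderData (d : ℕ) (X : Type*) [MetricSpace X]
    [ChartedSpace (EuclideanSpace ℝ (Fin d)) X] where
  N : ℕ
  g : (Fin N → ℝ) → ℝ
  φ : Fin N → X → ℝ
  smooth : ContDiff ℝ ∞ g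
  bounded : ∀ j : ℕ, ∃ C : ℝ, ∀ t, ‖iteratedFDeriv ℝ j g t‖ ≤ C
  contMDiff : ∀ a, ContMDiff (𝓡 d) 𝓘(ℝ, ℝ) ∞ (φ a)
  hasCompactSupport : ∀ a, HasCompactSupport (φ a)

/-! ### Cylinder functions and their carré du champ -/

namespace CylinderData

open Configuration

variable {d : ℕ} {X : Type*} [MetricSpace X] [ChartedSpace (EuclideanSpace ℝ (Fin d)) X]

local notation "𝔼" => EuclideanSpace ℝ (Fin d)

/-- The vector `(⟨φ₁, γ⟩, …, ⟨φ_N, γ⟩)`. -/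
def vec (c : CylinderData d X) (γ : Configuration X) : Fin c.N → ℝ := fun a => pairing (c.φ a) γ

/-- The cylinder function. -/
def eval (c : CylinderData d X) (γ : Configuration X) : ℝ := c.g (c.vec γ)

/-- The value of the cylinder function at `γ + ε_y`. -/
def evalAdd (c : CylinderData d X) (γ : Configuration X) (y : X) : ℝ :=
  c.g fun a => pairing (c.φ a) γ + c.φ a y

/-- The partial derivatives of `g` at `(⟨φ₁, γ⟩, …, ⟨φ_N, γ⟩)`. -/
def partialAt (c : CylinderData d X) (γ : Configuration X) (a : Fin c.N) : ℝ :=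
  fderiv ℝ c.g (c.vec γ) (Pi.single a 1)

/-- The derivative of the cylinder function when the point `z` of `γ` is moved. -/
def grad (c : CylinderData d X) (γ : Configuration X) (z : X) (u : TangentSpace (𝓡 d) z) : ℝ :=
  ∑ a, c.partialAt γ a * diffAt (c.φ a) z u

lemma _root_.IsCylinder.exists_data {F : Configuration X → ℝ} (hF : IsCylinder d F) :
    ∃ c : CylinderData d X, F = c.eval := by
  obtain ⟨N, g, φ, h1, h2, h3, h4⟩ := hF
  exact ⟨⟨N, g, φ, h1, h2, fun a => (h3 a).1, fun a => (h3 a).2⟩, funext h4⟩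

lemma exists_abs_eval_le (c : CylinderData d X) : ∃ C, ∀ γ, |c.eval γ| ≤ C := by
  obtain ⟨C, hC⟩ := c.bounded 0
  refine ⟨C, fun γ => ?_⟩
  simpa [eval] using hC (c.vec γ)

lemma exists_abs_partialAt_le (c : CylinderData d X) : ∃ C, ∀ γ a, |c.partialAt γ a| ≤ C := by
  obtain ⟨C, hC⟩ := c.bounded 1
  refine ⟨C, fun γ a => ?_⟩
  have h1 := (fderiv ℝ c.g (c.vec γ)).le_opNorm (Pi.single a 1)
  have h2 : ‖(Pi.single a 1 : Fin c.N → ℝ)‖ = 1 := by rw [Pi.norm_single, norm_one]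
  rw [h2, mul_one] at h1
  refine h1.trans ?_
  rw [← norm_iteratedFDeriv_one]
  exact hC _

lemma continuous_φ (c : CylinderData d X) (a : Fin c.N) : Continuous (c.φ a) :=
  (c.contMDiff a).continuous

lemma continuous_vec (c : CylinderData d X) : Continuous c.vec :=
  continuous_pi fun a => continuous_pairing (c.continuous_φ a) (c.hasCompactSupport a)

lemma continuous_eval (c : CylinderData d X) : Continuous c.eval :=
  c.smooth.continuous.comp c.continuous_vec

lemma continuous_partialAt (c : CylinderData d X) (a : Fin c.N) :
    Continuous fun γ => c.partialAt γ a :=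
  ((c.smooth.continuous_fderiv (by simp)).comp c.continuous_vec).clm_apply continuous_const

lemma continuous_evalAdd (c : CylinderData d X) (γ : Configuration X) :
    Continuous (c.evalAdd γ) :=
  c.smooth.continuous.comp
    (continuous_pi fun a => continuous_const.add (c.continuous_φ a))

lemma eval_addPoint (c : CylinderData d X) {γ : Configuration X} {y : X} (hy : y ∉ γ.1) :
    c.eval (γ.addPoint y) = c.evalAdd γ y :=
  congrArg c.g (funext fun a => pairing_addPoint γ (c.hasCompactSupport a) hy)

variable [LocallyCompactSpace X]

/-- Points near `z` do not belong to `γ` without `z`. -/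
lemma _root_.Configuration.eventually_pointAt_notMem (γ : Configuration X) (z : X) :
    ∀ᶠ q in 𝓝 (coordAt d z), pointAt z q ∉ (γ.remove {z}).1 := by
  have h3 : Filter.Tendsto (pointAt (d := d) z) (𝓝 (coordAt d z)) (𝓝 z) := by
    have := continuousAt_pointAt (coordAt_mem (d := d) z)
    rwa [ContinuousAt, pointAt_coordAt] at this
  obtain ⟨K, hK, hz⟩ := exists_compact_mem_nhds z
  have h4 : ((γ.remove {z}).1 ∩ K)ᶜ ∈ 𝓝 z :=
    ((γ.remove {z}).2 K hK).isClosed.isOpen_compl.mem_nhds fun h => h.1.2 rfl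
  filter_upwards [h3.eventually h4, h3.eventually hz] with q hq hq' h
  exact hq ⟨h, hq'⟩

/-- The pairing is additive in the moved point only as long as this point does not hit another point
of γ, which is guaranteed near z by local finiteness. The right hand side is smooth in q. -/
lemma eval_move_eventuallyEq (c : CylinderData d X) (γ : Configuration X) (z : X) :
    (fun q : 𝔼 => c.eval (γ.move z (pointAt z q))) =ᶠ[𝓝 (coordAt d z)]
      fun q => c.evalAdd (γ.remove {z}) (pointAt z q) := by
  filter_upwards [γ.eventually_pointAt_notMem z] with q hq
  exact c.eval_addPoint hq

variable [IsManifold (𝓡 d) ∞ X]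

lemma hasFDerivAt_eval_move (c : CylinderData d X) {γ : Configuration X} {z : X} (hz : z ∈ γ.1) :
    ∃ L : 𝔼 →L[ℝ] ℝ, HasFDerivAt (fun q : 𝔼 => c.eval (γ.move z (pointAt z q))) L (coordAt d z) ∧
      ∀ u : TangentSpace (𝓡 d) z, L (vecCoord z u) = c.grad γ z u := by
  have h1 : HasFDerivAt (fun q : 𝔼 => fun a => pairing (c.φ a) (γ.remove {z}) +
      c.φ a (pointAt z q)) (ContinuousLinearMap.pi fun a =>
        fderiv ℝ (fun q : 𝔼 => c.φ a (pointAt z q)) (coordAt d z)) (coordAt d z) :=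
    hasFDerivAt_pi.2 fun a => (hasFDerivAt_comp_pointAt (c.contMDiff a) z).const_add _
  have h2 : (fun a => pairing (c.φ a) (γ.remove {z}) + c.φ a (pointAt z (coordAt d z))) =
      c.vec γ := by
    funext a
    rw [pointAt_coordAt, pairing_remove_singleton γ (c.hasCompactSupport a) hz, vec]; ring
  have h3 : HasFDerivAt c.g (fderiv ℝ c.g (c.vec γ)) (c.vec γ) :=
    (c.smooth.differentiable (by simp) _).hasFDerivAt
  rw [← h2] at h3
  have h4 := (HasFDerivAt.comp (f := fun q : 𝔼 => fun a => pairing (c.φ a) (γ.remove {z}) +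
      c.φ a (pointAt z q)) (coordAt d z) h3 h1).congr_of_eventuallyEq
    (c.eval_move_eventuallyEq γ z)
  refine ⟨_, h4, fun u => ?_⟩
  rw [h2, grad]
  rw [ContinuousLinearMap.comp_apply]
  have h5 : ∀ w : Fin c.N → ℝ, fderiv ℝ c.g (c.vec γ) w = ∑ a, c.partialAt γ a * w a := by
    intro w
    conv_lhs => rw [pi_eq_sum_univ' w]
    rw [map_sum]
    refine Finset.sum_congr rfl fun a _ => ?_
    rw [map_smul, smul_eq_mul, mul_comm, partialAt]
  rw [h5]
  rfl

lemma grad_eq_zero (c : CylinderData d X) (γ : Configuration X) {z : X}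
    (hz : ∀ a, z ∉ tsupport (c.φ a)) (u : TangentSpace (𝓡 d) z) : c.grad γ z u = 0 :=
  Finset.sum_eq_zero fun a _ => by rw [diffAt_eq_zero (hz a), mul_zero]

variable [RiemannianBundle (fun x : X => TangentSpace (𝓡 d) x)]
    [IsContMDiffRiemannianBundle (𝓡 d) ∞ (EuclideanSpace ℝ (Fin d))
      (fun x : X => TangentSpace (𝓡 d) x)]

/-- The carré du champ of two cylinder functions. -/
def carre (c c' : CylinderData d X) (γ : Configuration X) : ℝ :=
  ∑ a, ∑ b, c.partialAt γ a * c'.partialAt γ b * pairing (gradInner d (c.φ a) (c'.φ b)) γ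

lemma tsum_grad_mul_grad (c c' : CylinderData d X) (γ : Configuration X) (S : Finset X)
    (hS : ∀ z ∈ S, z ∈ γ.1) (hS' : ∀ a, ∀ z ∈ γ.1, z ∈ tsupport (c.φ a) → z ∈ S) :
    ∑ z ∈ S, ∑ i, c.grad γ z (frame z i) * c'.grad γ z (frame z i) = c.carre c' γ := by
  have h1 : ∀ a b, pairing (gradInner d (c.φ a) (c'.φ b)) γ =
      ∑ z ∈ S, gradInner d (c.φ a) (c'.φ b) z := fun a b =>
    pairing_eq_sum γ _ S hS fun z hz hzS => gradInner_eq_zero fun h => hzS (hS' a z hz h)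
  simp only [carre, h1, grad, gradInner, Finset.mul_sum]
  symm
  have h2 : ∀ f : Fin c.N → Fin c'.N → X → Fin d → ℝ, ∑ a, ∑ b, ∑ z ∈ S, ∑ i, f a b z i =
      ∑ z ∈ S, ∑ i, ∑ a, ∑ b, f a b z i := by
    intro f
    rw [Finset.sum_congr rfl fun a _ => Finset.sum_comm, Finset.sum_comm]
    refine Finset.sum_congr rfl fun z _ => ?_
    rw [Finset.sum_congr rfl fun a _ => Finset.sum_comm, Finset.sum_comm]
  rw [h2]
  refine Finset.sum_congr rfl fun z _ => Finset.sum_congr rfl fun i _ => ?_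
  rw [Finset.sum_comm]
  refine Finset.sum_congr rfl fun b _ => ?_
  rw [Finset.sum_mul]
  exact Finset.sum_congr rfl fun a _ => by ring

lemma continuous_carre (c c' : CylinderData d X) : Continuous (c.carre c') :=
  continuous_finsetSum _ fun a _ => continuous_finsetSum _ fun b _ =>
    ((c.continuous_partialAt a).mul (c'.continuous_partialAt b)).mul
      (continuous_pairing (continuous_gradInner (c.contMDiff a) (c'.contMDiff b))
        (hasCompactSupport_gradInner (c.hasCompactSupport a)))

/-- The first derivatives of the outer functions are bounded, and the finitely many continuous
functions ⟨∇φ_a, ∇φ'_b⟩ vanish off a common compact set; χ is the sum of their absolute values. So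
the carré du champ grows at most linearly in the number of points. -/
lemma exists_abs_carre_le (c c' : CylinderData d X) :
    ∃ (C : ℝ) (χ : C_c(X, ℝ)), 0 ≤ C ∧ (∀ x, 0 ≤ χ x) ∧ ∀ γ, |c.carre c' γ| ≤ C * pairing χ γ := by
  obtain ⟨C, hC⟩ := c.exists_abs_partialAt_le
  obtain ⟨C', hC'⟩ := c'.exists_abs_partialAt_le
  have hcont : Continuous fun x => ∑ a, ∑ b, |gradInner d (c.φ a) (c'.φ b) x| :=
    continuous_finsetSum _ fun a _ => continuous_finsetSum _ fun b _ =>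
      (continuous_gradInner (c.contMDiff a) (c'.contMDiff b)).abs
  have hK : IsCompact (⋃ a, tsupport (c.φ a)) := isCompact_iUnion fun a => c.hasCompactSupport a
  have h0 : ∀ x ∉ ⋃ a, tsupport (c.φ a), ∀ a b, gradInner d (c.φ a) (c'.φ b) x = 0 :=
    fun x hx a b => gradInner_eq_zero fun h => hx (mem_iUnion.2 ⟨a, h⟩)
  have h0' : ∀ x ∉ ⋃ a, tsupport (c.φ a), ∑ a, ∑ b, |gradInner d (c.φ a) (c'.φ b) x| = 0 :=
    fun x hx => by simp [h0 x hx]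
  refine ⟨∑ a : Fin c.N, ∑ b : Fin c'.N, |C| * |C'|, ⟨⟨_, hcont⟩, HasCompactSupport.intro hK h0'⟩,
    by positivity, fun x => ?_, fun γ => ?_⟩
  · change 0 ≤ ∑ a, ∑ b, |gradInner d (c.φ a) (c'.φ b) x|
    positivity
  · rw [Finset.sum_mul]
    refine (Finset.abs_sum_le_sum_abs _ _).trans (Finset.sum_le_sum fun a _ => ?_)
    rw [Finset.sum_mul]
    refine (Finset.abs_sum_le_sum_abs _ _).trans (Finset.sum_le_sum fun b _ => ?_)
    rw [abs_mul, abs_mul]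
    refine mul_le_mul (mul_le_mul ((hC γ a).trans (le_abs_self _)) ((hC' γ b).trans (le_abs_self _))
      (abs_nonneg _) (abs_nonneg _)) ?_ (abs_nonneg _) (by positivity)
    refine (abs_pairing_le γ hK fun x hx => h0 x hx a b).trans ?_
    refine pairing_mono_fun γ hK (fun x hx => by rw [h0 x hx, abs_zero]) h0' fun x _ => ?_
    refine le_trans ?_ (Finset.single_le_sum (f := fun a => ∑ b, |gradInner d (c.φ a) (c'.φ b) x|)
      (fun a _ => Finset.sum_nonneg fun b _ => abs_nonneg _) (Finset.mem_univ a))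
    exact Finset.single_le_sum (f := fun b => |gradInner d (c.φ a) (c'.φ b) x|)
      (fun b _ => abs_nonneg _) (Finset.mem_univ b)

end CylinderData

/-! ### The volume measure: null points and positive open sets -/

section Volume

variable {d : ℕ} {X : Type*} [MetricSpace X] [ChartedSpace (EuclideanSpace ℝ (Fin d)) X]

local notation "𝔼" => EuclideanSpace ℝ (Fin d)

variable [RiemannianBundle (fun x : X => TangentSpace (𝓡 d) x)] [MeasurableSpace X]

/-- The density of the volume in the preferred chart around `x`. -/
abbrev volDensity (x : X) (q : 𝔼) : ENNReal :=
  ENNReal.ofReal (Real.sqrt (Matrix.det (Matrix.of fun i j : Fin d =>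
    chartMetric x q (EuclideanSpace.single i 1) (EuclideanSpace.single j 1))))

/-- The volume in the preferred chart around `x`. -/
abbrev chartVolume (d : ℕ) {X : Type*} [MetricSpace X]
    [ChartedSpace (EuclideanSpace ℝ (Fin d)) X]
    [RiemannianBundle (fun x : X => TangentSpace (𝓡 d) x)] [MeasurableSpace X] (x : X) :
    Measure X :=
  (((volume : Measure (EuclideanSpace ℝ (Fin d))).withDensity (volDensity x)).restrict
    (coordDom x)).map (pointAt x)

lemma chartVolume_le (x : X) : chartVolume d x ≤ riemannianVolume d X :=
  le_iSup (fun x : X => chartVolume d x) x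

variable [BorelSpace X]

lemma chartVolume_apply (x : X) {s : Set X} (hs : MeasurableSet s) : chartVolume d x s =
    (volume : Measure 𝔼).withDensity (volDensity x) (pointAt x ⁻¹' s ∩ coordDom x) := by
  have hT : MeasurableSet (coordDom (d := d) x) := (chartAt 𝔼 x).open_target.measurableSet
  rw [chartVolume, Measure.map_apply_of_aemeasurable
    ((continuousOn_pointAt x).aemeasurable hT) hs, Measure.restrict_apply' hT]

lemma riemannianVolume_singleton (hd : d ≠ 0) (p : X) : riemannianVolume d X {p} = 0 := by
  have : Nonempty (Fin d) := ⟨⟨0, Nat.pos_of_ne_zero hd⟩⟩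
  have : Nontrivial 𝔼 := inferInstance
  have h1 : ∀ x : X, chartVolume d x {p} = 0 := by
    intro x
    rw [chartVolume_apply x (measurableSet_singleton p)]
    refine withDensity_absolutelyContinuous _ _ (Set.Subsingleton.measure_zero ?_ _)
    intro q hq q' hq'
    exact (chartAt 𝔼 x).symm.injOn hq.2 hq'.2 (hq.1.trans hq'.1.symm)
  -- A supremum of measures is not computed set by set. Instead, all of them are bounded by one
  -- measure that does not charge p.
  have h2 : riemannianVolume d X ≤ (⊤ : Measure X).restrict {p}ᶜ := by
    refine iSup_le fun x => ?_
    have h3 : (chartVolume d x).restrict {p}ᶜ = chartVolume d x :=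
      Measure.restrict_eq_self_of_ae_mem (measure_eq_zero_iff_ae_notMem.1 (h1 x))
    exact h3.symm.le.trans (Measure.restrict_mono le_rfl le_top)
  refine le_antisymm ((h2 _).trans ?_) zero_le
  rw [Measure.restrict_apply (measurableSet_singleton p)]
  simp

/-- For d = 0 the manifold is discrete, hence a single point by connectedness, and its volume is
finite. -/
lemma dim_ne_zero [ConnectedSpace X] (hvol : riemannianVolume d X univ = ⊤) : d ≠ 0 := by
  rintro rfl
  have h1 : ∀ x : X, (chartAt (EuclideanSpace ℝ (Fin 0)) x).source = {x} := fun x =>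
    Subset.antisymm (fun y hy => (chartAt (EuclideanSpace ℝ (Fin 0)) x).injOn hy
      (mem_chart_source _ x) (Subsingleton.elim _ _)) (singleton_subset_iff.2 (mem_chart_source _ x))
  have : DiscreteTopology X := discreteTopology_iff_forall_isOpen.2 fun s => by
    rw [← biUnion_of_singleton s]
    exact isOpen_biUnion fun x _ => h1 x ▸ (chartAt (EuclideanSpace ℝ (Fin 0)) x).open_source
  have : Subsingleton X := PreconnectedSpace.trivial_of_discrete
  have h2 : riemannianVolume 0 X univ < ⊤ := by
    obtain ⟨x₀⟩ := (inferInstance : Nonempty X)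
    have h3 : riemannianVolume 0 X ≤ chartVolume 0 x₀ :=
      iSup_le fun x => (congrArg (chartVolume 0) (Subsingleton.elim x x₀)).le
    refine (h3 univ).trans_lt ?_
    rw [chartVolume_apply x₀ MeasurableSet.univ]
    refine (measure_mono (subset_univ _)).trans_lt ?_
    rw [withDensity_apply _ MeasurableSet.univ]
    simp only [volDensity, Matrix.det_isEmpty, Real.sqrt_one, ENNReal.ofReal_one]
    rw [lintegral_one, Measure.restrict_univ]
    exact isCompact_univ.measure_lt_top
  exact h2.ne hvol

variable [IsManifold (𝓡 d) ∞ X] [IsContMDiffRiemannianBundle (𝓡 d) ∞ (EuclideanSpace ℝ (Fin d))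
      (fun x : X => TangentSpace (𝓡 d) x)]

lemma det_chartMetric_pos (x : X) {q : 𝔼} (hq : q ∈ coordDom x) :
    0 < Matrix.det (Matrix.of fun i j : Fin d =>
      chartMetric x q (EuclideanSpace.single i 1) (EuclideanSpace.single j 1)) := by
  obtain ⟨B, hB⟩ := exists_isMetricOn_chartMetric (d := d) x
  refine Matrix.PosDef.det_pos (Matrix.PosDef.of_dotProduct_mulVec_pos ?_ fun v hv => ?_)
  · ext i j
    simp only [Matrix.conjTranspose_apply, Matrix.of_apply, star_trivial]
    exact real_inner_comm _ _
  · have h1 : ∀ v : 𝔼, v = ∑ i, v i • EuclideanSpace.single i (1 : ℝ) := by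
      intro v
      have := (EuclideanSpace.basisFun (Fin d) ℝ).sum_repr v
      simpa using this.symm
    have h2 := hB.pos q hq (WithLp.toLp 2 v) (by simpa using hv)
    rw [h1 (WithLp.toLp 2 v)] at h2
    simp only [map_sum, map_smul, _root_.sum_apply, ContinuousLinearMap.smul_apply, smul_eq_mul,
      ← hB.eq q hq] at h2
    simp only [dotProduct, Matrix.mulVec, Matrix.of_apply, star_trivial, Finset.mul_sum]
    refine h2.trans_le (le_of_eq ?_)
    refine Finset.sum_congr rfl fun i _ => ?_
    simp only [Finset.mul_sum]
    refine Finset.sum_congr rfl fun j _ => ?_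
    rw [show chartMetric x q (EuclideanSpace.single j 1) (EuclideanSpace.single i 1) =
      chartMetric x q (EuclideanSpace.single i 1) (EuclideanSpace.single j 1) from
        real_inner_comm _ _]
    ring

/-- In a chart the density is continuous and positive, so a set of volume zero has Lebesgue measure
zero there, which is impossible for a nonempty open set. -/
lemma riemannianVolume_pos {U : Set X} (hU : IsOpen U) (hne : U.Nonempty) :
    riemannianVolume d X U ≠ 0 := by
  obtain ⟨p, hp⟩ := hne
  intro h0
  have h1 : chartVolume d p U = 0 := le_antisymm ((chartVolume_le p U).trans h0.le) zero_le
  have hT : MeasurableSet (coordDom (d := d) p) := (chartAt 𝔼 p).open_target.measurableSet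
  rw [chartVolume_apply p hU.measurableSet, ← Measure.restrict_apply' hT,
    restrict_withDensity hT] at h1
  have hc : ContinuousOn (volDensity (d := d) p) (coordDom p) := by
    refine ENNReal.continuous_ofReal.comp_continuousOn (Real.continuous_sqrt.comp_continuousOn ?_)
    refine (continuous_id.matrix_det).comp_continuousOn (f := fun q : 𝔼 => Matrix.of
      fun i j : Fin d => chartMetric p q (EuclideanSpace.single i 1) (EuclideanSpace.single j 1)) ?_
    exact continuousOn_pi.2 fun i => continuousOn_pi.2 fun j =>
      (contDiffOn_chartMetric p _ _).continuousOn
  have h2 := withDensity_absolutelyContinuous' (μ := (volume : Measure 𝔼).restrict (coordDom p))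
    (hc.aemeasurable hT) (by
      filter_upwards [ae_restrict_mem hT] with q hq
      simpa [volDensity] using det_chartMetric_pos p hq) h1
  rw [Measure.restrict_apply' hT] at h2
  have h3 : IsOpen (coordDom (d := d) p ∩ pointAt p ⁻¹' U) :=
    (continuousOn_pointAt p).isOpen_inter_preimage (chartAt 𝔼 p).open_target hU
  rw [inter_comm] at h2
  exact (h3.measure_pos volume ⟨coordAt d p, coordAt_mem p, by simpa using hp⟩).ne' h2

open Configuration in
-- A configuration is countable, and for d ≥ 1 points have volume zero.
lemma ae_notMem_of_absolutelyContinuous [SecondCountableTopology X] [LocallyCompactSpace X]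
    (hd : d ≠ 0) {μ : Measure (Configuration X)} {σ : Kernel (Configuration X) X}
    (hac : ∀ᵐ γ ∂μ, σ γ ≪ riemannianVolume d X) : ∀ᵐ γ ∂μ, ∀ᵐ y ∂(σ γ), y ∉ γ.1 := by
  filter_upwards [hac] with γ hγ
  refine measure_eq_zero_iff_ae_notMem.1 (hγ ?_)
  rw [← biUnion_of_singleton γ.1]
  exact (measure_biUnion_null_iff γ.countable_val).2 fun x _ => riemannianVolume_singleton hd x

/-- σ(γ) dominates its absolutely continuous part, which has a positive density and therefore the
same null sets as the volume. -/
lemma ae_isOpenPos_of_rnDeriv_pos {μ : Measure (Configuration X)} {σ : Kernel (Configuration X) X}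
    (hpos : ∀ᵐ γ ∂μ, ∀ᵐ x ∂(riemannianVolume d X), 0 < (σ γ).rnDeriv (riemannianVolume d X) x) :
    ∀ᵐ γ ∂μ, ∀ U : Set X, IsOpen U → U.Nonempty → σ γ U ≠ 0 := by
  filter_upwards [hpos] with γ hγ U hU hne h0
  refine riemannianVolume_pos (d := d) hU hne ?_
  refine withDensity_absolutelyContinuous' (Measure.measurable_rnDeriv (σ γ) _).aemeasurable
    (hγ.mono fun x hx => hx.ne') ?_
  exact le_antisymm ((Measure.withDensity_rnDeriv_le _ _ U).trans h0.le) zero_le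

end Volume

/-! ### Components of a form, and their derivatives -/

section Components

variable {d : ℕ} {X : Type*} [MetricSpace X] [ChartedSpace (EuclideanSpace ℝ (Fin d)) X]

local notation "𝔼" => EuclideanSpace ℝ (Fin d)

variable {n k : ℕ}

open Classical in
lemma component_apply (α : TangentFam d X [⋀^Fin n]→ₗ[ℝ] ℝ) (x : Fin k → X)
    (v : Fin n → ∀ i, TangentSpace (𝓡 d) (x i)) :
    component α x v = ∑ j : Fin n → Fin k with Function.Surjective j,
      α fun m => DFinsupp.single (x (j m)) (v m (j m)) := by
  change (∑ j : Fin n → Fin k with Function.Surjective j,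
      α.toMultilinearMap.compLinearMap fun m =>
        (DFinsupp.lsingle (x (j m)) : TangentSpace (𝓡 d) (x (j m)) →ₗ[ℝ] TangentFam d X).comp
          (LinearMap.proj (j m))) v = _
  rw [_root_.sum_apply]
  rfl

open Classical in
-- When v m lives only in the factor j m, every other index map meets a zero vector, and a single
-- entry of α is read off.
lemma component_apply_of_surjective (α : TangentFam d X [⋀^Fin n]→ₗ[ℝ] ℝ) (x : Fin k → X)
    {j : Fin n → Fin k} (hj : Function.Surjective j)
    {v : Fin n → ∀ i, TangentSpace (𝓡 d) (x i)} (hv : ∀ m l, l ≠ j m → v m l = 0) :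
    component α x v = α fun m => DFinsupp.single (x (j m)) (v m (j m)) := by
  rw [component_apply, Finset.sum_eq_single j]
  · intro j' _ hne
    obtain ⟨m, hm⟩ := Function.ne_iff.1 hne
    refine α.map_coord_zero m ?_
    rw [hv m _ hm, DFinsupp.single_zero]
  · intro h; exact absurd (by simpa using hj) h

/-- Each surjective index map takes the value i somewhere, so each term has a zero argument. As a
consequence, index maps that are not surjective do not contribute to `innerPow`. -/
lemma component_eq_zero (α : TangentFam d X [⋀^Fin n]→ₗ[ℝ] ℝ) (x : Fin k → X) (i : Fin k)
    {v : Fin n → ∀ i, TangentSpace (𝓡 d) (x i)} (hv : ∀ m, v m i = 0) : component α x v = 0 := by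
  classical
  rw [component_apply]
  refine Finset.sum_eq_zero fun j hj => ?_
  obtain ⟨m, hm⟩ := (Finset.mem_filter.1 hj).2 i
  refine α.map_coord_zero m ?_
  subst hm
  rw [hv m, DFinsupp.single_zero]

lemma sqrt_factorial_ne_zero (k : ℕ) : Real.sqrt (k.factorial : ℝ) ≠ 0 :=
  (Real.sqrt_pos.2 (Nat.cast_pos.2 k.factorial_pos)).ne'

lemma sqrt_factorial_mul_isoI (W : ConfForm d X n) (γ : Configuration X) (x : Fin k → X)
    (v : Fin n → ∀ i, TangentSpace (𝓡 d) (x i)) : Real.sqrt (k.factorial : ℝ) * isoI W k γ x v =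
      component (W (γ.add (range x) (finite_range x))) x v := by
  change _ * ((Real.sqrt (k.factorial : ℝ))⁻¹ * _) = _
  rw [mul_inv_cancel_left₀ (sqrt_factorial_ne_zero k)]
  rfl

lemma isoI_eq_zero (W : ConfForm d X n) (γ : Configuration X) (x : Fin k → X) (i : Fin k)
    {v : Fin n → ∀ i, TangentSpace (𝓡 d) (x i)} (hv : ∀ m, v m i = 0) : isoI W k γ x v = 0 := by
  exact (congrArg (fun t => (Real.sqrt (k.factorial : ℝ))⁻¹ * t)
    (component_eq_zero _ _ i hv)).trans (mul_zero _)

lemma gradGamma_isoI_eq_zero [RiemannianBundle (fun x : X => TangentSpace (𝓡 d) x)]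
    (W : ConfForm d X n) (γ : Configuration X) (x : Fin k → X) (z : X)
    (u : TangentSpace (𝓡 d) z) (i : Fin k)
    {v : Fin n → ∀ i, TangentSpace (𝓡 d) (x i)} (hv : ∀ m, v m i = 0) :
    gradGamma (isoI W) γ x z u v = 0 := by
  simp only [gradGamma, isoI_eq_zero W _ x i hv]
  simp

lemma vecAt_zero (x : X) (q : 𝔼) : vecAt x q 0 = 0 := map_zero (vecAtE x q)

lemma vecCoord_zero (x : X) : vecCoord (d := d) x 0 = 0 := map_zero (coordDeriv x x)

lemma sigma_vecAt_vecCoord [IsManifold (𝓡 d) ∞ X] (x : X) (e : TangentSpace (𝓡 d) x) :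
    (⟨pointAt x (coordAt d x), vecAt x (coordAt d x) (vecCoord x e)⟩ :
      Σ y : X, TangentSpace (𝓡 d) y) = ⟨x, e⟩ :=
  congrArg (fun s : PointedFam d X 1 => (⟨s.1 0, s.2 0 e⟩ : Σ y : X, TangentSpace (𝓡 d) y))
    (pointedFam_coordDeriv (x := fun _ : Fin 1 => x) (y := fun _ => x)
      fun _ => mem_chart_source _ _)

variable [IsManifold (𝓡 d) ∞ X] [RiemannianBundle (fun x : X => TangentSpace (𝓡 d) x)]
    [IsContMDiffRiemannianBundle (𝓡 d) ∞ (EuclideanSpace ℝ (Fin d))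
      (fun x : X => TangentSpace (𝓡 d) x)]

lemma parallelExt_chartMetric_zero (x : X) (q : 𝔼) :
    parallelExt (chartMetric x) (coordAt d x) 0 q = 0 := by
  obtain ⟨B, hB⟩ := exists_isMetricOn_chartMetric (d := d) x
  exact hB.parallelExt_zero (coordAt_mem x) q

lemma parallelExt_chartMetric_self (x : X) (v : 𝔼) :
    parallelExt (chartMetric x) (coordAt d x) v (coordAt d x) = v := by
  obtain ⟨B, hB⟩ := exists_isMetricOn_chartMetric (d := d) x
  exact hB.parallelExt_self (coordAt_mem x) v

/-- The vector fields in the definition of `gradPow` are those in the factors. -/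
lemma vecAt_parallelExt_prodMetric (x : Fin k → X) (v : Fin k → 𝔼) (q : Fin k → 𝔼) (l : Fin k) :
    vecAt (x l) (q l) (parallelExt (prodMetric x) (fun i => coordAt d (x i)) v q l) =
      vecAt (x l) (q l) (parallelExt (chartMetric (x l)) (coordAt d (x l)) (v l) (q l)) := by
  rw [parallelExt_prodMetric x (p := fun i => coordAt d (x i)) fun i _ => coordAt_mem (x i)]

lemma vecAt_parallelExt_eq_zero (x : Fin k → X) {v : Fin k → 𝔼} (q : Fin k → 𝔼) {l : Fin k}
    (hv : v l = 0) :
    vecAt (x l) (q l) (parallelExt (prodMetric x) (fun i => coordAt d (x i)) v q l) = 0 := by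
  rw [vecAt_parallelExt_prodMetric, hv, parallelExt_chartMetric_zero, vecAt_zero]

lemma gradPow_isoI_eq_zero (W : ConfForm d X n) (γ : Configuration X) (x : Fin k → X)
    (u : ∀ i, TangentSpace (𝓡 d) (x i)) (i : Fin k)
    {v : Fin n → ∀ i, TangentSpace (𝓡 d) (x i)} (hv : ∀ m, v m i = 0) :
    gradPow (isoI W k γ) x u v = 0 := by
  unfold gradPow
  have h : ∀ q : Fin k → 𝔼, isoI W k γ (fun i => pointAt (x i) (q i)) (fun m i =>
        vecAt (x i) (q i) (parallelExt (prodMetric x) (fun i => coordAt d (x i))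
          (fun i => vecCoord (x i) (v m i)) q i)) = 0 := fun q =>
    isoI_eq_zero W γ _ i fun m => vecAt_parallelExt_eq_zero x q (by rw [hv m, vecCoord_zero])
  simp only [h]
  simp

open Classical in
-- None of the vectors sits at the moved point x, so erasing at x changes nothing and the
-- transported vector is zero. Only the configuration varies, and adding y back to the moved γ - y
-- gives the moved γ.
lemma gradConfForm_of_notMem (W : ConfForm d X n) (γ : Configuration X) {y : Fin k → X}
    (hy : ∀ i, y i ∈ γ.1) {j : Fin n → Fin k} (hj : Function.Surjective j) {x : X}
    (hx : x ∉ range y) (u : TangentSpace (𝓡 d) x) (e : ∀ m, TangentSpace (𝓡 d) (y (j m))) :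
    gradConfForm W γ x u (fun m => DFinsupp.single (y (j m)) (e m)) =
      Real.sqrt (k.factorial : ℝ) *
        gradGamma (isoI W) (γ.remove (range y)) y x u (fun m => Pi.single (j m) (e m)) := by
  have h1 : ∀ q : 𝔼, (W (γ.move x (pointAt x q)) fun m =>
      (DFinsupp.single (y (j m)) (e m) : TangentFam d X).erase x +
        DFinsupp.single (pointAt x q) (vecAt x q (parallelExt (chartMetric x) (coordAt d x)
          (vecCoord x ((DFinsupp.single (y (j m)) (e m) : TangentFam d X) x)) q))) =
      Real.sqrt (k.factorial : ℝ) * isoI W k ((γ.remove (range y)).move x (pointAt x q)) y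
        fun m => Pi.single (j m) (e m) := by
    intro q
    have hne : ∀ m, y (j m) ≠ x := fun m h => hx ⟨j m, h⟩
    have h2 : ((γ.remove (range y)).move x (pointAt x q)).add (range y) (finite_range y) =
        γ.move x (pointAt x q) := by
      refine Configuration.ext fun z => ?_
      simp only [Configuration.mem_add, Configuration.mem_move, Configuration.mem_remove]
      constructor
      · rintro ((h | ⟨⟨h, -⟩, h'⟩) | ⟨i, rfl⟩)
        · exact Or.inl h
        · exact Or.inr ⟨h, h'⟩
        · exact Or.inr ⟨hy i, fun h => hx ⟨i, h⟩⟩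
      · rintro (h | ⟨h, h'⟩)
        · exact Or.inl (Or.inl h)
        · by_cases hz : z ∈ range y
          · exact Or.inr hz
          · exact Or.inl (Or.inr ⟨⟨h, hz⟩, h'⟩)
    rw [sqrt_factorial_mul_isoI, h2, component_apply_of_surjective _ _ hj
      (fun m l hl => Pi.single_eq_of_ne hl _)]
    congr 1
    funext m
    rw [DFinsupp.erase_single_ne _ (hne m), DFinsupp.single_eq_of_ne (hne m).symm, vecCoord_zero,
      parallelExt_chartMetric_zero, vecAt_zero, DFinsupp.single_zero, add_zero, Pi.single_eq_same]
  unfold gradConfForm gradGamma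
  simp only [h1]
  exact congrArg (fun D : 𝔼 → 𝔼 →L[ℝ] ℝ => D (coordAt d x) (vecCoord x u))
    (fderiv_const_smul_of_field (f := fun q : 𝔼 => isoI W k ((γ.remove (range y)).move x
      (pointAt x q)) y fun m => Pi.single (j m) (e m)) (Real.sqrt (k.factorial : ℝ)))

open Classical in
-- Moving y i is varying the i-th coordinate alone in the product chart. The extensions of vectors
-- for the product metric are those of the factors, so the two derivatives are of the same function,
-- restricted to a coordinate subspace. Differentiability makes the derivative of the restriction a
-- partial derivative; without it `fderiv` would have the default value 0.
lemma gradConfForm_of_mem (W : ConfForm d X n) (γ : Configuration X) {y : Fin k → X}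
    (hinj : Function.Injective y) (hy : ∀ i, y i ∈ γ.1) {j : Fin n → Fin k}
    (hj : Function.Surjective j) (i : Fin k) (u : TangentSpace (𝓡 d) (y i))
    (e : ∀ m, TangentSpace (𝓡 d) (y (j m)))
    (hdiff : DifferentiableAt ℝ (fun q : Fin k → 𝔼 =>
      isoI W k (γ.remove (range y)) (fun i => pointAt (y i) (q i)) fun m l =>
        vecAt (y l) (q l) (parallelExt (prodMetric y) (fun i => coordAt d (y i))
          (fun i => vecCoord (y i)
            ((Pi.single (j m) (e m) : ∀ i, TangentSpace (𝓡 d) (y i)) i)) q l))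
      (fun i => coordAt d (y i))) :
    gradConfForm W γ (y i) u (fun m => DFinsupp.single (y (j m)) (e m)) =
      Real.sqrt (k.factorial : ℝ) * gradPow (isoI W k (γ.remove (range y))) y
        (Pi.single i u) (fun m => Pi.single (j m) (e m)) := by
  set h : (Fin k → 𝔼) → ℝ := fun q : Fin k → 𝔼 =>
      isoI W k (γ.remove (range y)) (fun i => pointAt (y i) (q i)) fun m l =>
        vecAt (y l) (q l) (parallelExt (prodMetric y) (fun i => coordAt d (y i))
          (fun i => vecCoord (y i)
            ((Pi.single (j m) (e m) : ∀ i, TangentSpace (𝓡 d) (y i)) i)) q l) with hh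
  have h1 : ∀ q : 𝔼, (W (γ.move (y i) (pointAt (y i) q)) fun m =>
      (DFinsupp.single (y (j m)) (e m) : TangentFam d X).erase (y i) +
        DFinsupp.single (pointAt (y i) q) (vecAt (y i) q (parallelExt (chartMetric (y i))
          (coordAt d (y i))
          (vecCoord (y i) ((DFinsupp.single (y (j m)) (e m) : TangentFam d X) (y i))) q))) =
      Real.sqrt (k.factorial : ℝ) * h (Function.update (fun i => coordAt d (y i)) i q) := by
    intro q
    set Q := Function.update (fun i => coordAt d (y i)) i q with hQ
    have hQi : Q i = q := Function.update_self ..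
    have hQl : ∀ l, l ≠ i → Q l = coordAt d (y l) := fun l hl => Function.update_of_ne hl ..
    have hyi : pointAt (y i) (Q i) = pointAt (y i) q := by rw [hQi]
    have hyl : ∀ l, l ≠ i → pointAt (y l) (Q l) = y l := fun l hl => by
      rw [hQl l hl, pointAt_coordAt]
    have h2 : (γ.remove (range y)).add (range fun l => pointAt (y l) (Q l)) (finite_range _) =
        γ.move (y i) (pointAt (y i) q) := by
      refine Configuration.ext fun z => ?_
      simp only [Configuration.mem_add, Configuration.mem_move, Configuration.mem_remove]
      constructor
      · rintro (⟨h, h'⟩ | ⟨l, rfl⟩)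
        · exact Or.inr ⟨h, fun h => h' ⟨i, h.symm⟩⟩
        · by_cases hl : l = i
          · subst hl; exact Or.inl hyi
          · simp only [hyl l hl]
            exact Or.inr ⟨hy l, fun h => hl (hinj h)⟩
      · rintro (rfl | ⟨h, h'⟩)
        · exact Or.inr ⟨i, hyi⟩
        · by_cases hz : z ∈ range y
          · obtain ⟨l, rfl⟩ := hz
            exact Or.inr ⟨l, hyl l fun hl => h' (hl ▸ rfl)⟩
          · exact Or.inl ⟨h, hz⟩
    rw [hh]
    simp only
    rw [sqrt_factorial_mul_isoI, h2, component_apply_of_surjective _ _ hj]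
    swap
    · exact fun m l hl =>
        vecAt_parallelExt_eq_zero y Q (by rw [Pi.single_eq_of_ne hl, vecCoord_zero])
    congr 1
    funext m
    rw [vecAt_parallelExt_prodMetric, Pi.single_eq_same]
    have h3 : ∀ q q' : 𝔼, q = q' →
        (DFinsupp.single (pointAt (y (j m)) q) (vecAt (y (j m)) q (parallelExt
          (chartMetric (y (j m))) (coordAt d (y (j m))) (vecCoord (y (j m)) (e m)) q)) :
            TangentFam d X) =
        DFinsupp.single (pointAt (y (j m)) q') (vecAt (y (j m)) q' (parallelExt
          (chartMetric (y (j m))) (coordAt d (y (j m))) (vecCoord (y (j m)) (e m)) q')) := by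
      rintro q _ rfl; rfl
    -- In the moved factor the erased vector is replaced by its extension. In the other factors the
    -- coordinates stay at the base point, where the extension takes its original value.
    by_cases hm : j m = i
    · rw [h3 (Q (j m)) q (by rw [hm, hQi])]
      have h4 : ∀ l, j m = l → (DFinsupp.single (y (j m)) (e m) : TangentFam d X).erase (y l) +
          DFinsupp.single (pointAt (y l) q) (vecAt (y l) q (parallelExt (chartMetric (y l))
          (coordAt d (y l))
          (vecCoord (y l) ((DFinsupp.single (y (j m)) (e m) : TangentFam d X) (y l))) q)) =
          DFinsupp.single (pointAt (y (j m)) q) (vecAt (y (j m)) q (parallelExt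
          (chartMetric (y (j m))) (coordAt d (y (j m))) (vecCoord (y (j m)) (e m)) q)) := by
        rintro l rfl
        rw [DFinsupp.erase_single_same, DFinsupp.single_eq_same, zero_add]
      exact h4 i hm
    · have hne : y (j m) ≠ y i := fun h => hm (hinj h)
      rw [h3 (Q (j m)) _ (hQl _ hm), parallelExt_chartMetric_self,
        DFinsupp.erase_single_ne _ hne, DFinsupp.single_eq_of_ne hne.symm, vecCoord_zero,
        parallelExt_chartMetric_zero, vecAt_zero, DFinsupp.single_zero, add_zero]
      exact (congrArg (fun s : Σ y : X, TangentSpace (𝓡 d) y =>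
        (DFinsupp.single s.1 s.2 : TangentFam d X)) (sigma_vecAt_vecCoord (y (j m)) (e m))).symm
  have hu : Function.update (fun i => coordAt d (y i)) i (coordAt d (y i)) = fun i => coordAt d (y i) := Function.update_eq_self i _
  have h5 : HasFDerivAt h (fderiv ℝ h (fun i => coordAt d (y i))) (Function.update (fun i => coordAt d (y i)) i (coordAt d (y i))) := by
    rw [hu]; exact hdiff.hasFDerivAt
  have h6 := (h5.comp (coordAt d (y i)) (hasFDerivAt_update (fun i => coordAt d (y i)) (coordAt d (y i)))).const_mul
    (Real.sqrt (k.factorial : ℝ))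
  unfold gradConfForm
  simp only [h1]
  refine (congrArg (fun L : 𝔼 →L[ℝ] ℝ => L (vecCoord (y i) u)) h6.fderiv).trans ?_
  change Real.sqrt (k.factorial : ℝ) * fderiv ℝ h (fun i => coordAt d (y i)) _ = Real.sqrt (k.factorial : ℝ) * fderiv ℝ h (fun i => coordAt d (y i)) _
  congr 2
  funext l
  by_cases hl : l = i
  · subst hl; simp
  · rw [Pi.single_eq_of_ne hl, vecCoord_zero]
    simp [hl]

end Components

/-! ### Counting tuples by their distinct points -/

section Tuples

variable {X : Type*} {n k : ℕ}

/-- Every tuple factors through a surjection onto the index set of a tuple of distinct points. -/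
lemma exists_injective_comp_surjective (y : Fin n → X) :
    ∃ k ≤ n, ∃ x : Fin k → X, Function.Injective x ∧
      ∃ j : Fin n → Fin k, Function.Surjective j ∧ y = x ∘ j := by
  classical
  have hc : Fintype.card (range y) ≤ n := by
    simpa using Fintype.card_le_of_surjective _ (rangeFactorization_surjective (f := y))
  refine ⟨_, hc, fun i => ((Fintype.equivFin (range y)).symm i : X),
    Subtype.val_injective.comp (Equiv.injective _), fun m =>
      Fintype.equivFin (range y) ⟨y m, mem_range_self m⟩, ?_, ?_⟩
  · exact (Equiv.surjective _).comp (rangeFactorization_surjective (f := y))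
  · funext m; simp

open Classical in
-- A factorization y = x ∘ j with x injective and j surjective is the same as a bijection of Fin k
-- onto the range of y: x is the bijection and j its inverse along y.
lemma card_factorizations (y : Fin n → X) (S : Finset X) (hy : ∀ m, y m ∈ S) :
    (((Fintype.piFinset fun _ : Fin k => S).filter Function.Injective ×ˢ
      (Finset.univ : Finset (Fin n → Fin k)).filter Function.Surjective).filter
        fun p => p.1 ∘ p.2 = y).card =
      if k = Fintype.card (range y) then k.factorial else 0 := by
  split_ifs with hk
  · have h1 : Fintype.card (Fin k ≃ range y) = k.factorial := by
      rw [Fintype.card_equiv (Fintype.equivFinOfCardEq hk.symm).symm, Fintype.card_fin]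
    rw [← h1, ← Finset.card_univ]
    symm
    refine Finset.card_bij (fun e _ => (fun i => (e i : X),
      fun m => e.symm ⟨y m, mem_range_self m⟩)) ?_ ?_ ?_
    · intro e _
      simp only [Finset.mem_filter, Finset.mem_product, Fintype.mem_piFinset, Finset.mem_univ,
        true_and]
      refine ⟨⟨⟨fun i => ?_, Subtype.val_injective.comp e.injective⟩,
        e.symm.surjective.comp (rangeFactorization_surjective (f := y))⟩, ?_⟩
      · obtain ⟨m, hm⟩ := (e i).2
        rw [← hm]; exact hy m
      · funext m; simp
    · intro e _ e' _ h
      ext i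
      exact congrFun (congrArg Prod.fst h) i
    · rintro ⟨x, j⟩ h
      simp only [Finset.mem_filter, Finset.mem_product, Fintype.mem_piFinset, Finset.mem_univ,
        true_and] at h
      obtain ⟨⟨⟨hxS, hx⟩, hj⟩, rfl⟩ := h
      have hr : ∀ i, x i ∈ range (x ∘ j) := fun i => by
        obtain ⟨m, rfl⟩ := hj i; exact ⟨m, rfl⟩
      have hb : Function.Bijective fun i => (⟨x i, hr i⟩ : range (x ∘ j)) := by
        refine ⟨fun i i' h => hx (congrArg Subtype.val h), ?_⟩
        rintro ⟨_, m, rfl⟩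
        exact ⟨j m, rfl⟩
      refine ⟨Equiv.ofBijective _ hb, Finset.mem_univ _, Prod.ext rfl (funext fun m => ?_)⟩
      exact (Equiv.ofBijective _ hb).symm_apply_eq.2 rfl
  · rw [Finset.card_eq_zero, Finset.filter_eq_empty_iff]
    rintro ⟨x, j⟩ h rfl
    simp only [Finset.mem_filter, Finset.mem_product, Finset.mem_univ, true_and] at h
    refine hk ?_
    have h2 : range (x ∘ j) = range x := h.2.range_comp x
    rw [Fintype.card_congr (Equiv.setCongr h2), Set.card_range_of_injective h.1.2, Fintype.card_fin]

open Classical in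
/-- Summation over tuples according to the number of distinct points. -/
lemma sum_tuples (S : Finset X) (f : (Fin n → X) → ℝ) :
    ∑ y ∈ Fintype.piFinset fun _ : Fin n => S, f y =
      ∑ k ∈ Finset.range (n + 1), ∑ x ∈ (Fintype.piFinset fun _ : Fin k => S).filter
        Function.Injective, ((k.factorial : ℝ))⁻¹ *
          ∑ j : Fin n → Fin k with Function.Surjective j, f (x ∘ j) := by
  have h1 : ∀ k, ∑ x ∈ (Fintype.piFinset fun _ : Fin k => S).filter
        Function.Injective, ((k.factorial : ℝ))⁻¹ *
          ∑ j : Fin n → Fin k with Function.Surjective j, f (x ∘ j) =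
      ∑ y ∈ Fintype.piFinset fun _ : Fin n => S,
        if k = Fintype.card (range y) then f y else 0 := by
    intro k
    rw [← Finset.mul_sum, ← Finset.sum_product']
    rw [← Finset.sum_fiberwise_of_maps_to (t := Fintype.piFinset fun _ : Fin n => S)
      (g := fun p : (Fin k → X) × (Fin n → Fin k) => p.1 ∘ p.2)]
    · rw [Finset.mul_sum]
      refine Finset.sum_congr rfl fun y hy => ?_
      rw [Finset.sum_congr rfl (g := fun _ => f y)
        (fun p hp => congrArg f (Finset.mem_filter.1 hp).2), Finset.sum_const,
        card_factorizations y S (Fintype.mem_piFinset.1 hy)]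
      split_ifs with hk
      · rw [nsmul_eq_mul, inv_mul_cancel_left₀ (Nat.cast_ne_zero.2 k.factorial_ne_zero)]
      · simp
    · intro p hp
      simp only [Finset.mem_product, Finset.mem_filter, Fintype.mem_piFinset] at hp ⊢
      exact fun m => hp.1.1 _
  simp only [h1]
  rw [Finset.sum_comm]
  refine Finset.sum_congr rfl fun y _ => ?_
  rw [Finset.sum_ite_eq' , if_pos]
  rw [Finset.mem_range, Nat.lt_succ_iff]
  simpa using Fintype.card_le_of_surjective _ (rangeFactorization_surjective (f := y))

/-- A sum over a set, of a function which vanishes off a finite subset. -/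
lemma tsum_coe_eq_sum {s : Set X} (S : Finset X) (hS : ∀ x ∈ S, x ∈ s) {f : X → ℝ}
    (hf : ∀ x ∈ s, x ∉ S → f x = 0) : ∑' x : s, f x = ∑ x ∈ S, f x := by
  classical
  rw [tsum_subtype s f, tsum_eq_sum (s := S)]
  · exact Finset.sum_congr rfl fun x hx => indicator_of_mem (hS x hx) f
  · intro x hx
    by_cases h : x ∈ s
    · rw [indicator_of_mem h, hf x h hx]
    · exact indicator_of_notMem h f

lemma tsum_tuple_eq_sum {s : Set X} (S : Finset X) (hS : ∀ x ∈ S, x ∈ s) {f : (Fin n → X) → ℝ}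
    (hf : ∀ y, (∀ m, y m ∈ s) → (∃ m, y m ∉ S) → f y = 0) :
    ∑' y : Fin n → s, f (fun m => y m) = ∑ y ∈ Fintype.piFinset fun _ : Fin n => S, f y := by
  classical
  have hi : Function.Injective fun (y : Fin n → s) (m : Fin n) => (y m : X) := fun y y' h =>
    funext fun m => Subtype.ext (congrFun h m)
  have h1 : ∀ y : Fin n → s, f (fun m => y m) =
      ((Fintype.piFinset fun _ : Fin n => S : Finset (Fin n → X)) : Set (Fin n → X)).indicator f
        fun m => (y m : X) := by
    intro y
    by_cases h : (fun m => (y m : X)) ∈ Fintype.piFinset fun _ : Fin n => S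
    · rw [indicator_of_mem (Finset.mem_coe.2 h)]
    · rw [indicator_of_notMem fun h' => h (Finset.mem_coe.1 h')]
      simp only [Fintype.mem_piFinset, not_forall] at h
      exact hf _ (fun m => (y m).2) h
  simp only [h1]
  rw [hi.tsum_eq (f := ((Fintype.piFinset fun _ : Fin n => S : Finset (Fin n → X)) :
    Set (Fin n → X)).indicator f), tsum_eq_sum (s := Fintype.piFinset fun _ : Fin n => S)]
  · exact Finset.sum_congr rfl fun y hy => indicator_of_mem (Finset.mem_coe.2 hy) f
  · exact fun y hy => indicator_of_notMem (fun h => hy (Finset.mem_coe.1 h)) f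
  · intro y hy
    have hy' : y ∈ Fintype.piFinset fun _ : Fin n => S := by
      by_contra h
      exact hy (indicator_of_notMem (fun h' => h (Finset.mem_coe.1 h')) f)
    exact ⟨fun m => ⟨y m, hS _ (Fintype.mem_piFinset.1 hy' m)⟩, rfl⟩

end Tuples

/-! ### Finite sums of cylinder functions times forms -/

section Linearity

variable {d : ℕ} {X : Type*} [MetricSpace X] [ChartedSpace (EuclideanSpace ℝ (Fin d)) X] {n k : ℕ}

lemma component_add (α β : TangentFam d X [⋀^Fin n]→ₗ[ℝ] ℝ) (x : Fin k → X) :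
    component (α + β) x = component α x + component β x := by
  refine AlternatingMap.ext fun v => ?_
  rw [AlternatingMap.add_apply, component_apply, component_apply, component_apply,
    ← Finset.sum_add_distrib]
  rfl

lemma component_smul (a : ℝ) (α : TangentFam d X [⋀^Fin n]→ₗ[ℝ] ℝ) (x : Fin k → X) :
    component (a • α) x = a • component α x := by
  refine AlternatingMap.ext fun v => ?_
  rw [AlternatingMap.smul_apply, component_apply, component_apply, Finset.smul_sum]
  rfl

lemma component_zero (x : Fin k → X) :
    component (0 : TangentFam d X [⋀^Fin n]→ₗ[ℝ] ℝ) x = 0 := by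
  have := component_smul 0 (0 : TangentFam d X [⋀^Fin n]→ₗ[ℝ] ℝ) x
  rwa [zero_smul, zero_smul] at this

end Linearity

/-- The data of a map `(γ, x) ↦ ∑ᵢ Fᵢ(γ) ηᵢ(x)` with cylinder functions `Fᵢ` and smooth compactly
supported forms `ηᵢ` on `X ^ k`. -/
structure FockRep (d : ℕ) (X : Type*) [MetricSpace X]
    [ChartedSpace (EuclideanSpace ℝ (Fin d)) X] (n k : ℕ) where
  ι : Type
  fintype : Fintype ι
  c : ι → CylinderData d X
  η : ι → ∀ x : Fin k → X, PowFormAt d n x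
  K : Set X
  smooth : ∀ i, SmoothForm (η i)
  isCompact_K : IsCompact K
  tsupport_subset : ∀ i a, tsupport ((c i).φ a) ⊆ K
  eta_eq_zero : ∀ i x, (∃ l, x l ∉ K) → η i x = 0

attribute [instance] FockRep.fintype

namespace FockRep

variable {d : ℕ} {X : Type*} [MetricSpace X] [ChartedSpace (EuclideanSpace ℝ (Fin d)) X] {n k : ℕ}

local notation "𝔼" => EuclideanSpace ℝ (Fin d)

/-- The map `(γ, x) ↦ ∑ᵢ Fᵢ(γ) ηᵢ(x)`. -/
def val (R : FockRep d X n k) (γ : Configuration X) (x : Fin k → X) : PowFormAt d n x :=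
  ∑ i, (R.c i).eval γ • R.η i x

lemma val_apply (R : FockRep d X n k) (γ : Configuration X) (x : Fin k → X)
    (v : Fin n → ∀ i, TangentSpace (𝓡 d) (x i)) :
    R.val γ x v = ∑ i, (R.c i).eval γ * R.η i x v := by
  exact map_sum ({ toFun := fun α => α v, map_zero' := rfl, map_add' := fun _ _ => rfl } :
    PowFormAt d n x →+ ℝ) _ _

/-- `R` describes `Iⁿ W`. -/
def Represents (R : FockRep d X n k) (W : ConfForm d X n) : Prop :=
  ∀ γ x, Function.Injective x → isoI W k γ x = R.val (γ.remove (range x)) x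

lemma Represents.isoI_eq {R : FockRep d X n k} {W : ConfForm d X n} (h : R.Represents W)
    {γ : Configuration X} {x : Fin k → X} (hx : Function.Injective x) (hγ : ∀ i, x i ∉ γ.1) :
    isoI W k γ x = R.val γ x := by
  have h1 : γ.remove (range x) = γ := Configuration.remove_eq_self γ
    (Set.disjoint_right.2 (by rintro _ ⟨i, rfl⟩; exact hγ i))
  have h2 := h γ x hx
  rwa [h1] at h2

/-- The trivial representation. -/
def zero (d : ℕ) (X : Type*) [MetricSpace X] [ChartedSpace (EuclideanSpace ℝ (Fin d)) X]
    (n k : ℕ) : FockRep d X n k where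
  ι := Empty
  fintype := inferInstance
  c := Empty.elim
  η := fun i => i.elim
  K := ∅
  smooth := fun i => i.elim
  isCompact_K := isCompact_empty
  tsupport_subset := fun i => i.elim
  eta_eq_zero := fun i => i.elim

/-- The sum of two representations. -/
def add (R R' : FockRep d X n k) : FockRep d X n k where
  ι := R.ι ⊕ R'.ι
  fintype := inferInstance
  c := Sum.elim R.c R'.c
  η := Sum.elim R.η R'.η
  K := R.K ∪ R'.K
  smooth := fun i => by cases i; exacts [R.smooth _, R'.smooth _]
  isCompact_K := R.isCompact_K.union R'.isCompact_K
  tsupport_subset := fun i a => by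
    cases i
    exacts [(R.tsupport_subset _ a).trans subset_union_left,
      (R'.tsupport_subset _ a).trans subset_union_right]
  eta_eq_zero := fun i x hx => by
    obtain ⟨l, hl⟩ := hx
    cases i
    exacts [R.eta_eq_zero _ x ⟨l, fun h => hl (Or.inl h)⟩,
      R'.eta_eq_zero _ x ⟨l, fun h => hl (Or.inr h)⟩]

/-- A multiple of a representation. -/
def smul (a : ℝ) (R : FockRep d X n k) : FockRep d X n k where
  ι := R.ι
  fintype := inferInstance
  c := R.c
  η := fun i x => a • R.η i x
  K := R.K
  smooth := fun i x v => (R.smooth i x v).const_smul a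
  isCompact_K := R.isCompact_K
  tsupport_subset := R.tsupport_subset
  eta_eq_zero := fun i x hx => by rw [R.eta_eq_zero i x hx, smul_zero]

lemma represents_zero : (zero d X n k).Represents (0 : ConfForm d X n) := fun γ x _ => by
  refine (congrArg (fun t => (Real.sqrt (k.factorial : ℝ))⁻¹ • t) (component_zero x)).trans ?_
  rw [smul_zero]; rfl

lemma Represents.add {R R' : FockRep d X n k} {W W' : ConfForm d X n} (h : R.Represents W)
    (h' : R'.Represents W') : (R.add R').Represents (W + W') := fun γ x hx => by
  have e : isoI (W + W') k γ x = isoI W k γ x + isoI W' k γ x := by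
    refine (congrArg (fun t => (Real.sqrt (k.factorial : ℝ))⁻¹ • t)
      (component_add _ _ x)).trans ?_
    rw [smul_add]; rfl
  rw [e, h γ x hx, h' γ x hx]
  exact (Fintype.sum_sum_type fun i : R.ι ⊕ R'.ι =>
    (Sum.elim R.c R'.c i).eval (γ.remove (range x)) • Sum.elim R.η R'.η i x).symm

lemma Represents.smul {R : FockRep d X n k} {W : ConfForm d X n} (h : R.Represents W) (a : ℝ) :
    (R.smul a).Represents (a • W) := fun γ x hx => by
  have e : isoI (a • W) k γ x = a • isoI W k γ x := by
    refine (congrArg (fun t => (Real.sqrt (k.factorial : ℝ))⁻¹ • t)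
      (component_smul a _ x)).trans ?_
    rw [smul_comm]; rfl
  rw [e, h γ x hx, val, Finset.smul_sum]
  exact Finset.sum_congr rfl fun i _ => smul_comm _ _ _

end FockRep

section Existence

variable {d : ℕ} {X : Type*} [MetricSpace X] [ChartedSpace (EuclideanSpace ℝ (Fin d)) X] {n : ℕ}

/-- Iⁿ evaluates W at γ ∪ x, and taking x away again leaves γ \ x, which differs from γ if some x_i
was already present; hence the form of `FockRep.Represents`. For k other than k₀ the component is
zero. -/
lemma IsElementaryForm.exists_fockRep {k₀ : ℕ} {F : Configuration X → ℝ}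
    {η : ∀ x : Fin k₀ → X, PowFormAt d n x} {W : ConfForm d X n} (hF : IsCylinder d F)
    (hη : IsPsiSym η) (hW : IsElementaryForm k₀ F η W) (k : ℕ) :
    ∃ R : FockRep d X n k, R.Represents W := by
  have hmem : ∀ {l : ℕ} (γ : Configuration X) (x : Fin l → X) (i : Fin l),
      x i ∈ (γ.add (range x) (finite_range x)).1 := fun γ x i => Or.inr (mem_range_self i)
  by_cases hk : k = k₀
  · subst hk
    obtain ⟨c, rfl⟩ := hF.exists_data
    obtain ⟨K, hK, hK'⟩ := hη.compact_support
    refine ⟨{ ι := Unit, fintype := inferInstance, c := fun _ => c, η := fun _ => η,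
              -- One compact set serves both for the points x_l and for the points of γ at which the
              -- cylinder function has a gradient.
              K := (⋃ l, (fun x : Fin k → X => x l) '' K) ∪ ⋃ a, tsupport (c.φ a),
              smooth := fun _ => hη.smooth,
              isCompact_K := (isCompact_iUnion fun l => hK.image (continuous_apply l)).union
                (isCompact_iUnion fun a => c.hasCompactSupport a),
              tsupport_subset := fun _ a => (subset_iUnion (fun a => tsupport (c.φ a)) a).trans
                subset_union_right,
              eta_eq_zero := fun _ x hx => hK' x fun h => by
                obtain ⟨l, hl⟩ := hx
                exact hl (Or.inl (mem_iUnion.2 ⟨l, x, h, rfl⟩)) }, fun γ x hx => ?_⟩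
    have h1 : (γ.add (range x) (finite_range x)).remove (range x) = γ.remove (range x) := by
      refine Configuration.ext fun z => ?_
      simp only [Configuration.mem_add, Configuration.mem_remove]
      tauto
    have h2 := hW.component_eq _ x hx (hmem γ x)
    rw [h1] at h2
    refine (congrArg (fun t => (Real.sqrt (k.factorial : ℝ))⁻¹ • t) h2).trans ?_
    rw [smul_smul, inv_mul_cancel_left₀ (sqrt_factorial_ne_zero k)]
    exact (Fintype.sum_unique fun _ : Unit => c.eval (γ.remove (range x)) • η x).symm
  · refine ⟨FockRep.zero d X n k, fun γ x hx => ?_⟩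
    refine (congrArg (fun t => (Real.sqrt (k.factorial : ℝ))⁻¹ • t)
      (hW.component_ne _ k hk x hx (hmem γ x))).trans ?_
    rw [smul_zero]; rfl

lemma exists_fockRep {W : ConfForm d X n} (hW : W ∈ DOmega d X n) (k : ℕ) :
    ∃ R : FockRep d X n k, R.Represents W := by
  induction hW using Submodule.span_induction with
  | mem W h =>
    obtain ⟨k₀, F, η, -, -, hF, hη, hW⟩ := h
    exact hW.exists_fockRep hF hη k
  | zero => exact ⟨_, FockRep.represents_zero⟩
  | add W W' _ _ h h' =>
    obtain ⟨R, hR⟩ := h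
    obtain ⟨R', hR'⟩ := h'
    exact ⟨_, hR.add hR'⟩
  | smul a W _ h =>
    obtain ⟨R, hR⟩ := h
    exact ⟨_, hR.smul a⟩

end Existence

/-! ### The gradients of a represented form -/

section Bilinearity

variable {d : ℕ} {X : Type*} [MetricSpace X] [ChartedSpace (EuclideanSpace ℝ (Fin d)) X] {n k : ℕ}
  [RiemannianBundle (fun x : X => TangentSpace (𝓡 d) x)]

lemma innerPow_sum {ι κ : Type*} [Fintype ι] [Fintype κ] (x : Fin k → X) (a : ι → ℝ) (b : κ → ℝ)
    (α : ι → (Fin n → ∀ i, TangentSpace (𝓡 d) (x i)) → ℝ)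
    (β : κ → (Fin n → ∀ i, TangentSpace (𝓡 d) (x i)) → ℝ) :
    innerPow x (fun v => ∑ i, a i * α i v) (fun v => ∑ j, b j * β j v) =
      ∑ i, ∑ j, a i * b j * innerPow x (α i) (β j) := by
  simp only [innerPow, Finset.mul_sum]
  have h2 : ∀ f : ι → κ → (Fin n → Fin k) → (Fin n → Fin d) → ℝ,
      ∑ a, ∑ b, ∑ z, ∑ i, f a b z i = ∑ z, ∑ i, ∑ a, ∑ b, f a b z i := by
    intro f
    rw [Finset.sum_congr rfl fun a _ => Finset.sum_comm, Finset.sum_comm]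
    refine Finset.sum_congr rfl fun z _ => ?_
    rw [Finset.sum_congr rfl fun a _ => Finset.sum_comm, Finset.sum_comm]
  rw [h2]
  refine Finset.sum_congr rfl fun z _ => Finset.sum_congr rfl fun i _ => ?_
  rw [Finset.sum_comm]
  refine Finset.sum_congr rfl fun b _ => ?_
  rw [Finset.sum_mul]
  exact Finset.sum_congr rfl fun a _ => by ring

end Bilinearity

namespace FockRep

variable {d : ℕ} {X : Type*} [MetricSpace X] [ChartedSpace (EuclideanSpace ℝ (Fin d)) X] {n k : ℕ}

local notation "𝔼" => EuclideanSpace ℝ (Fin d)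

lemma tendsto_pointAt (x : X) : Filter.Tendsto (pointAt (d := d) x) (𝓝 (coordAt d x)) (𝓝 x) := by
  have := continuousAt_pointAt (coordAt_mem (d := d) x)
  rwa [ContinuousAt, pointAt_coordAt] at this

lemma tendsto_pointAt_pi (x : Fin k → X) (l : Fin k) :
    Filter.Tendsto (fun q : Fin k → 𝔼 => pointAt (x l) (q l)) (𝓝 fun i => coordAt d (x i))
      (𝓝 (x l)) :=
  (tendsto_pointAt (x l)).comp ((continuous_apply l).tendsto fun i => coordAt d (x i))

variable [LocallyCompactSpace X] [SecondCountableTopology X] [MeasurableSpace X] [BorelSpace X]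

/-- Distinctness of the points and disjointness from γ are open conditions, so the formula ∑ F_i(γ)
η_i(x) holds in a neighbourhood and can be differentiated. -/
lemma eventually_injective_disjoint {γ : Configuration X} {x : Fin k → X}
    (hx : Function.Injective x) (hγ : ∀ i, x i ∉ γ.1) :
    ∀ᶠ q in 𝓝 fun i => coordAt d (x i), Function.Injective (fun i => pointAt (x i) (q i)) ∧
      ∀ i, pointAt (x i) (q i) ∉ γ.1 := by
  refine Filter.Eventually.and ?_ (Filter.eventually_all.2 fun l => ?_)
  · have h : ∀ l l', ∀ᶠ q : Fin k → 𝔼 in 𝓝 fun i => coordAt d (x i),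
        l ≠ l' → pointAt (x l) (q l) ≠ pointAt (x l') (q l') := by
      intro l l'
      by_cases hl : l = l'
      · exact Filter.Eventually.of_forall fun _ h => absurd hl h
      · have ho : IsOpen {p : X × X | p.1 ≠ p.2} := isOpen_ne_fun continuous_fst continuous_snd
        filter_upwards [((tendsto_pointAt_pi (d := d) x l).prodMk_nhds
          (tendsto_pointAt_pi x l')).eventually
            (ho.mem_nhds fun h => hl (hx h))] with q hq _ using hq
    filter_upwards [Filter.eventually_all.2 fun l => Filter.eventually_all.2 fun l' => h l l']
      with q hq l l' hll
    by_contra hne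
    exact hq l l' hne hll
  · exact (tendsto_pointAt_pi x l).eventually (γ.isClosed_val.isOpen_compl.mem_nhds (hγ l))

variable [IsManifold (𝓡 d) ∞ X] [RiemannianBundle (fun x : X => TangentSpace (𝓡 d) x)]

lemma Represents.gradGamma_eq {R : FockRep d X n k} {W : ConfForm d X n} (h : R.Represents W)
    {γ : Configuration X} {x : Fin k → X} (hx : Function.Injective x) (hγ : ∀ i, x i ∉ γ.1)
    {z : X} (hz : z ∈ γ.1) (u : TangentSpace (𝓡 d) z)
    (v : Fin n → ∀ i, TangentSpace (𝓡 d) (x i)) :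
    gradGamma (isoI W) γ x z u v = ∑ i, (R.c i).grad γ z u * R.η i x v := by
  have hzx : z ∉ range x := by rintro ⟨i, rfl⟩; exact hγ i hz
  have e : (fun q : 𝔼 => isoI W k (γ.move z (pointAt z q)) x v) =ᶠ[𝓝 (coordAt d z)]
      fun q => ∑ i, (R.c i).eval (γ.move z (pointAt z q)) * R.η i x v := by
    filter_upwards [(tendsto_pointAt z).eventually
      ((finite_range x).isClosed.isOpen_compl.mem_nhds hzx)] with q hq
    rw [h.isoI_eq hx, val_apply]
    intro i hi
    rcases Configuration.mem_move.1 hi with hi | ⟨hi, -⟩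
    · exact hq ⟨i, hi⟩
    · exact hγ i hi
  choose L hL hL' using fun i => (R.c i).hasFDerivAt_eval_move hz
  have h1 := HasFDerivAt.fun_sum fun i (_ : i ∈ Finset.univ) => (hL i).mul_const (R.η i x v)
  rw [gradGamma, e.fderiv_eq]
  refine (congrArg (fun L : 𝔼 →L[ℝ] ℝ => L (vecCoord z u)) h1.fderiv).trans ?_
  rw [_root_.sum_apply]
  refine Finset.sum_congr rfl fun i _ => ?_
  rw [ContinuousLinearMap.smul_apply, hL', smul_eq_mul, mul_comm]

variable [IsContMDiffRiemannianBundle (𝓡 d) ∞ (EuclideanSpace ℝ (Fin d))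
      (fun x : X => TangentSpace (𝓡 d) x)]

/-- Besides the value of `gradPow`, this supplies the differentiability required by
`gradConfForm_of_mem`. -/
lemma Represents.hasFDerivAt_isoI {R : FockRep d X n k} {W : ConfForm d X n} (h : R.Represents W)
    {γ : Configuration X} {x : Fin k → X} (hx : Function.Injective x) (hγ : ∀ i, x i ∉ γ.1)
    (v : Fin n → ∀ i, TangentSpace (𝓡 d) (x i)) :
    ∃ L : (Fin k → 𝔼) →L[ℝ] ℝ, HasFDerivAt (fun q : Fin k → 𝔼 =>
      isoI W k γ (fun i => pointAt (x i) (q i)) fun m i =>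
        vecAt (x i) (q i) (parallelExt (prodMetric x) (fun i => coordAt d (x i))
          (fun i => vecCoord (x i) (v m i)) q i)) L (fun i => coordAt d (x i)) ∧
      ∀ u : ∀ i, TangentSpace (𝓡 d) (x i), L (fun i => vecCoord (x i) (u i)) =
        ∑ i, (R.c i).eval γ * gradPow (R.η i) x u v := by
  have hP : (fun i => coordAt d (x i)) ∈ prodDom x := fun i _ => coordAt_mem (x i)
  choose L hL _ using fun i => (R.smooth i).hasFDerivAt_formIn_parallelExt hP
    (fun m i => vecCoord (x i) (v m i))
  have h1 := HasFDerivAt.fun_sum fun i (_ : i ∈ Finset.univ) => (hL i).const_mul ((R.c i).eval γ)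
  refine ⟨_, h1.congr_of_eventuallyEq ?_, fun u => ?_⟩
  · filter_upwards [eventually_injective_disjoint hx hγ] with q hq
    rw [h.isoI_eq hq.1 hq.2, val_apply]
    rfl
  · rw [_root_.sum_apply]
    refine Finset.sum_congr rfl fun i _ => ?_
    rw [ContinuousLinearMap.smul_apply, gradPow_eq_covIn, covIn, (hL i).fderiv, smul_eq_mul]

lemma Represents.gradPow_eq {R : FockRep d X n k} {W : ConfForm d X n} (h : R.Represents W)
    {γ : Configuration X} {x : Fin k → X} (hx : Function.Injective x) (hγ : ∀ i, x i ∉ γ.1)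
    (u : ∀ i, TangentSpace (𝓡 d) (x i)) (v : Fin n → ∀ i, TangentSpace (𝓡 d) (x i)) :
    gradPow (isoI W k γ) x u v = ∑ i, (R.c i).eval γ * gradPow (R.η i) x u v := by
  obtain ⟨L, h1, h2⟩ := h.hasFDerivAt_isoI hx hγ v
  rw [← h2]
  exact congrArg (fun L : (Fin k → 𝔼) →L[ℝ] ℝ => L fun i => vecCoord (x i) (u i)) h1.fderiv

lemma gradPow_eta_eq_zero (R : FockRep d X n k) (i : R.ι) {x : Fin k → X} {l : Fin k}
    (hl : x l ∉ R.K) (u : ∀ i, TangentSpace (𝓡 d) (x i))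
    (v : Fin n → ∀ i, TangentSpace (𝓡 d) (x i)) : gradPow (R.η i) x u v = 0 := by
  have e : (fun q : Fin k → 𝔼 =>
      R.η i (fun i => pointAt (x i) (q i)) fun m i =>
        vecAt (x i) (q i) (parallelExt (prodMetric x) (fun i => coordAt d (x i))
          (fun i => vecCoord (x i) (v m i)) q i)) =ᶠ[𝓝 fun i => coordAt d (x i)] fun _ => 0 := by
    filter_upwards [(tendsto_pointAt_pi x l).eventually
      (R.isCompact_K.isClosed.isOpen_compl.mem_nhds hl)] with q hq
    rw [R.eta_eq_zero i _ ⟨l, hq⟩]; rfl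
  rw [gradPow, e.fderiv_eq]; simp

/-- The first part of the integrand on the right hand side. -/
def thetaGamma (R R' : FockRep d X n k) (p : Configuration X × (Fin k → X)) : ℝ :=
  ∑ i, ∑ j, (R.c i).carre (R'.c j) p.1 * innerPow p.2 (R.η i p.2) (R'.η j p.2)

/-- The second part of the integrand on the right hand side. -/
def thetaPow (R R' : FockRep d X n k) (p : Configuration X × (Fin k → X)) : ℝ :=
  ∑ i, ∑ j, ((R.c i).eval p.1 * (R'.c j).eval p.1) *
    innerGradPow p.2 (gradPow (R.η i) p.2) (gradPow (R'.η j) p.2)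

lemma Represents.innerGradPow_eq {R R' : FockRep d X n k} {W W' : ConfForm d X n}
    (h : R.Represents W) (h' : R'.Represents W') {γ : Configuration X} {x : Fin k → X}
    (hx : Function.Injective x) (hγ : ∀ i, x i ∉ γ.1) :
    innerGradPow x (gradPow (isoI W k γ) x) (gradPow (isoI W' k γ) x) = thetaPow R R' (γ, x) := by
  unfold innerGradPow thetaPow
  have h1 : ∀ u, gradPow (isoI W k γ) x u = fun v =>
      ∑ i, (R.c i).eval γ * gradPow (R.η i) x u v := fun u => funext (h.gradPow_eq hx hγ u)
  have h1' : ∀ u, gradPow (isoI W' k γ) x u = fun v =>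
      ∑ i, (R'.c i).eval γ * gradPow (R'.η i) x u v := fun u => funext (h'.gradPow_eq hx hγ u)
  simp only [h1, h1', innerPow_sum, innerGradPow, Finset.mul_sum]
  have h2 : ∀ f : Fin k → Fin d → R.ι → R'.ι → ℝ,
      ∑ a, ∑ b, ∑ z, ∑ i, f a b z i = ∑ z, ∑ i, ∑ a, ∑ b, f a b z i := by
    intro f
    rw [Finset.sum_congr rfl fun a _ => Finset.sum_comm, Finset.sum_comm]
    refine Finset.sum_congr rfl fun z _ => ?_
    rw [Finset.sum_congr rfl fun a _ => Finset.sum_comm, Finset.sum_comm]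
  rw [h2]

/-- The points of `γ` in the compact set `K`. -/
def _root_.Configuration.restrictFinset (γ : Configuration X) {K : Set X} (hK : IsCompact K) :
    Finset X := (γ.2 K hK).toFinset

lemma _root_.Configuration.mem_restrictFinset {γ : Configuration X} {K : Set X} {hK : IsCompact K}
    {x : X} : x ∈ γ.restrictFinset hK ↔ x ∈ γ.1 ∧ x ∈ K := by
  simp [Configuration.restrictFinset]

lemma grad_eq_zero (R : FockRep d X n k) (i : R.ι) (γ : Configuration X) {z : X} (hz : z ∉ R.K)
    (u : TangentSpace (𝓡 d) z) : (R.c i).grad γ z u = 0 :=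
  (R.c i).grad_eq_zero γ (fun a h => hz (R.tsupport_subset i a h)) u

lemma Represents.innerGradGamma_eq {R R' : FockRep d X n k} {W W' : ConfForm d X n}
    (h : R.Represents W) (h' : R'.Represents W') {γ : Configuration X} {x : Fin k → X}
    (hx : Function.Injective x) (hγ : ∀ i, x i ∉ γ.1) :
    innerGradGamma γ x (gradGamma (isoI W) γ x) (gradGamma (isoI W') γ x) =
      thetaGamma R R' (γ, x) := by
  have hS : ∀ z ∈ γ.restrictFinset R.isCompact_K, z ∈ γ.1 := fun z hz =>
    (Configuration.mem_restrictFinset.1 hz).1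
  have h1 : ∀ z : γ.1, ∑ a : Fin d, innerPow x (gradGamma (isoI W) γ x z (frame (z : X) a))
      (gradGamma (isoI W') γ x z (frame (z : X) a)) = ∑ i, ∑ j,
        (∑ a : Fin d, (R.c i).grad γ (z : X) (frame (z : X) a) *
          (R'.c j).grad γ (z : X) (frame (z : X) a)) * innerPow x (R.η i x) (R'.η j x) := by
    intro z
    have e : ∀ u, gradGamma (isoI W) γ x z u = fun v => ∑ i, (R.c i).grad γ (z : X) u * R.η i x v :=
      fun u => funext (h.gradGamma_eq hx hγ z.2 u)
    have e' : ∀ u, gradGamma (isoI W') γ x z u =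
        fun v => ∑ i, (R'.c i).grad γ (z : X) u * R'.η i x v :=
      fun u => funext (h'.gradGamma_eq hx hγ z.2 u)
    simp only [e, e', innerPow_sum, Finset.sum_mul]
    rw [Finset.sum_comm]
    exact Finset.sum_congr rfl fun i _ => Finset.sum_comm
  unfold innerGradGamma
  simp only [h1]
  rw [tsum_coe_eq_sum (γ.restrictFinset R.isCompact_K) hS (f := fun z => ∑ i, ∑ j,
        (∑ a : Fin d, (R.c i).grad γ z (frame z a) *
          (R'.c j).grad γ z (frame z a)) * innerPow x (R.η i x) (R'.η j x))]
  · rw [Finset.sum_comm]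
    refine Finset.sum_congr rfl fun i _ => ?_
    rw [Finset.sum_comm]
    refine Finset.sum_congr rfl fun j _ => ?_
    rw [← Finset.sum_mul, CylinderData.tsum_grad_mul_grad _ _ _ _ hS]
    exact fun a z hz ha => Configuration.mem_restrictFinset.2 ⟨hz, R.tsupport_subset i a ha⟩
  · intro z hz hzS
    have hzK : z ∉ R.K := fun hK => hzS (Configuration.mem_restrictFinset.2 ⟨hz, hK⟩)
    simp [R.grad_eq_zero _ γ hzK]

end FockRep

/-! ### The pointwise identity for the integrand -/

section Pointwise

variable {d : ℕ} {X : Type*} [MetricSpace X] [ChartedSpace (EuclideanSpace ℝ (Fin d)) X] {n k : ℕ}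

local notation "𝔼" => EuclideanSpace ℝ (Fin d)

/-- Each of the two factors carries √k!, and their product cancels the 1/k! of `sum_tuples`. Maps j
that miss an index i contribute nothing to `innerPow`, by h0. -/
lemma innerPow_eq_sum_surjective [RiemannianBundle (fun x : X => TangentSpace (𝓡 d) x)]
    (x : Fin k → X) {α β : (Fin n → ∀ i, TangentSpace (𝓡 d) (x i)) → ℝ}
    {A B : (Fin n → Fin k) → (Fin n → Fin d) → ℝ}
    (hA : ∀ j, Function.Surjective j → ∀ b, A j b = Real.sqrt (k.factorial : ℝ) *
      α fun m => Pi.single (j m) (frame (x (j m)) (b m)))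
    (hB : ∀ j, Function.Surjective j → ∀ b, B j b = Real.sqrt (k.factorial : ℝ) *
      β fun m => Pi.single (j m) (frame (x (j m)) (b m)))
    (h0 : ∀ i v, (∀ m, v m i = 0) → α v = 0)
    [DecidablePred fun j : Fin n → Fin k => Function.Surjective j] :
    ((k.factorial : ℝ))⁻¹ * ∑ j : Fin n → Fin k with Function.Surjective j,
      ∑ b, A j b * B j b = innerPow x α β := by
  unfold innerPow
  rw [← Finset.sum_subset (Finset.filter_subset (fun j => Function.Surjective j) Finset.univ)]
  · rw [Finset.mul_sum]
    refine Finset.sum_congr rfl fun j hj => ?_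
    rw [Finset.mul_sum]
    refine Finset.sum_congr rfl fun b _ => ?_
    have hj' := (Finset.mem_filter.1 hj).2
    rw [hA j hj', hB j hj', mul_mul_mul_comm, Real.mul_self_sqrt (Nat.cast_nonneg _),
      inv_mul_cancel_left₀ (Nat.cast_ne_zero.2 k.factorial_ne_zero)]
  · intro j _ hj
    have hj' : ¬ Function.Surjective j := fun h => hj (Finset.mem_filter.2 ⟨Finset.mem_univ _, h⟩)
    obtain ⟨i, hi⟩ := not_forall.1 hj'
    refine Finset.sum_eq_zero fun b _ => ?_
    rw [h0 i _ (fun m => Pi.single_eq_of_ne (fun h => hi ⟨m, h.symm⟩) _), zero_mul]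

variable [LocallyCompactSpace X] [SecondCountableTopology X] [MeasurableSpace X] [BorelSpace X]
  [IsManifold (𝓡 d) ∞ X] [RiemannianBundle (fun x : X => TangentSpace (𝓡 d) x)]
  [IsContMDiffRiemannianBundle (𝓡 d) ∞ (EuclideanSpace ℝ (Fin d))
      (fun x : X => TangentSpace (𝓡 d) x)]

open FockRep

lemma notMem_remove_range (γ : Configuration X) (y : Fin k → X) (i : Fin k) :
    y i ∉ (γ.remove (range y)).1 := fun h => h.2 (mem_range_self i)

open Classical in
lemma FockRep.Represents.gradConfForm_of_mem {R : FockRep d X n k} {W : ConfForm d X n}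
    (h : R.Represents W) {γ : Configuration X} {y : Fin k → X}
    (hinj : Function.Injective y) (hy : ∀ i, y i ∈ γ.1) {j : Fin n → Fin k}
    (hj : Function.Surjective j) (i : Fin k) (u : TangentSpace (𝓡 d) (y i))
    (e : ∀ m, TangentSpace (𝓡 d) (y (j m))) :
    gradConfForm W γ (y i) u (fun m => DFinsupp.single (y (j m)) (e m)) =
      Real.sqrt (k.factorial : ℝ) * gradPow (isoI W k (γ.remove (range y))) y
        (Pi.single i u) (fun m => Pi.single (j m) (e m)) := by
  refine _root_.gradConfForm_of_mem W γ hinj hy hj i u e ?_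
  obtain ⟨L, hL, -⟩ := h.hasFDerivAt_isoI hinj (notMem_remove_range γ y)
    (fun m => Pi.single (j m) (e m))
  exact hL.differentiableAt

open Classical in
-- Write y = z ∘ j with z injective. If x is one of the z i, the derivatives of the η_i vanish as
-- soon as one z l is off K; otherwise either the gradient of the cylinder function or η_i itself
-- vanishes. This reduces the sums over γ in the inner product to finite sums over γ ∩ K.
lemma gradConfForm_eq_zero {W : ConfForm d X n} {R : ∀ k, FockRep d X n k}
    (h : ∀ k, (R k).Represents W) {K : Set X} (hK : ∀ k ≤ n, (R k).K ⊆ K) {γ : Configuration X}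
    {x : X} (hx : x ∈ γ.1) {y : Fin n → X} (hy : ∀ m, y m ∈ γ.1)
    (hxy : x ∉ K ∨ ∃ m, y m ∉ K) (u : TangentSpace (𝓡 d) x)
    (e : ∀ m, TangentSpace (𝓡 d) (y m)) :
    gradConfForm W γ x u (fun m => DFinsupp.single (y m) (e m)) = 0 := by
  obtain ⟨k, hk, z, hz, j, hj, rfl⟩ := exists_injective_comp_surjective y
  have hzγ : ∀ i, z i ∈ γ.1 := fun i => by
    obtain ⟨m, rfl⟩ := hj i; exact hy m
  by_cases hxz : x ∈ range z
  · obtain ⟨i, rfl⟩ := hxz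
    refine ((h k).gradConfForm_of_mem hz hzγ hj i u e).trans ?_
    have hl : ∃ l, z l ∉ (R k).K := by
      rcases hxy with h1 | ⟨m, hm⟩
      · exact ⟨i, fun h => h1 (hK k hk h)⟩
      · exact ⟨j m, fun h => hm (hK k hk h)⟩
    obtain ⟨l, hl⟩ := hl
    rw [(h k).gradPow_eq hz (notMem_remove_range γ z)]
    refine mul_eq_zero_of_right _ (Finset.sum_eq_zero fun i _ => ?_)
    rw [(R k).gradPow_eta_eq_zero i hl, mul_zero]
  · refine (gradConfForm_of_notMem W γ hzγ hj hxz u e).trans ?_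
    rw [(h k).gradGamma_eq hz (notMem_remove_range γ z) ⟨hx, hxz⟩]
    refine mul_eq_zero_of_right _ (Finset.sum_eq_zero fun i _ => ?_)
    rcases hxy with h1 | ⟨m, hm⟩
    · rw [(R k).grad_eq_zero i _ (fun h => h1 (hK k hk h)), zero_mul]
    · rw [(R k).eta_eq_zero i z ⟨j m, fun h => hm (hK k hk h)⟩]
      exact mul_zero _

lemma FockRep.thetaGamma_eq_zero (R R' : FockRep d X n k) (γ : Configuration X) {x : Fin k → X}
    (hx : ∃ l, x l ∉ R.K) : thetaGamma R R' (γ, x) = 0 := by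
  refine Finset.sum_eq_zero fun i _ => Finset.sum_eq_zero fun j _ => ?_
  refine mul_eq_zero_of_right _ (Finset.sum_eq_zero fun _ _ => Finset.sum_eq_zero fun _ _ => ?_)
  change R.η i x _ * _ = 0
  rw [R.eta_eq_zero i x hx]
  exact zero_mul _

lemma FockRep.thetaPow_eq_zero (R R' : FockRep d X n k) (γ : Configuration X) {x : Fin k → X}
    (hx : ∃ l, x l ∉ R.K) : thetaPow R R' (γ, x) = 0 := by
  obtain ⟨l, hl⟩ := hx
  refine Finset.sum_eq_zero fun i _ => Finset.sum_eq_zero fun j _ => ?_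
  refine mul_eq_zero_of_right _ (Finset.sum_eq_zero fun _ _ => Finset.sum_eq_zero fun _ _ =>
    Finset.sum_eq_zero fun _ _ => Finset.sum_eq_zero fun _ _ => ?_)
  rw [R.gradPow_eta_eq_zero i hl, zero_mul]

/-- The integrand on the right hand side, in terms of representations. -/
def FockRep.theta (R R' : FockRep d X n k) (p : Configuration X × (Fin k → X)) : ℝ :=
  thetaGamma R R' p + thetaPow R R' p

open Classical in
/-- The contribution of the components indexed by the points `y₁, …, y_k`. -/
lemma sum_gradConfForm_eq_theta {W W' : ConfForm d X n} {R R' : ∀ k, FockRep d X n k}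
    (h : ∀ k, (R k).Represents W) (h' : ∀ k, (R' k).Represents W') {K : Set X} (hKc : IsCompact K)
    (hk : (R k).K ⊆ K) (γ : Configuration X) {y : Fin k → X}
    (hinj : Function.Injective y) (hy : ∀ i, y i ∈ γ.restrictFinset hKc) :
    ∑ x ∈ γ.restrictFinset hKc, ∑ a : Fin d, ((k.factorial : ℝ))⁻¹ *
      ∑ j : Fin n → Fin k with Function.Surjective j, ∑ b : Fin n → Fin d,
        gradConfForm W γ x (frame x a)
            (fun m => DFinsupp.single ((y ∘ j) m) (frame ((y ∘ j) m) (b m))) *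
          gradConfForm W' γ x (frame x a)
            (fun m => DFinsupp.single ((y ∘ j) m) (frame ((y ∘ j) m) (b m))) =
      theta (R k) (R' k) (γ.remove (range y), y) := by
  have hyγ : ∀ i, y i ∈ γ.1 := fun i => (Configuration.mem_restrictFinset.1 (hy i)).1
  have hd := notMem_remove_range γ y
  rw [theta, ← (h k).innerGradGamma_eq (h' k) hinj hd, ← (h k).innerGradPow_eq (h' k) hinj hd]
  -- Moved points x outside y give the gradient in γ; those among y give the gradient on X^k, whose
  -- directions are indexed by the factors.
  rw [← Finset.sum_filter_not_add_sum_filter _ (fun x => x ∈ range y)]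
  congr 1
  · unfold innerGradGamma
    rw [tsum_coe_eq_sum ((γ.restrictFinset hKc).filter fun x => x ∉ range y)
      (f := fun z => ∑ a : Fin d, innerPow y
        (gradGamma (isoI W) (γ.remove (range y)) y z (frame z a))
        (gradGamma (isoI W') (γ.remove (range y)) y z (frame z a)))]
    · refine Finset.sum_congr rfl fun x hx => Finset.sum_congr rfl fun a _ => ?_
      have hxy := (Finset.mem_filter.1 hx).2
      exact innerPow_eq_sum_surjective y
        (A := fun j b => gradConfForm W γ x (frame x a)
            (fun m => DFinsupp.single (y (j m)) (frame (y (j m)) (b m))))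
        (B := fun j b => gradConfForm W' γ x (frame x a)
            (fun m => DFinsupp.single (y (j m)) (frame (y (j m)) (b m))))
        (fun j hj b => gradConfForm_of_notMem W γ hyγ hj hxy _ _)
        (fun j hj b => gradConfForm_of_notMem W' γ hyγ hj hxy _ _)
        (fun i v hv => gradGamma_isoI_eq_zero W _ y x _ i hv)
    · intro z hz
      obtain ⟨hz1, hz2⟩ := Finset.mem_filter.1 hz
      exact ⟨(Configuration.mem_restrictFinset.1 hz1).1, hz2⟩
    · intro z hz hzS
      have hzK : z ∉ (R k).K := fun hzK => hzS (Finset.mem_filter.2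
        ⟨Configuration.mem_restrictFinset.2 ⟨hz.1, hk hzK⟩, hz.2⟩)
      refine Finset.sum_eq_zero fun a _ => Finset.sum_eq_zero fun j _ =>
        Finset.sum_eq_zero fun b _ => ?_
      rw [(h k).gradGamma_eq hinj hd hz]
      refine mul_eq_zero_of_left (Finset.sum_eq_zero fun i _ => ?_) _
      rw [(R k).grad_eq_zero i _ hzK, zero_mul]
  · have h1 : (γ.restrictFinset hKc).filter (fun x => x ∈ range y) =
        Finset.univ.map ⟨y, hinj⟩ := by
      ext x
      simp only [Finset.mem_filter, Finset.mem_map, Finset.mem_univ, true_and,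
        Function.Embedding.coeFn_mk, mem_range]
      exact ⟨fun h => h.2, fun h => ⟨by obtain ⟨i, rfl⟩ := h; exact hy i, h⟩⟩
    rw [h1, Finset.sum_map]
    unfold innerGradPow
    refine Finset.sum_congr rfl fun i _ => Finset.sum_congr rfl fun a _ => ?_
    exact innerPow_eq_sum_surjective y
        (A := fun j b => gradConfForm W γ (y i) (frame (y i) a)
            (fun m => DFinsupp.single (y (j m)) (frame (y (j m)) (b m))))
        (B := fun j b => gradConfForm W' γ (y i) (frame (y i) a)
            (fun m => DFinsupp.single (y (j m)) (frame (y (j m)) (b m))))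
        (fun j hj b => (h k).gradConfForm_of_mem hinj hyγ hj i _ _)
        (fun j hj b => (h' k).gradConfForm_of_mem hinj hyγ hj i _ _)
        (fun i v hv => gradPow_isoI_eq_zero W _ y _ i hv)

/-- The pointwise identity behind the formula for the Bochner form. -/
theorem bochnerIntegrand_eq {W W' : ConfForm d X n} {R R' : ∀ k, FockRep d X n k}
    (h : ∀ k, (R k).Represents W) (h' : ∀ k, (R' k).Represents W') (γ : Configuration X) :
    bochnerIntegrand W W' γ = ∑ k ∈ Finset.range (n + 1), ∑' x : Fin k → γ.1,
      {x : Fin k → X | Function.Injective x}.indicator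
        (fun x => theta (R k) (R' k) (γ.remove (range x), x)) (fun i => (x i : X)) := by
  classical
  obtain ⟨K, hKc, hK⟩ : ∃ K, IsCompact K ∧ ∀ k ≤ n, (R k).K ⊆ K :=
    ⟨⋃ k ∈ Finset.range (n + 1), (R k).K,
      (Finset.range (n + 1)).isCompact_biUnion fun k _ => (R k).isCompact_K,
      fun k hk => subset_biUnion_of_mem (u := fun k => (R k).K)
        (Finset.mem_coe.2 (Finset.mem_range.2 (Nat.lt_succ_of_le hk)))⟩
  have hS : ∀ x ∈ γ.restrictFinset hKc, x ∈ γ.1 := fun x hx =>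
    (Configuration.mem_restrictFinset.1 hx).1
  have hnot : ∀ x ∈ γ.1, x ∉ γ.restrictFinset hKc → x ∉ K := fun x hx hxS hxK =>
    hxS (Configuration.mem_restrictFinset.2 ⟨hx, hxK⟩)
  set f : X → Fin d → (Fin n → X) → ℝ := fun x a y => ∑ b : Fin n → Fin d,
        gradConfForm W γ x (frame x a)
            (fun m => DFinsupp.single (y m) (frame (y m) (b m))) *
          gradConfForm W' γ x (frame x a)
            (fun m => DFinsupp.single (y m) (frame (y m) (b m))) with hf
  have hf0 : ∀ x ∈ γ.1, ∀ a y, (∀ m, y m ∈ γ.1) → (x ∉ K ∨ ∃ m, y m ∉ K) → f x a y = 0 := by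
    intro x hx a y hy hxy
    refine Finset.sum_eq_zero fun b _ => ?_
    rw [gradConfForm_eq_zero h hK hx hy hxy, zero_mul]
  have h1 : bochnerIntegrand W W' γ = ∑ x ∈ γ.restrictFinset hKc, ∑ a : Fin d,
      ∑ y ∈ Fintype.piFinset fun _ : Fin n => γ.restrictFinset hKc, f x a y := by
    have h2 : bochnerIntegrand W W' γ = ∑' x : γ.1, ∑ a : Fin d,
        ∑' y : Fin n → γ.1, f x a fun m => y m := rfl
    rw [h2, tsum_coe_eq_sum (γ.restrictFinset hKc) hS
      (f := fun x => ∑ a : Fin d, ∑' y : Fin n → γ.1, f x a fun m => y m)]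
    · refine Finset.sum_congr rfl fun x hx => Finset.sum_congr rfl fun a _ => ?_
      refine tsum_tuple_eq_sum _ hS fun y hy hm => hf0 x (hS x hx) a y hy (Or.inr ?_)
      obtain ⟨m, hm⟩ := hm
      exact ⟨m, hnot _ (hy m) hm⟩
    · intro x hx hxS
      refine Finset.sum_eq_zero fun a _ => ?_
      simp only [hf0 x hx a _ (fun m => Subtype.coe_prop _) (Or.inl (hnot x hx hxS)), tsum_zero]
  rw [h1]
  -- The n-tuples are regrouped by their number k of distinct points; the remaining sums are finite
  -- and are interchanged.
  simp only [sum_tuples]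
  rw [Finset.sum_congr rfl fun x _ => Finset.sum_comm, Finset.sum_comm]
  refine Finset.sum_congr rfl fun k hk => ?_
  have hkn : k ≤ n := Nat.lt_succ_iff.1 (Finset.mem_range.1 hk)
  rw [Finset.sum_congr rfl fun x _ => Finset.sum_comm, Finset.sum_comm]
  rw [tsum_tuple_eq_sum (γ.restrictFinset hKc) hS
    (f := {x : Fin k → X | Function.Injective x}.indicator
        (fun x => theta (R k) (R' k) (γ.remove (range x), x)))]
  · rw [Finset.sum_filter]
    refine Finset.sum_congr rfl fun y hy => ?_
    by_cases hinj : Function.Injective y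
    · rw [if_pos hinj, indicator_of_mem (show y ∈ {x : Fin k → X | Function.Injective x} from hinj)]
      exact sum_gradConfForm_eq_theta h h' hKc (hK k hkn) γ hinj (Fintype.mem_piFinset.1 hy)
    · rw [if_neg hinj, indicator_of_notMem (fun h => hinj h)]
  · intro y hy hm
    obtain ⟨m, hm⟩ := hm
    have hm' : ∃ l, y l ∉ (R k).K := ⟨m, fun hl => hnot _ (hy m) hm (hK k hkn hl)⟩
    refine indicator_apply_eq_zero.2 fun _ => ?_
    simp only [theta, thetaGamma_eq_zero _ _ _ hm', thetaPow_eq_zero _ _ _ hm', add_zero]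

end Pointwise

/-! ### Integrability -/

section Admissible

open Configuration

variable {X : Type*} [MetricSpace X] [LocallyCompactSpace X] [SecondCountableTopology X]
  [MeasurableSpace X] [BorelSpace X] {k : ℕ}

/-- Measurable functions on `Γ_X × X ^ k` with compact support in the second variable, of at most
linear growth in the first one. -/
def Admissible (Θ : Configuration X × (Fin k → X) → ℝ) : Prop :=
  Measurable Θ ∧ ∃ (K : Set X) (C : ℝ) (χ : C_c(X, ℝ)), IsCompact K ∧ 0 ≤ C ∧ (∀ x, 0 ≤ χ x) ∧
    (∀ x ∈ K, 1 ≤ χ x) ∧ (∀ γ x, (∃ i, x i ∉ K) → Θ (γ, x) = 0) ∧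
    ∀ γ x, |Θ (γ, x)| ≤ C * (1 + pairing χ γ)

lemma Admissible.zero : Admissible fun _ : Configuration X × (Fin k → X) => (0 : ℝ) :=
  ⟨measurable_const, ∅, 0, 0, isCompact_empty, le_rfl, fun _ => le_rfl, fun _ h => h.elim,
    fun _ _ _ => rfl, fun _ _ => by simp⟩

lemma Admissible.add {Θ Θ' : Configuration X × (Fin k → X) → ℝ} (h : Admissible Θ)
    (h' : Admissible Θ') : Admissible fun p => Θ p + Θ' p := by
  obtain ⟨hm, K, C, χ, hK, hC, hχ, hχ1, h0, hb⟩ := h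
  obtain ⟨hm', K', C', χ', hK', hC', hχ', hχ1', h0', hb'⟩ := h'
  refine ⟨hm.add hm', K ∪ K', C + C', χ + χ', hK.union hK', add_nonneg hC hC',
    fun x => add_nonneg (hχ x) (hχ' x), ?_, ?_, fun γ x => ?_⟩
  · rintro x (hx | hx)
    · exact (hχ1 x hx).trans (le_add_of_nonneg_right (hχ' x))
    · exact (hχ1' x hx).trans (le_add_of_nonneg_left (hχ x))
  · rintro γ x ⟨i, hi⟩
    simp only [h0 γ x ⟨i, fun h => hi (Or.inl h)⟩, h0' γ x ⟨i, fun h => hi (Or.inr h)⟩, add_zero]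
  · have h1 : pairing (χ + χ' : C_c(X, ℝ)) γ = pairing χ γ + pairing χ' γ :=
      pairing_add_fun γ χ.hasCompactSupport χ'.hasCompactSupport
    have h2 := pairing_nonneg γ hχ
    have h3 := pairing_nonneg γ hχ'
    rw [h1]
    refine (abs_add_le _ _).trans ((add_le_add (hb γ x) (hb' γ x)).trans ?_)
    nlinarith [mul_nonneg hC h3, mul_nonneg hC' h2]

lemma Admissible.sum {ι : Type*} (s : Finset ι) {Θ : ι → Configuration X × (Fin k → X) → ℝ}
    (h : ∀ i, Admissible (Θ i)) : Admissible fun p => ∑ i ∈ s, Θ i p := by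
  classical
  induction s using Finset.induction_on with
  | empty => simpa using Admissible.zero
  | insert i s hi ih =>
    simp only [Finset.sum_insert hi]
    exact (h i).add ih

lemma Admissible.mul {f : Configuration X → ℝ} (hf : Measurable f) {C : ℝ} {χ : C_c(X, ℝ)}
    (hC : 0 ≤ C) (hχ : ∀ x, 0 ≤ χ x) (hfb : ∀ γ, |f γ| ≤ C * (1 + pairing χ γ))
    {g : (Fin k → X) → ℝ} (hg : Continuous g) {K : Set X} (hK : IsCompact K)
    (hgK : ∀ x, (∃ i, x i ∉ K) → g x = 0) :
    Admissible fun p : Configuration X × (Fin k → X) => f p.1 * g p.2 := by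
  obtain ⟨χ₁, h1, -, hc, h01⟩ := exists_continuous_one_zero_of_isCompact hK isClosed_empty
    (disjoint_empty K)
  obtain ⟨M, hM⟩ := (isCompact_univ_pi fun _ : Fin k => hK).exists_bound_of_continuousOn
    hg.continuousOn
  have hM' : ∀ x, |g x| ≤ |M| := by
    intro x
    by_cases hx : ∃ i, x i ∉ K
    · rw [hgK x hx, abs_zero]; exact abs_nonneg _
    · push Not at hx
      exact (hM x fun i _ => hx i).trans (le_abs_self _)
  -- χ controls the growth of f but may vanish on K; χ₂ is added because the dominating function
  -- must be at least 1 on K in order to count the points there.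
  let χ₂ : C_c(X, ℝ) := ⟨χ₁, hc⟩
  have hχ₂ : ∀ x, 0 ≤ χ₂ x := fun x => (h01 x).1
  refine ⟨(hf.comp measurable_fst).mul (hg.measurable.comp measurable_snd), K, C * |M|, χ + χ₂, hK,
    mul_nonneg hC (abs_nonneg _), fun x => add_nonneg (hχ x) (hχ₂ x), fun x hx => ?_,
    fun γ x hx => ?_, fun γ x => ?_⟩
  · exact (h1 hx).symm.le.trans (le_add_of_nonneg_left (hχ x))
  · simp only [hgK x hx, mul_zero]
  · have h1 : pairing (χ + χ₂ : C_c(X, ℝ)) γ = pairing χ γ + pairing χ₂ γ :=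
      pairing_add_fun γ χ.hasCompactSupport χ₂.hasCompactSupport
    have h3 := pairing_nonneg γ hχ₂
    rw [h1, abs_mul]
    refine (mul_le_mul (hfb γ) (hM' x) (abs_nonneg _) ((abs_nonneg _).trans (hfb γ))).trans ?_
    have := mul_nonneg (mul_nonneg hC (abs_nonneg M)) h3
    linarith

variable {μ : Measure (Configuration X)} [SFinite μ] {σ : Kernel (Configuration X) X}
  [IsSFiniteKernel σ]

lemma Admissible.integral_muPow {Θ : Configuration X × (Fin k → X) → ℝ} (h : Admissible Θ)
    (hm : MeckeIdentity μ σ) (h0 : ∀ᵐ γ ∂μ, ∀ᵐ y ∂(σ γ), y ∉ γ.1)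
    (hmom : ∀ (k : ℕ) (φ : C_c(X, ℝ)), (∀ x, 0 ≤ φ x) →
      Integrable (fun γ => Configuration.pairing φ γ ^ k) μ) :
    Integrable Θ (muPow μ σ k) ∧
    Integrable (fun γ => ∑' x : Fin k → γ.1, {x : Fin k → X | Function.Injective x}.indicator
        (fun x => Θ (γ.remove (range x), x)) (fun i => (x i : X))) μ ∧
    ∫ γ, ∑' x : Fin k → γ.1, {x : Fin k → X | Function.Injective x}.indicator
        (fun x => Θ (γ.remove (range x), x)) (fun i => (x i : X)) ∂μ =
      ∫ p, Θ p ∂(muPow μ σ k) := by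
  obtain ⟨hΘ, K, C, χ, hK, hC, hχ, hχ1, hs, hb⟩ := h
  exact hm.integral_muPow h0 hΘ hK hs hC hχ hχ1 hb fun j => hmom j χ hχ

end Admissible

namespace FockRep

variable {d : ℕ} {X : Type*} [MetricSpace X] [ChartedSpace (EuclideanSpace ℝ (Fin d)) X] {n k : ℕ}
  [LocallyCompactSpace X] [SecondCountableTopology X] [MeasurableSpace X] [BorelSpace X]
  [IsManifold (𝓡 d) ∞ X] [RiemannianBundle (fun x : X => TangentSpace (𝓡 d) x)]
  [IsContMDiffRiemannianBundle (𝓡 d) ∞ (EuclideanSpace ℝ (Fin d))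
      (fun x : X => TangentSpace (𝓡 d) x)]

lemma admissible_thetaGamma (R R' : FockRep d X n k) : Admissible (thetaGamma R R') := by
  refine Admissible.sum _ fun i => Admissible.sum _ fun j => ?_
  obtain ⟨C, χ, hC, hχ, hb⟩ := (R.c i).exists_abs_carre_le (R'.c j)
  refine Admissible.mul ((R.c i).continuous_carre (R'.c j)).measurable hC hχ
    (fun γ => (hb γ).trans (mul_le_mul_of_nonneg_left (by linarith) hC))
    ((R.smooth i).continuous_innerPow (R'.smooth j)) R.isCompact_K fun x hx => ?_
  refine Finset.sum_eq_zero fun _ _ => Finset.sum_eq_zero fun _ _ => ?_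
  rw [R.eta_eq_zero i x hx]
  exact zero_mul _

lemma admissible_thetaPow (R R' : FockRep d X n k) : Admissible (thetaPow R R') := by
  refine Admissible.sum _ fun i => Admissible.sum _ fun j => ?_
  obtain ⟨C, hC⟩ := (R.c i).exists_abs_eval_le
  obtain ⟨C', hC'⟩ := (R'.c j).exists_abs_eval_le
  refine Admissible.mul (f := fun γ => (R.c i).eval γ * (R'.c j).eval γ)
    ((R.c i).continuous_eval.mul (R'.c j).continuous_eval).measurable
    (C := |C| * |C'|) (χ := 0) (by positivity) (fun _ => le_rfl) (fun γ => ?_)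
    ((R.smooth i).continuous_innerGradPow (R'.smooth j)) R.isCompact_K fun x hx => ?_
  · have h0 : Configuration.pairing (0 : C_c(X, ℝ)) γ = 0 :=
      (Configuration.pairing_eq_sum γ _ ∅ (by simp) (by intro x _ _; rfl)).trans (by simp)
    rw [h0, add_zero, mul_one, abs_mul]
    exact mul_le_mul ((hC γ).trans (le_abs_self _)) ((hC' γ).trans (le_abs_self _)) (abs_nonneg _)
      (abs_nonneg _)
  · obtain ⟨l, hl⟩ := hx
    refine Finset.sum_eq_zero fun _ _ => Finset.sum_eq_zero fun _ _ =>
      Finset.sum_eq_zero fun _ _ => Finset.sum_eq_zero fun _ _ => ?_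
    rw [R.gradPow_eta_eq_zero i hl, zero_mul]

lemma admissible_theta (R R' : FockRep d X n k) : Admissible (theta R R') :=
  (admissible_thetaGamma R R').add (admissible_thetaPow R R')

end FockRep

lemma ae_compProd_of_ae_left {α β : Type*} [MeasurableSpace α] [MeasurableSpace β]
    {μ : Measure α} {κ : Kernel α β} {p : α → Prop} (h : ∀ᵐ a ∂μ, p a) :
    ∀ᵐ x ∂(μ ⊗ₘ κ), p x.1 := by
  have h1 := Measure.ae_compProd_of_ae_fst κ (p := fun a => a ∉ toMeasurable μ {a | ¬ p a})
    (measurableSet_toMeasurable _ _).compl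
    (measure_eq_zero_iff_ae_notMem.1 (by rw [measure_toMeasurable]; exact h))
  filter_upwards [h1] with x hx
  by_contra hp
  exact hx (subset_toMeasurable μ _ hp)

/-! ### Independence of the representative -/

section Forms

variable {d : ℕ} {X : Type*} [MetricSpace X] [ChartedSpace (EuclideanSpace ℝ (Fin d)) X] {n k : ℕ}
  [IsManifold (𝓡 d) ∞ X] [RiemannianBundle (fun x : X => TangentSpace (𝓡 d) x)]
  [IsContMDiffRiemannianBundle (𝓡 d) ∞ (EuclideanSpace ℝ (Fin d))
      (fun x : X => TangentSpace (𝓡 d) x)]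

lemma eq_zero_of_innerPow_self {x : Fin k → X} {α : PowFormAt d n x} (h : innerPow x α α = 0) :
    α = 0 := by
  rw [innerPow_eq_sum] at h
  have h1 : ∀ J : Fin n → Σ _ : Fin k, Fin d, α (fun m => powFrame x (J m)) = 0 := fun J => by
    have := (Finset.sum_eq_zero_iff_of_nonneg fun J _ => mul_self_nonneg _).1 h J
      (Finset.mem_univ J)
    exact mul_self_eq_zero.1 this
  have h2 : α.toMultilinearMap = 0 := by
    refine Module.Basis.ext_multilinear
      (fun _ => Pi.basis fun i => (frame (x i)).toBasis) fun J => ?_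
    refine Eq.trans ?_ (h1 J)
    change α _ = α _
    congr 1
    funext m
    rw [Pi.basis_apply, OrthonormalBasis.coe_toBasis]
    rfl
  exact AlternatingMap.coe_multilinearMap_injective h2

end Forms

namespace FockRep

open Configuration

variable {d : ℕ} {X : Type*} [MetricSpace X] [ChartedSpace (EuclideanSpace ℝ (Fin d)) X] {n k : ℕ}
  [LocallyCompactSpace X] [SecondCountableTopology X] [MeasurableSpace X] [BorelSpace X]
  [IsManifold (𝓡 d) ∞ X] [RiemannianBundle (fun x : X => TangentSpace (𝓡 d) x)]
  [IsContMDiffRiemannianBundle (𝓡 d) ∞ (EuclideanSpace ℝ (Fin d))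
      (fun x : X => TangentSpace (𝓡 d) x)]

local notation "𝔼" => EuclideanSpace ℝ (Fin d)

lemma smoothForm_val_sub (R S : FockRep d X n k) (γ : Configuration X) :
    SmoothForm fun y => R.val γ y - S.val γ y := by
  intro x v
  have h : ∀ R : FockRep d X n k, ContDiffOn ℝ ∞ (fun q : Fin k → 𝔼 =>
      R.val γ (fun i => pointAt (x i) (q i)) fun m i => vecAt (x i) (q i) (v m i)) (prodDom x) := by
    intro R
    simp only [val_apply]
    exact ContDiffOn.sum fun i _ => contDiffOn_const.mul (R.smooth i x v)
  exact (h R).sub (h S)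

variable {μ : Measure (Configuration X)} [SFinite μ] {σ : Kernel (Configuration X) X}
  [IsSFiniteKernel σ]

/-- For fixed γ, the squared norm of the difference is continuous in x. It vanishes almost
everywhere for a measure charging all nonempty open sets, hence everywhere, also where points
coincide. -/
lemma ae_val_eq (hm : MeckeIdentity μ σ) (h0 : ∀ᵐ γ ∂μ, ∀ᵐ y ∂(σ γ), y ∉ γ.1)
    (hσ : ∀ᵐ γ ∂μ, ∀ U : Set X, IsOpen U → U.Nonempty → σ γ U ≠ 0)
    {R S : FockRep d X n k} {W V : ConfForm d X n} (hR : R.Represents W) (hS : S.Represents V)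
    (h : ∀ᵐ p ∂(muPow μ σ k), isoI W k p.1 p.2 = isoI V k p.1 p.2) :
    ∀ᵐ γ ∂μ, ∀ y : Fin k → X, R.val γ y = S.val γ y := by
  rw [muPow_eq_compProd] at h
  filter_upwards [Measure.ae_ae_of_ae_compProd h, hm.ae_injective_disjoint' h0 k,
    hm.ae_isOpenPos hσ k] with γ h1 h2 h3 y
  set η : ∀ y : Fin k → X, PowFormAt d n y := fun y => R.val γ y - S.val γ y with hη
  have hs : SmoothForm η := smoothForm_val_sub R S γ
  have ho : IsOpen {y | innerPow y (η y) (η y) ≠ 0} :=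
    isOpen_ne_fun (hs.continuous_innerPow hs) continuous_const
  by_contra hne
  refine h3 _ ho ⟨y, fun h => hne (sub_eq_zero.1 (eq_zero_of_innerPow_self h))⟩ ?_
  refine measure_eq_zero_iff_ae_notMem.2 ?_
  filter_upwards [h1, h2] with x hx hx' hxU
  refine hxU ?_
  have h4 : η x = 0 := by
    rw [hη]
    exact sub_eq_zero.2 ((hR.isoI_eq hx'.1 hx'.2).symm.trans (hx.trans (hS.isoI_eq hx'.1 hx'.2)))
  refine Finset.sum_eq_zero fun _ _ => Finset.sum_eq_zero fun _ _ => ?_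
  rw [h4]
  exact zero_mul _

/-- The gradient in γ compares values at configurations with a point moved arbitrarily, so equality
for almost every added point is not enough. For fixed γ and x both sides are continuous in y, as
`evalAdd` shows, and σ(γ) charges all nonempty open sets. -/
lemma ae_val_addPoint_eq (hm : MeckeIdentity μ σ) (h0 : ∀ᵐ γ ∂μ, ∀ᵐ y ∂(σ γ), y ∉ γ.1)
    (hσ : ∀ᵐ γ ∂μ, ∀ U : Set X, IsOpen U → U.Nonempty → σ γ U ≠ 0)
    {R S : FockRep d X n k} (h : ∀ᵐ γ ∂μ, ∀ x : Fin k → X, R.val γ x = S.val γ x) :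
    ∀ᵐ γ ∂μ, ∀ y ∉ γ.1, ∀ x : Fin k → X, R.val (γ.addPoint y) x = S.val (γ.addPoint y) x := by
  filter_upwards [hm.ae_addPoint h, h0, hσ] with γ h1 h2 h3 y hy x
  refine AlternatingMap.ext fun v => ?_
  have hval : ∀ (R : FockRep d X n k) (y : X), y ∉ γ.1 → R.val (γ.addPoint y) x v =
      ∑ i, (R.c i).evalAdd γ y * R.η i x v := fun R y hy => by
    rw [val_apply]
    exact Finset.sum_congr rfl fun i _ => by rw [(R.c i).eval_addPoint hy]
  have hcont : ∀ R : FockRep d X n k, Continuous fun y => ∑ i, (R.c i).evalAdd γ y * R.η i x v :=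
    fun R => continuous_finsetSum _ fun i _ => ((R.c i).continuous_evalAdd γ).mul continuous_const
  rw [hval R y hy, hval S y hy]
  by_contra hne
  refine h3 {y | ∑ i, (R.c i).evalAdd γ y * R.η i x v ≠ ∑ i, (S.c i).evalAdd γ y * S.η i x v}
    (isOpen_ne_fun (hcont R) (hcont S)) ⟨y, hne⟩ (measure_eq_zero_iff_ae_notMem.2 ?_)
  filter_upwards [h1, h2] with z hz hz' hzU
  exact hzU (by rw [← hval R z hz', ← hval S z hz', hz x])

/-- The gradients do not depend on the choice of a form within its class. -/
theorem ae_gradients_eq (hm : MeckeIdentity μ σ) (h0 : ∀ᵐ γ ∂μ, ∀ᵐ y ∂(σ γ), y ∉ γ.1)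
    (hσ : ∀ᵐ γ ∂μ, ∀ U : Set X, IsOpen U → U.Nonempty → σ γ U ≠ 0)
    {R S : FockRep d X n k} {W V : ConfForm d X n} (hR : R.Represents W) (hS : S.Represents V)
    (h : ∀ᵐ p ∂(muPow μ σ k), isoI W k p.1 p.2 = isoI V k p.1 p.2) :
    ∀ᵐ p ∂(muPow μ σ k), (∀ z ∈ p.1.1, gradGamma (isoI W) p.1 p.2 z =
      gradGamma (isoI V) p.1 p.2 z) ∧ gradPow (isoI W k p.1) p.2 = gradPow (isoI V k p.1) p.2 := by
  have h1 := ae_val_eq hm h0 hσ hR hS h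
  -- Applied to γ - ε_z in place of γ: for a.e. γ, the sums agree at γ - ε_z + ε_y for every z ∈ γ
  -- and every y not in γ - ε_z.
  have h2 := hm.ae_forall_remove h0 (ae_val_addPoint_eq hm h0 hσ h1)
  have h3 := ae_compProd_of_ae_left (κ := sigmaKernel σ k) (h1.and h2)
  rw [← muPow_eq_compProd] at h3
  filter_upwards [h3, hm.ae_injective_disjoint h0 k] with p hp hd
  obtain ⟨γ, x⟩ := p
  obtain ⟨hx, hγ⟩ := hd
  refine ⟨fun z hz => funext fun u => funext fun v => ?_, funext fun u => funext fun v => ?_⟩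
  · have hzx : z ∉ range x := by rintro ⟨i, rfl⟩; exact hγ i hz
    have e : (fun q : 𝔼 => isoI W k (γ.move z (pointAt z q)) x v) =ᶠ[𝓝 (coordAt d z)]
        fun q => isoI V k (γ.move z (pointAt z q)) x v := by
      filter_upwards [(tendsto_pointAt z).eventually
        ((finite_range x).isClosed.isOpen_compl.mem_nhds hzx),
        γ.eventually_pointAt_notMem z] with q hq hq'
      have hd : ∀ i, x i ∉ (γ.move z (pointAt z q)).1 := by
        intro i hi
        rcases Configuration.mem_move.1 hi with hi | ⟨hi, -⟩
        · exact hq ⟨i, hi⟩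
        · exact hγ i hi
      rw [hR.isoI_eq hx hd, hS.isoI_eq hx hd]
      exact congrArg (fun α : PowFormAt d n x => α v) (hp.2 z hz _ hq' x)
    simp only [gradGamma, e.fderiv_eq]
  · unfold gradPow
    rw [Filter.EventuallyEq.fderiv_eq]
    filter_upwards [eventually_injective_disjoint hx hγ] with q hq
    rw [hR.isoI_eq hq.1 hq.2, hS.isoI_eq hq.1 hq.2, hp.1]

end FockRep

/-! ### Assembling the formula -/

section Main

open FockRep

variable {d : ℕ} {X : Type*} [MetricSpace X] [ChartedSpace (EuclideanSpace ℝ (Fin d)) X] {n : ℕ}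
  [LocallyCompactSpace X] [SecondCountableTopology X] [MeasurableSpace X] [BorelSpace X]
  [IsManifold (𝓡 d) ∞ X] [RiemannianBundle (fun x : X => TangentSpace (𝓡 d) x)]
  [IsContMDiffRiemannianBundle (𝓡 d) ∞ (EuclideanSpace ℝ (Fin d))
      (fun x : X => TangentSpace (𝓡 d) x)]
  {μ : Measure (Configuration X)} [SFinite μ] {σ : Kernel (Configuration X) X}
  [IsSFiniteKernel σ]

/-- For `n ≥ 1` there is no contribution of `k = 0`. -/
lemma FockRep.theta_zero_eq_zero (hn : n ≠ 0) (R R' : FockRep d X n 0)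
    (p : Configuration X × (Fin 0 → X)) : theta R R' p = 0 := by
  have h : IsEmpty (Fin n → Fin 0) := ⟨fun f => (f ⟨0, Nat.pos_of_ne_zero hn⟩).elim0⟩
  simp [theta, thetaGamma, thetaPow, innerPow, innerGradPow]

lemma DOmega_zero (d : ℕ) (X : Type*) [MetricSpace X] [ChartedSpace (EuclideanSpace ℝ (Fin d)) X] :
    DOmega d X 0 = ⊥ := by
  rw [DOmega, Submodule.span_eq_bot]
  rintro W ⟨k, F, η, h1, h2, -⟩
  omega

/-- The Bochner form in terms of the image under `Iⁿ`. -/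
theorem integral_bochnerIntegrand (hm : MeckeIdentity μ σ)
    (h0 : ∀ᵐ γ ∂μ, ∀ᵐ y ∂(σ γ), y ∉ γ.1)
    (hmom : ∀ (k : ℕ) (φ : C_c(X, ℝ)), (∀ x, 0 ≤ φ x) →
      Integrable (fun γ => Configuration.pairing φ γ ^ k) μ)
    {W W' : ConfForm d X n} (hW : W ∈ DOmega d X n) (hW' : W' ∈ DOmega d X n) :
    Integrable (bochnerIntegrand W W') μ ∧
    (∀ k, Integrable (fun p : Configuration X × (Fin k → X) =>
        innerGradGamma p.1 p.2 (gradGamma (isoI W) p.1 p.2) (gradGamma (isoI W') p.1 p.2))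
          (muPow μ σ k) ∧
      Integrable (fun p : Configuration X × (Fin k → X) =>
        innerGradPow p.2 (gradPow (isoI W k p.1) p.2) (gradPow (isoI W' k p.1) p.2))
          (muPow μ σ k)) ∧
    bochnerForm μ W W' = ∑ k ∈ Finset.Icc 1 n, ∫ p : Configuration X × (Fin k → X),
        (innerGradGamma p.1 p.2 (gradGamma (isoI W) p.1 p.2) (gradGamma (isoI W') p.1 p.2)
          + innerGradPow p.2 (gradPow (isoI W k p.1) p.2) (gradPow (isoI W' k p.1) p.2))
        ∂(muPow μ σ k) := by
  choose R hR using fun k => exists_fockRep hW k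
  choose R' hR' using fun k => exists_fockRep hW' k
  have hae : ∀ k, ∀ᵐ p ∂(muPow μ σ k),
      innerGradGamma p.1 p.2 (gradGamma (isoI W) p.1 p.2) (gradGamma (isoI W') p.1 p.2) =
        thetaGamma (R k) (R' k) p ∧
      innerGradPow p.2 (gradPow (isoI W k p.1) p.2) (gradPow (isoI W' k p.1) p.2) =
        thetaPow (R k) (R' k) p := by
    intro k
    filter_upwards [hm.ae_injective_disjoint h0 k] with p hp
    exact ⟨(hR k).innerGradGamma_eq (hR' k) hp.1 hp.2, (hR k).innerGradPow_eq (hR' k) hp.1 hp.2⟩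
  have hbi : bochnerIntegrand W W' = fun γ => ∑ k ∈ Finset.range (n + 1),
      ∑' x : Fin k → γ.1, {x : Fin k → X | Function.Injective x}.indicator
        (fun x => theta (R k) (R' k) (γ.remove (range x), x)) (fun i => (x i : X)) :=
    funext (bochnerIntegrand_eq hR hR')
  have hint : ∀ k, Integrable (fun γ : Configuration X =>
      ∑' x : Fin k → γ.1, {x : Fin k → X | Function.Injective x}.indicator
        (fun x => theta (R k) (R' k) (γ.remove (range x), x)) (fun i => (x i : X))) μ := fun k =>
    ((admissible_theta (R k) (R' k)).integral_muPow hm h0 hmom).2.1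
  refine ⟨?_, fun k => ⟨?_, ?_⟩, ?_⟩
  · rw [hbi]
    exact integrable_finsetSum _ fun k _ => hint k
  · exact ((admissible_thetaGamma (R k) (R' k)).integral_muPow hm h0 hmom).1.congr
      ((hae k).mono fun p hp => hp.1.symm)
  · exact ((admissible_thetaPow (R k) (R' k)).integral_muPow hm h0 hmom).1.congr
      ((hae k).mono fun p hp => hp.2.symm)
  -- The pointwise identity includes k = 0, which the formula omits. For n ≥ 1 this term vanishes
  -- because there is no map from Fin n to Fin 0; for n = 0 the space of forms is trivial.
  · by_cases hn : n = 0
    · subst hn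
      rw [DOmega_zero, Submodule.mem_bot] at hW hW'
      subst hW hW'
      have h1 : bochnerIntegrand (0 : ConfForm d X 0) 0 = fun _ => 0 := by
        funext γ
        have h2 : ∀ x u v, gradConfForm (0 : ConfForm d X 0) γ x u v = 0 := fun x u v => by
          simp [gradConfForm]
        simp [bochnerIntegrand, innerGradConf, innerConf, h2]
      rw [bochnerForm, h1]
      simp
    · rw [bochnerForm, hbi, integral_finsetSum _ fun k _ => hint k, Finset.sum_range_eq_add_Ico _
        (Nat.succ_pos n)]
      have h1 : ∫ γ : Configuration X, ∑' x : Fin 0 → γ.1,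
          {x : Fin 0 → X | Function.Injective x}.indicator
            (fun x => theta (R 0) (R' 0) (γ.remove (range x), x)) (fun i => (x i : X)) ∂μ = 0 := by
        simp [theta_zero_eq_zero hn]
      rw [h1, zero_add]
      refine Finset.sum_congr rfl fun k _ => ?_
      rw [((admissible_theta (R k) (R' k)).integral_muPow hm h0 hmom).2.2]
      refine integral_congr_ae ((hae k).mono fun p hp => ?_)
      exact (congrArg₂ (· + ·) hp.1 hp.2).symm

/-- The right hand side depends on the classes only. -/
theorem ae_integrand_eq (hm : MeckeIdentity μ σ) (h0 : ∀ᵐ γ ∂μ, ∀ᵐ y ∂(σ γ), y ∉ γ.1)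
    (hσ : ∀ᵐ γ ∂μ, ∀ U : Set X, IsOpen U → U.Nonempty → σ γ U ≠ 0)
    {W V W' V' : ConfForm d X n} (hW : W ∈ DOmega d X n) (hV : V ∈ DOmega d X n)
    (hW' : W' ∈ DOmega d X n) (hV' : V' ∈ DOmega d X n)
    (h : SameClass μ σ (isoI W) (isoI V)) (h' : SameClass μ σ (isoI W') (isoI V')) {k : ℕ}
    (hk : k ∈ Finset.Icc 1 n) :
    ∀ᵐ p ∂(muPow μ σ k),
      innerGradGamma p.1 p.2 (gradGamma (isoI W) p.1 p.2) (gradGamma (isoI W') p.1 p.2)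
          + innerGradPow p.2 (gradPow (isoI W k p.1) p.2) (gradPow (isoI W' k p.1) p.2) =
      innerGradGamma p.1 p.2 (gradGamma (isoI V) p.1 p.2) (gradGamma (isoI V') p.1 p.2)
          + innerGradPow p.2 (gradPow (isoI V k p.1) p.2) (gradPow (isoI V' k p.1) p.2) := by
  obtain ⟨R, hR⟩ := exists_fockRep hW k
  obtain ⟨S, hS⟩ := exists_fockRep hV k
  obtain ⟨R', hR'⟩ := exists_fockRep hW' k
  obtain ⟨S', hS'⟩ := exists_fockRep hV' k
  have h1 := ae_gradients_eq hm h0 hσ hR hS (h k hk)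
  have h2 := ae_gradients_eq hm h0 hσ hR' hS' (h' k hk)
  filter_upwards [h1, h2] with p hp hp'
  refine congrArg₂ (· + ·) ?_ ?_
  · refine tsum_congr fun z => Finset.sum_congr rfl fun a _ => ?_
    rw [hp.1 z z.2, hp'.1 z z.2]
  · rw [hp.2, hp'.2]

end Main

end

theorem proposition3p8 {d : ℕ} {X : Type*} [MetricSpace X] [CompleteSpace X] [ConnectedSpace X]
    [SecondCountableTopology X]
    [ChartedSpace (EuclideanSpace ℝ (Fin d)) X] [IsManifold (𝓡 d) ∞ X]
    [RiemannianBundle (fun x : X => TangentSpace (𝓡 d) x)]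
    [IsContMDiffRiemannianBundle (𝓡 d) ∞ (EuclideanSpace ℝ (Fin d))
      (fun x : X => TangentSpace (𝓡 d) x)]
    [IsRiemannianManifold (𝓡 d) X]
    [MeasurableSpace X] [BorelSpace X]
    (hvol : riemannianVolume d X Set.univ = ⊤)
    (μ : Measure (Configuration X)) [IsProbabilityMeasure μ]
    (hmom : ∀ (k : ℕ) (φ : C_c(X, ℝ)), (∀ x, 0 ≤ φ x) →
      Integrable (fun γ => Configuration.pairing φ γ ^ k) μ)
    (σ : Kernel (Configuration X) X) [IsSFiniteKernel σ]
    (hac : ∀ᵐ γ ∂μ, σ γ ≪ riemannianVolume d X)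
    (hmecke : MeckeIdentity μ σ)
    (hpos : ∀ᵐ γ ∂μ, ∀ᵐ x ∂(riemannianVolume d X), 0 < (σ γ).rnDeriv (riemannianVolume d X) x)
    (n : ℕ) (𝒲₁ 𝒲₂ : FockForm d X n)
    (h₁ : 𝒲₁ ∈ isoI '' (DOmega d X n : Set (ConfForm d X n)))
    (h₂ : 𝒲₂ ∈ isoI '' (DOmega d X n : Set (ConfForm d X n))) :
    -- `bochnerFormImage` is well defined on classes, and is the image of the Bochner form
    (∀ W₁ ∈ DOmega d X n, ∀ W₂ ∈ DOmega d X n,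
      SameClass μ σ (isoI W₁) 𝒲₁ → SameClass μ σ (isoI W₂) 𝒲₂ →
        Integrable (bochnerIntegrand W₁ W₂) μ ∧
        bochnerFormImage μ σ 𝒲₁ 𝒲₂ = bochnerForm μ W₁ W₂) ∧
    -- the integrals on the right hand side exist
    (∀ k ∈ Finset.Icc 1 n,
      Integrable (fun p : Configuration X × (Fin k → X) =>
        innerGradGamma p.1 p.2 (gradGamma 𝒲₁ p.1 p.2) (gradGamma 𝒲₂ p.1 p.2)) (muPow μ σ k) ∧
      Integrable (fun p : Configuration X × (Fin k → X) =>
        innerGradPow p.2 (gradPow (𝒲₁ k p.1) p.2) (gradPow (𝒲₂ k p.1) p.2)) (muPow μ σ k)) ∧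
    bochnerFormImage μ σ 𝒲₁ 𝒲₂ =
      ∑ k ∈ Finset.Icc 1 n, ∫ p : Configuration X × (Fin k → X),
        (innerGradGamma p.1 p.2 (gradGamma 𝒲₁ p.1 p.2) (gradGamma 𝒲₂ p.1 p.2)
          + innerGradPow p.2 (gradPow (𝒲₁ k p.1) p.2) (gradPow (𝒲₂ k p.1) p.2))
        ∂(muPow μ σ k) := by
  have hlc : LocallyCompactSpace X :=
    ChartedSpace.locallyCompactSpace (EuclideanSpace ℝ (Fin d)) X
  have hd : d ≠ 0 := dim_ne_zero hvol
  have h0 := ae_notMem_of_absolutelyContinuous hd hac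
  have hσ := ae_isOpenPos_of_rnDeriv_pos hpos
  obtain ⟨V₁, hV₁, rfl⟩ := h₁
  obtain ⟨V₂, hV₂, rfl⟩ := h₂
  -- `bochnerFormImage` is evaluated at chosen forms, which may differ from V₁ and V₂. The formula
  -- is therefore proved for all W₁, W₂ in the classes, with a right hand side written in V₁ and V₂
  -- only; this gives at once the formula and the independence of the choice.
  have key : ∀ W₁ ∈ DOmega d X n, ∀ W₂ ∈ DOmega d X n, SameClass μ σ (isoI W₁) (isoI V₁) →
      SameClass μ σ (isoI W₂) (isoI V₂) → bochnerForm μ W₁ W₂ =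
        ∑ k ∈ Finset.Icc 1 n, ∫ p : Configuration X × (Fin k → X),
        (innerGradGamma p.1 p.2 (gradGamma (isoI V₁) p.1 p.2) (gradGamma (isoI V₂) p.1 p.2)
          + innerGradPow p.2 (gradPow (isoI V₁ k p.1) p.2) (gradPow (isoI V₂ k p.1) p.2))
        ∂(muPow μ σ k) := by
    intro W₁ hW₁ W₂ hW₂ h₁ h₂
    rw [(integral_bochnerIntegrand hmecke h0 hmom hW₁ hW₂).2.2]
    exact Finset.sum_congr rfl fun k hk =>
      integral_congr_ae (ae_integrand_eq hmecke h0 hσ hW₁ hV₁ hW₂ hV₂ h₁ h₂ hk)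
  have himage : bochnerFormImage μ σ (isoI V₁) (isoI V₂) =
      ∑ k ∈ Finset.Icc 1 n, ∫ p : Configuration X × (Fin k → X),
        (innerGradGamma p.1 p.2 (gradGamma (isoI V₁) p.1 p.2) (gradGamma (isoI V₂) p.1 p.2)
          + innerGradPow p.2 (gradPow (isoI V₁ k p.1) p.2) (gradPow (isoI V₂ k p.1) p.2))
        ∂(muPow μ σ k) := by
    have hex : (∃ W ∈ DOmega d X n, SameClass μ σ (isoI W) (isoI V₁)) ∧
        (∃ W ∈ DOmega d X n, SameClass μ σ (isoI W) (isoI V₂)) :=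
      ⟨⟨V₁, hV₁, fun k _ => Filter.Eventually.of_forall fun _ => rfl⟩,
        ⟨V₂, hV₂, fun k _ => Filter.Eventually.of_forall fun _ => rfl⟩⟩
    rw [bochnerFormImage, dif_pos hex]
    exact key _ hex.1.choose_spec.1 _ hex.2.choose_spec.1 hex.1.choose_spec.2 hex.2.choose_spec.2
  refine ⟨fun W₁ hW₁ W₂ hW₂ h₁ h₂ => ⟨(integral_bochnerIntegrand hmecke h0 hmom hW₁ hW₂).1,
    himage.trans (key W₁ hW₁ W₂ hW₂ h₁ h₂).symm⟩,
    fun k _ => (integral_bochnerIntegrand hmecke h0 hmom hV₁ hV₂).2.1 k, himage⟩
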